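/- Let $n,d,p$ be natural numbers, $\mathfrak h=L^2(\mathbb R^d;\mathbb C^p)$, let $\omega:\mathbb R^d\to[0,\infty)$ be measurable and a.e. nonzero, and let $\mathfrak h_\omega=\{h\in\mathfrak h:\|h\|_\omega<\infty\}$ with $\|h\|_\omega=(\|h\|^2+\|h/\sqrt\omega\|^2)^{1/2}$. Let $\mathcal F=\bigoplus_{m\ge0}\mathcal F_m$ be the symmetric Fock space over $\mathfrak h$ and $\mathcal H=L^2(\mathbb R^n)\otimes\mathcal F\cong L^2(\mathbb R^n;\mathcal F)$. Let $H_f=d\Gamma(M_\omega)$ be the second quantization of multiplication by $\omega$ (on $\mathcal F_m$: multiplication by $\omega(k_1)+\dots+\omega(k_m)$), let $p_j=-i\partial_j$ with domain the functions in $\mathcal H$ whose distributional derivative $\partial_j$ lies in $\mathcal H$, and let $p^2=\sum_j p_j^2$ with domain $H^2(\mathbb R^n;\mathcal F)$; $p_j$, $p^2$ and $H_f$ are all regarded as operators in $\mathcal H$. For $h\in\mathfrak h$ let $a^*(h)$ be the closure of the operator given on $\mathcal F_m$ by $\varphi\mapsto(m+1)^{1/2}S_{m+1}(h\otimes\varphi)$,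 where $S_{m+1}$ is the orthogonal projection onto symmetric tensors, let $a(h)$ be its adjoint, and let $\phi(h)$ be the closure of $2^{-1/2}(a(h)+a^*(h))$ on the vectors with finitely many particles. For $G\in L^\infty(\mathbb R^n;\mathfrak h)$ let $\Phi(G)$ be the closure of the operator $(\widehat\Phi(G)\psi)(x)=\phi(G(x))\psi(x)$ defined on the vectors $\psi\in\mathcal H$ with only finitely many nonzero particle components. $G$ is called weakly $\partial_j$-differentiable if there is $K=:\partial_jG\in L^\infty(\mathbb R^n;\mathfrak h)$ with $\int\partial_jf(x)\,(v,G(x))\,dx=-\int f(x)\,(v,K(x))\,dx$ for all $v\in\mathfrak h$ and $f\in C_0^\infty(\mathbb R^n)$. Suppose that, for $j=1,\dots,n$, $G_j\in L^\infty(\mathbb R^n;\mathfrak h_\omega)$ is weakly $\partial_j$-differentiable and $\partial_jG_j\in L^\infty(\mathbb R^n;\mathfrak h_\omega)$. Put $A_j=\Phi(G_j)$, and let $T_A$ be the self-adjoint operator associated with the closed nonnegative form $$q(\varphi,\psi)=\sum_{j=1}^n((p_j+A_j)\varphi,(p_j+A_j)\psi)+(H_f^{1/2}\varphi,H_f^{1/2}\psi)$$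 on $Q(q)=\bigcap_jD(p_j)\cap D(H_f^{1/2})$; that is, $\varphi\in D(T_A)$ and $T_A\varphi=\eta$ if and only if $\varphi\in Q(q)$ and $q(\varphi,\psi)=(\eta,\psi)$ for all $\psi\in Q(q)$. Let $(p+A)^2=\sum_j(p_j+A_j)^2$, where sums and compositions of operators have their natural domains $D(S+R)=D(S)\cap D(R)$ and $D(SR)=\{\psi\in D(R):R\psi\in D(S)\}$; in particular $D(p^2+H_f)=D(p^2)\cap D(H_f)$. Then $D(p^2+H_f)\subset D(T_A)\cap D((p+A)^2+H_f)$, and for every $\varphi\in D(p^2+H_f)$, $$T_A\varphi=(p+A)^2\varphi+H_f\varphi .$$ -/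

import Mathlib

open MeasureTheory Filter
open scoped ENNReal NNReal

noncomputable section

namespace PauliFierz

/-! ### Unbounded operators -/

section Operators

variable {H₁ H₂ H₃ : Type*} [AddCommGroup H₁] [Module ℂ H₁] [AddCommGroup H₂] [Module ℂ H₂]
  [AddCommGroup H₃] [Module ℂ H₃]

/-- The composition `S R` of two unbounded operators, with domain
`D(S R) = {ψ ∈ D(R) | R ψ ∈ D(S)}`. -/
def opComp (S : H₂ →ₗ.[ℂ] H₃) (R : H₁ →ₗ.[ℂ] H₂) : H₁ →ₗ.[ℂ] H₃ where
  domain := (S.domain.comap R.toFun).map R.domain.subtype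
  toFun :=
    { toFun := fun x => S ⟨R ⟨x, by
          obtain ⟨y, -, hy⟩ := x.2; rw [← hy]; exact y.2⟩, by
          obtain ⟨y, hyS, hy⟩ := x.2
          have : (⟨(x : H₁), by rw [← hy]; exact y.2⟩ : R.domain) = y := Subtype.ext hy.symm
          rw [this]; exact hyS⟩
      map_add' := fun x y => by
        rw [← S.map_add]; congr 1; ext1
        exact R.map_add ⟨(x : H₁), _⟩ ⟨(y : H₁), _⟩
      map_smul' := fun c x => by
        rw [RingHom.id_apply, ← S.map_smul]; congr 1; ext1
        exact R.map_smul c ⟨(x : H₁), _⟩ }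

/-- The restriction of an operator `T` to a subspace `Q` of its domain, as a linear map on `Q`
(and zero, by convention, if `Q` is not contained in the domain of `T`). -/
def onSubspace (T : H₁ →ₗ.[ℂ] H₂) (Q : Submodule ℂ H₁) : Q →ₗ[ℂ] H₂ :=
  open Classical in
  if h : Q ≤ T.domain then T.toFun ∘ₗ Submodule.inclusion h else 0

end Operators

/-- The operator associated by the first representation theorem with a sesquilinear form `q` with
form domain `Q`:  `φ ∈ D(T)` and `T φ = η` if and only if `φ ∈ Q` and `q(φ, ψ) = (η, ψ)` for all
`ψ ∈ Q`. -/
def formOperator {H : Type*} [NormedAddCommGroup H] [InnerProductSpace ℂ H] (Q : Submodule ℂ H)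
    (q : Q →ₗ⋆[ℂ] Q →ₗ[ℂ] ℂ) : H →ₗ.[ℂ] H :=
  Submodule.toLinearPMap
    { carrier := {x | ∃ φ : Q, (φ : H) = x.1 ∧ ∀ ψ : Q, q φ ψ = inner ℂ x.2 (ψ : H)}
      add_mem' := by
        rintro x y ⟨φ, hφ, h⟩ ⟨φ', hφ', h'⟩
        exact ⟨φ + φ', by simp [hφ, hφ'], fun ψ => by rw [map_add, LinearMap.add_apply, h, h', Prod.snd_add, inner_add_left]⟩
      zero_mem' := ⟨0, by simp, fun ψ => by simp⟩
      smul_mem' := by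
        rintro c x ⟨φ, hφ, h⟩
        exact ⟨c • φ, by simp [hφ], fun ψ => by
          rw [map_smulₛₗ, LinearMap.smul_apply, h, Prod.smul_snd, inner_smul_left, smul_eq_mul]⟩ }

/-! ### The symmetric Fock space over `L²(X, μ)` -/

section Fock

variable {X : Type*} [MeasurableSpace X] (μ : Measure X) [SigmaFinite μ]

/-- The `m`-fold Hilbert space tensor product of `L²(X, μ)` with itself, realized as the space
of square integrable functions of `m` variables in `X`. -/
abbrev TensorPower (m : ℕ) : Type _ := Lp ℂ 2 (Measure.pi fun _ : Fin m => μ)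

theorem measurePreserving_perm {m : ℕ} (σ : Equiv.Perm (Fin m)) :
    MeasurePreserving (fun k : Fin m → X => k ∘ σ)
      (Measure.pi fun _ : Fin m => μ) (Measure.pi fun _ : Fin m => μ) := by
  have h := measurePreserving_arrowCongr' (fun _ : Fin m => μ) (fun _ : Fin m => μ) σ.symm
    (MeasurableEquiv.refl X) (fun _ => MeasurePreserving.id μ)
  exact h

/-- The action of a permutation on functions of `m` variables:
`(U_σ f)(k₁, …, k_m) = f(k_{σ(1)}, …, k_{σ(m)})`. -/
def permute {m : ℕ} (σ : Equiv.Perm (Fin m)) : TensorPower μ m →ₗᵢ[ℂ] TensorPower μ m :=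
  Lp.compMeasurePreservingₗᵢ ℂ (fun k : Fin m → X => k ∘ σ) (measurePreserving_perm μ σ)

/-- The `m`-particle space: the totally symmetric elements of the `m`-fold tensor product. -/
def Sym (m : ℕ) : Submodule ℂ (TensorPower μ m) where
  carrier := {f | ∀ σ : Equiv.Perm (Fin m), permute μ σ f = f}
  add_mem' := fun hf hg σ => by rw [map_add, hf σ, hg σ]
  zero_mem' := fun σ => map_zero _
  smul_mem' := fun c f hf σ => by rw [map_smul, hf σ]

instance instCompleteSpaceSym (m : ℕ) : CompleteSpace (Sym μ m) := by
  have : IsClosed (Sym μ m : Set (TensorPower μ m)) := by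
    have h : (Sym μ m : Set (TensorPower μ m)) =
        ⋂ σ : Equiv.Perm (Fin m), {f | permute μ σ f = f} := by
      ext f; simp [Sym]
    rw [h]
    exact isClosed_iInter fun σ => isClosed_eq (permute μ σ).continuous continuous_id
  exact this.completeSpace_coe

/-- The bosonic Fock space, the Hilbert space direct sum of the `m`-particle spaces. -/
abbrev Fock : Type _ := lp (fun m : ℕ => Sym μ m) 2

/-- The subspace of states containing only finitely many particles. -/
def fockFin : Submodule ℂ (Fock μ) where
  carrier := {ψ | ∃ N : ℕ, ∀ m, N ≤ m → ψ m = 0}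
  add_mem' := by
    rintro ψ ψ' ⟨N, h⟩ ⟨N', h'⟩
    exact ⟨max N N', fun m hm => by
      rw [lp.coeFn_add, Pi.add_apply, h m (le_trans (le_max_left _ _) hm),
        h' m (le_trans (le_max_right _ _) hm), add_zero]⟩
  zero_mem' := ⟨0, fun m _ => rfl⟩
  smul_mem' := by
    rintro c ψ ⟨N, h⟩
    exact ⟨N, fun m hm => by rw [lp.coeFn_smul, Pi.smul_apply, h m hm, smul_zero]⟩

theorem measurePreserving_headTail (m : ℕ) :
    MeasurePreserving (fun k : Fin (m + 1) → X => (k 0, fun i : Fin m => k i.succ))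
      (Measure.pi fun _ : Fin (m + 1) => μ) (μ.prod (Measure.pi fun _ : Fin m => μ)) := by
  have h := measurePreserving_piFinSuccAbove (fun _ : Fin (m + 1) => μ) 0
  exact h

theorem memLp_tensor {m : ℕ} (h : Lp ℂ 2 μ) (f : TensorPower μ m) :
    MemLp (fun k : Fin (m + 1) → X => h (k 0) * f (fun i : Fin m => k i.succ)) 2
      (Measure.pi fun _ : Fin (m + 1) => μ) := by
  have key : MemLp (fun z : X × (Fin m → X) => h z.1 * f z.2) 2
      (μ.prod (Measure.pi fun _ : Fin m => μ)) := by
    have hm : AEStronglyMeasurable (fun z : X × (Fin m → X) => h z.1 * f z.2)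
        (μ.prod (Measure.pi fun _ : Fin m => μ)) :=
      (Lp.memLp h).1.comp_fst.mul (Lp.memLp f).1.comp_snd
    rw [memLp_two_iff_integrable_sq_norm hm]
    have := ((memLp_two_iff_integrable_sq_norm (Lp.memLp h).1).1 (Lp.memLp h)).mul_prod
      ((memLp_two_iff_integrable_sq_norm (Lp.memLp f).1).1 (Lp.memLp f))
    simpa only [norm_mul, mul_pow] using this
  exact key.comp_measurePreserving (measurePreserving_headTail μ m)

/-- The tensor product `h ⊗ f`, i.e. the function `(k₀, k₁, …, k_m) ↦ h(k₀) f(k₁, …, k_m)`. -/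
def tensor {m : ℕ} (h : Lp ℂ 2 μ) : TensorPower μ m →ₗ[ℂ] TensorPower μ (m + 1) where
  toFun f := (memLp_tensor μ h f).toLp _
  map_add' f g := by
    rw [← MemLp.toLp_add]
    refine MemLp.toLp_congr _ _ ?_
    have hq : Measure.QuasiMeasurePreserving (fun k : Fin (m + 1) → X => fun i : Fin m => k i.succ)
        (Measure.pi fun _ : Fin (m + 1) => μ) (Measure.pi fun _ : Fin m => μ) :=
      Measure.quasiMeasurePreserving_snd.comp (measurePreserving_headTail μ m).quasiMeasurePreserving
    filter_upwards [hq.ae (Lp.coeFn_add f g)] with k hk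
    simp only [Pi.add_apply] at hk ⊢
    rw [hk, mul_add]
  map_smul' c f := by
    rw [RingHom.id_apply, ← MemLp.toLp_const_smul]
    refine MemLp.toLp_congr _ _ ?_
    have hq : Measure.QuasiMeasurePreserving (fun k : Fin (m + 1) → X => fun i : Fin m => k i.succ)
        (Measure.pi fun _ : Fin (m + 1) => μ) (Measure.pi fun _ : Fin m => μ) :=
      Measure.quasiMeasurePreserving_snd.comp (measurePreserving_headTail μ m).quasiMeasurePreserving
    filter_upwards [hq.ae (Lp.coeFn_smul c f)] with k hk
    simp only [Pi.smul_apply, smul_eq_mul] at hk ⊢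
    rw [hk, mul_left_comm]

/-- The creation operator on the `m`-particle space: `f ↦ (m + 1)^{1/2} S_{m+1} (h ⊗ f)`, where
`S_{m+1}` is the orthogonal projection onto the totally symmetric tensors. -/
def createSector (h : Lp ℂ 2 μ) (m : ℕ) : Sym μ m →ₗ[ℂ] Sym μ (m + 1) :=
  ((Real.sqrt (m + 1) : ℝ) : ℂ) •
    ((Sym μ (m + 1)).orthogonalProjectionOnto.toLinearMap ∘ₗ tensor μ h ∘ₗ (Sym μ m).subtype)

/-- The components of `a*(h) ψ`. -/
def createSeq (h : Lp ℂ 2 μ) (ψ : ∀ m, Sym μ m) : ∀ m, Sym μ m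
  | 0 => 0
  | m + 1 => createSector μ h m (ψ m)

theorem memℓp_createSeq (h : Lp ℂ 2 μ) (ψ : fockFin μ) :
    Memℓp (createSeq μ h fun m => (ψ : Fock μ) m) 2 := by
  obtain ⟨N, hN⟩ := ψ.2
  refine (memℓp_zero ((Set.finite_Iic N).subset ?_)).of_exponent_ge (by simp)
  intro m hm
  by_contra hlt
  apply hm
  cases m with
  | zero => rfl
  | succ m =>
    have : N ≤ m := by simp only [Set.mem_Iic, not_le] at hlt; omega
    simp [createSeq, hN m this]

/-- The creation operator on the states with finitely many particles. -/
def createFin (h : Lp ℂ 2 μ) : Fock μ →ₗ.[ℂ] Fock μ where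
  domain := fockFin μ
  toFun :=
    { toFun := fun ψ => ⟨createSeq μ h fun m => (ψ : Fock μ) m, memℓp_createSeq μ h ψ⟩
      map_add' := fun ψ ψ' => by
        ext1; funext m
        cases m with
        | zero => exact (add_zero _).symm
        | succ m => exact map_add (createSector μ h m) _ _
      map_smul' := fun c ψ => by
        ext1; funext m
        cases m with
        | zero => exact (smul_zero c).symm
        | succ m => exact map_smul (createSector μ h m) _ _ }

/-- The creation operator `a*(h)`, a closed operator in Fock space. -/
def create (h : Lp ℂ 2 μ) : Fock μ →ₗ.[ℂ] Fock μ := (createFin μ h).closure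

/-- The annihilation operator `a(h)`, the adjoint of `a*(h)`. -/
def annihilate (h : Lp ℂ 2 μ) : Fock μ →ₗ.[ℂ] Fock μ := (create μ h).adjoint

/-- The field operator `φ(h)`, the closure of `2^{-1/2} (a(h) + a*(h))` on the states with
finitely many particles. -/
def field (h : Lp ℂ 2 μ) : Fock μ →ₗ.[ℂ] Fock μ :=
  ((((Real.sqrt 2)⁻¹ : ℝ) : ℂ) • (annihilate μ h + create μ h)).domRestrict (fockFin μ) |>.closure

/-- The operator which acts on the `m`-particle space as multiplication by the real function
`g m`, on its maximal domain: `(T ψ)_m (k₁, …, k_m) = g_m(k₁, …, k_m) ψ_m(k₁, …, k_m)`. -/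
def fockMul (g : ∀ m : ℕ, (Fin m → X) → ℝ) : Fock μ →ₗ.[ℂ] Fock μ :=
  Submodule.toLinearPMap
    { carrier := {x | ∀ m, ((x.2 m : TensorPower μ m) : (Fin m → X) → ℂ)
        =ᵐ[Measure.pi fun _ : Fin m => μ]
          fun k => (g m k : ℂ) * ((x.1 m : TensorPower μ m) : (Fin m → X) → ℂ) k}
      add_mem' := by
        intro x y hx hy m
        filter_upwards [hx m, hy m, Lp.coeFn_add (x.1 m : TensorPower μ m) (y.1 m),
          Lp.coeFn_add (x.2 m : TensorPower μ m) (y.2 m)] with k h1 h2 h3 h4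
        simp only [Prod.fst_add, Prod.snd_add, lp.coeFn_add, Pi.add_apply, Submodule.coe_add]
          at h3 h4 ⊢
        rw [h3, h4, h1, h2, mul_add]
      zero_mem' := by
        intro m
        filter_upwards [Lp.coeFn_zero ℂ 2 (Measure.pi fun _ : Fin m => μ)] with k h1
        simp only [Prod.fst_zero, Prod.snd_zero, lp.coeFn_zero, Pi.zero_apply,
          Submodule.coe_zero] at h1 ⊢
        rw [h1, mul_zero]
      smul_mem' := by
        intro c x hx m
        filter_upwards [hx m, Lp.coeFn_smul c (x.1 m : TensorPower μ m),
          Lp.coeFn_smul c (x.2 m : TensorPower μ m)] with k h1 h3 h4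
        simp only [Prod.smul_fst, Prod.smul_snd, lp.coeFn_smul, Pi.smul_apply,
          Submodule.coe_smul, smul_eq_mul] at h3 h4 ⊢
        rw [h3, h4, h1, mul_left_comm] }

end Fock

/-! ### Operators in `L²(ℝⁿ; F)` -/

section Fibers

variable {n : ℕ} {F : Type*} [NormedAddCommGroup F] [NormedSpace ℂ F]

/-- The Hilbert space `L²(ℝⁿ; F) ≅ L²(ℝⁿ) ⊗ F`. -/
abbrev L2 (n : ℕ) (F : Type*) [NormedAddCommGroup F] : Type _ :=
  Lp F 2 (volume : Measure (EuclideanSpace ℝ (Fin n)))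

/-- The operator acting pointwise by `(T ψ)(x) = T(x) ψ(x)`, with its maximal domain: all `ψ`
such that `ψ(x) ∈ D(T(x))` for almost every `x` and `x ↦ T(x) ψ(x)` is square integrable. For a
constant function `T` with closed values this is the operator `1 ⊗ T`. -/
def pointwise (T : EuclideanSpace ℝ (Fin n) → F →ₗ.[ℂ] F) : L2 n F →ₗ.[ℂ] L2 n F :=
  Submodule.toLinearPMap
    { carrier := {z | ∀ᵐ x, (z.1 x, z.2 x) ∈ (T x).graph}
      add_mem' := by
        intro y z hy hz
        filter_upwards [hy, hz, Lp.coeFn_add y.1 z.1, Lp.coeFn_add y.2 z.2] with x h1 h2 h3 h4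
        simp only [Prod.fst_add, Prod.snd_add, Pi.add_apply] at h3 h4 ⊢
        rw [h3, h4]
        exact (T x).graph.add_mem h1 h2
      zero_mem' := by
        filter_upwards [Lp.coeFn_zero F 2 (volume : Measure (EuclideanSpace ℝ (Fin n)))] with x h1
        simp only [Prod.fst_zero, Prod.snd_zero, Pi.zero_apply] at h1 ⊢
        rw [h1]
        exact (T x).graph.zero_mem
      smul_mem' := by
        intro c z hz
        filter_upwards [hz, Lp.coeFn_smul c z.1, Lp.coeFn_smul c z.2] with x h1 h3 h4
        simp only [Prod.smul_fst, Prod.smul_snd, Pi.smul_apply] at h3 h4 ⊢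
        rw [h3, h4]
        exact (T x).graph.smul_mem c h1 }

/-- The partial derivative `∂_j f` of a function on `ℝⁿ`. -/
def partialDeriv (j : Fin n) (f : EuclideanSpace ℝ (Fin n) → ℂ) (x : EuclideanSpace ℝ (Fin n)) :
    ℂ :=
  fderiv ℝ f x (EuclideanSpace.single j 1)

theorem integrable_testFunction_smul {f : EuclideanSpace ℝ (Fin n) → ℂ} (hf : Continuous f)
    (hc : HasCompactSupport f) (ψ : L2 n F) : Integrable (fun x => f x • ψ x) := by
  have h : MemLp (f • (ψ : EuclideanSpace ℝ (Fin n) → F)) 1 volume :=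
    (Lp.memLp ψ).smul (hf.memLp_of_hasCompactSupport (p := 2) hc)
  exact memLp_one_iff_integrable.1 h

theorem integrable_partialDeriv_smul {f : EuclideanSpace ℝ (Fin n) → ℂ} (hf : ContDiff ℝ (⊤ : ℕ∞) f)
    (hc : HasCompactSupport f) (j : Fin n) (ψ : L2 n F) :
    Integrable (fun x => partialDeriv j f x • ψ x) := by
  refine integrable_testFunction_smul ?_ ?_ ψ
  · exact (hf.continuous_fderiv (by simp)).clm_apply continuous_const
  · exact hc.fderiv_apply (𝕜 := ℝ) _

/-- The momentum operator `p_j = -i ∂_j` in `L²(ℝⁿ; F)`: `ψ ∈ D(p_j)` and `p_j ψ = η` if and only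
if `i η` is the distributional derivative `∂_j ψ`. -/
def momentum (F : Type*) [NormedAddCommGroup F] [NormedSpace ℂ F] (j : Fin n) :
    L2 n F →ₗ.[ℂ] L2 n F :=
  Submodule.toLinearPMap
    { carrier := {z | ∀ f : EuclideanSpace ℝ (Fin n) → ℂ, ContDiff ℝ (⊤ : ℕ∞) f → HasCompactSupport f →
        ∫ x, partialDeriv j f x • z.1 x = - ∫ x, f x • (Complex.I • z.2 x)}
      add_mem' := by
        intro y z hy hz f hf hc
        have e1 : ∫ x, partialDeriv j f x • (y + z).1 x =
            (∫ x, partialDeriv j f x • y.1 x) + ∫ x, partialDeriv j f x • z.1 x := by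
          rw [← integral_add (integrable_partialDeriv_smul hf hc j y.1)
            (integrable_partialDeriv_smul hf hc j z.1)]
          refine integral_congr_ae ?_
          filter_upwards [Lp.coeFn_add y.1 z.1] with x h
          simp only [Prod.fst_add, Pi.add_apply] at h ⊢
          rw [h, smul_add]
        have e2 : ∫ x, f x • (Complex.I • (y + z).2 x) =
            (∫ x, f x • (Complex.I • y.2 x)) + ∫ x, f x • (Complex.I • z.2 x) := by
          have i1 := (integrable_testFunction_smul hf.continuous hc y.2).smul Complex.I
          have i2 := (integrable_testFunction_smul hf.continuous hc z.2).smul Complex.I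
          simp only [smul_comm (f _) Complex.I]
          refine Eq.trans ?_ (integral_add i1 i2)
          refine integral_congr_ae ?_
          filter_upwards [Lp.coeFn_add y.2 z.2] with x h
          simp only [Prod.snd_add, Pi.add_apply] at h ⊢
          rw [h, smul_add, smul_add]
        rw [e1, e2, hy f hf hc, hz f hf hc, neg_add]
      zero_mem' := by
        intro f hf hc
        have h0 := Lp.coeFn_zero F 2 (volume : Measure (EuclideanSpace ℝ (Fin n)))
        rw [integral_eq_zero_of_ae, integral_eq_zero_of_ae, neg_zero]
        · filter_upwards [h0] with x h
          simp only [Prod.snd_zero, Pi.zero_apply] at h ⊢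
          rw [h, smul_zero, smul_zero]
        · filter_upwards [h0] with x h
          simp only [Prod.fst_zero, Pi.zero_apply] at h ⊢
          rw [h, smul_zero]
      smul_mem' := by
        intro c z hz f hf hc
        have e1 : ∫ x, partialDeriv j f x • (c • z).1 x =
            c • ∫ x, partialDeriv j f x • z.1 x := by
          rw [← integral_smul]
          refine integral_congr_ae ?_
          filter_upwards [Lp.coeFn_smul c z.1] with x h
          simp only [Prod.smul_fst, Pi.smul_apply] at h ⊢
          rw [h, smul_comm]
        have e2 : ∫ x, f x • (Complex.I • (c • z).2 x) =
            c • ∫ x, f x • (Complex.I • z.2 x) := by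
          rw [← integral_smul]
          refine integral_congr_ae ?_
          filter_upwards [Lp.coeFn_smul c z.2] with x h
          simp only [Prod.smul_snd, Pi.smul_apply] at h ⊢
          rw [h, smul_comm Complex.I c, smul_comm (f x) c]
        rw [e1, e2, hz f hf hc, smul_neg] }

/-- The Sobolev space `H²(ℝⁿ; F)`: all first and second order distributional derivatives are
square integrable. -/
def sobolev2 (n : ℕ) (F : Type*) [NormedAddCommGroup F] [NormedSpace ℂ F] :
    Submodule ℂ (L2 n F) :=
  (⨅ j : Fin n, (momentum F j).domain) ⊓
    ⨅ (j : Fin n) (l : Fin n), (opComp (momentum F l) (momentum F j)).domain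

/-- The operator `p² = ∑_j p_j²` with domain `H²(ℝⁿ; F)`. -/
def momentumSq (n : ℕ) (F : Type*) [NormedAddCommGroup F] [NormedSpace ℂ F] :
    L2 n F →ₗ.[ℂ] L2 n F :=
  (∑ j : Fin n, opComp (momentum F j) (momentum F j)).domRestrict (sobolev2 n F)

end Fibers

/-! ### The model -/

section Model

variable {n d p : ℕ}

/-- The measure space `ℝᵈ × {1, …, p}`, with Lebesgue measure times counting measure. -/
abbrev modeMeasure (d p : ℕ) : Measure (EuclideanSpace ℝ (Fin d) × Fin p) :=
  (volume : Measure (EuclideanSpace ℝ (Fin d))).prod Measure.count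

/-- The one-particle space `𝔥 = L²(ℝᵈ; ℂᵖ)`, realized as `L²(ℝᵈ × {1, …, p})`. -/
abbrev OneParticle (d p : ℕ) : Type := Lp ℂ 2 (modeMeasure d p)

/-- The Hilbert space `L²(ℝⁿ; 𝓕)`, with `𝓕` the Fock space over `𝔥`. -/
abbrev Hilb (n d p : ℕ) : Type := L2 n (Fock (modeMeasure d p))

/-- The states with only finitely many particles. -/
def hilbFin (n d p : ℕ) : Submodule ℂ (Hilb n d p) where
  carrier := {ψ | ∃ N : ℕ, ∀ m, N ≤ m → ∀ᵐ x, ψ x m = 0}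
  add_mem' := by
    rintro ψ ψ' ⟨N, h⟩ ⟨N', h'⟩
    refine ⟨max N N', fun m hm => ?_⟩
    filter_upwards [h m (le_trans (le_max_left _ _) hm), h' m (le_trans (le_max_right _ _) hm),
      Lp.coeFn_add ψ ψ'] with x h1 h2 h3
    rw [h3, Pi.add_apply, lp.coeFn_add, Pi.add_apply, h1, h2, add_zero]
  zero_mem' := ⟨0, fun m _ => by
    filter_upwards [Lp.coeFn_zero (Fock (modeMeasure d p)) 2
      (volume : Measure (EuclideanSpace ℝ (Fin n)))] with x h
    rw [h]; rfl⟩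
  smul_mem' := by
    rintro c ψ ⟨N, h⟩
    refine ⟨N, fun m hm => ?_⟩
    filter_upwards [h m hm, Lp.coeFn_smul c ψ] with x h1 h3
    rw [h3, Pi.smul_apply, lp.coeFn_smul, Pi.smul_apply, h1, smul_zero]

/-- The field energy `H_f = dΓ(M_ω)`: in the `m`-particle space it is multiplication by
`ω(k₁) + ⋯ + ω(k_m)`. -/
def fieldEnergy (n p : ℕ) (ω : EuclideanSpace ℝ (Fin d) → ℝ≥0) : Hilb n d p →ₗ.[ℂ] Hilb n d p :=
  pointwise fun _ => fockMul (modeMeasure d p) fun _ k => ∑ i, (ω (k i).1 : ℝ)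

/-- The square root `H_f^{1/2}` of the field energy. -/
def fieldEnergySqrt (n p : ℕ) (ω : EuclideanSpace ℝ (Fin d) → ℝ≥0) :
    Hilb n d p →ₗ.[ℂ] Hilb n d p :=
  pointwise fun _ => fockMul (modeMeasure d p) fun _ k => Real.sqrt (∑ i, (ω (k i).1 : ℝ))

/-- The operator `Φ(G)`: the closure of the operator `(Φ(G) ψ)(x) = φ(G(x)) ψ(x)` on the states
with finitely many particles. -/
def coupling (G : EuclideanSpace ℝ (Fin n) → OneParticle d p) : Hilb n d p →ₗ.[ℂ] Hilb n d p :=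
  ((pointwise fun x => field (modeMeasure d p) (G x)).domRestrict (hilbFin n d p)).closure

/-- The norm `‖h‖_ω = (‖h‖² + ‖h / √ω‖²)^{1/2}`, with value `∞` if `h ∉ 𝔥_ω`. -/
def omegaNorm (ω : EuclideanSpace ℝ (Fin d) → ℝ≥0) (h : OneParticle d p) : ℝ≥0∞ :=
  (eLpNorm h 2 (modeMeasure d p) ^ 2 +
    eLpNorm (fun k => h k / (Real.sqrt (ω k.1) : ℂ)) 2 (modeMeasure d p) ^ 2) ^ (1 / 2 : ℝ)

/-- `G ∈ L^∞(ℝⁿ; 𝔥)`. -/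
def EssBounded (G : EuclideanSpace ℝ (Fin n) → OneParticle d p) : Prop :=
  MemLp G ∞ volume

/-- `G ∈ L^∞(ℝⁿ; 𝔥_ω)`. (For functions with values in `𝔥_ω`, measurability with respect to the
norm of `𝔥_ω` and with respect to the norm of `𝔥` are the same.) -/
def OmegaBounded (ω : EuclideanSpace ℝ (Fin d) → ℝ≥0)
    (G : EuclideanSpace ℝ (Fin n) → OneParticle d p) : Prop :=
  AEStronglyMeasurable G volume ∧ essSup (fun x => omegaNorm ω (G x)) volume < ∞

/-- `G ∈ L^∞(ℝⁿ; 𝔥)` is weakly `∂_j`-differentiable with `∂_j G = K ∈ L^∞(ℝⁿ; 𝔥)`. -/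
def HasWeakDeriv (j : Fin n) (G K : EuclideanSpace ℝ (Fin n) → OneParticle d p) : Prop :=
  EssBounded G ∧ EssBounded K ∧
    ∀ (v : OneParticle d p) (f : EuclideanSpace ℝ (Fin n) → ℂ),
      ContDiff ℝ (⊤ : ℕ∞) f → HasCompactSupport f →
        ∫ x, partialDeriv j f x * inner ℂ v (G x) = - ∫ x, f x * inner ℂ v (K x)

/-- The operator `p_j + A_j` with `A_j = Φ(G_j)`, with domain `D(p_j) ∩ D(A_j)`. -/
def kinetic (G : Fin n → EuclideanSpace ℝ (Fin n) → OneParticle d p) (j : Fin n) :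
    Hilb n d p →ₗ.[ℂ] Hilb n d p :=
  momentum (Fock (modeMeasure d p)) j + coupling (G j)

/-- The operator sum `(p + A)² = ∑_j (p_j + A_j)²`. -/
def kineticSq (G : Fin n → EuclideanSpace ℝ (Fin n) → OneParticle d p) :
    Hilb n d p →ₗ.[ℂ] Hilb n d p :=
  ∑ j : Fin n, opComp (kinetic G j) (kinetic G j)

/-- The free Hamiltonian `p² + H_f`, with domain `D(p²) ∩ D(H_f)`. -/
def freeHamiltonian (n p : ℕ) (ω : EuclideanSpace ℝ (Fin d) → ℝ≥0) :
    Hilb n d p →ₗ.[ℂ] Hilb n d p :=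
  momentumSq n (Fock (modeMeasure d p)) + fieldEnergy n p ω

/-- The form domain `Q(q) = ⋂_j D(p_j) ∩ D(H_f^{1/2})`. -/
def formDomain (n p : ℕ) (ω : EuclideanSpace ℝ (Fin d) → ℝ≥0) : Submodule ℂ (Hilb n d p) :=
  (⨅ j : Fin n, (momentum (Fock (modeMeasure d p)) j).domain) ⊓ (fieldEnergySqrt n p ω).domain

/-- The quadratic form
`q(φ, ψ) = ∑_j ((p_j + A_j) φ, (p_j + A_j) ψ) + (H_f^{1/2} φ, H_f^{1/2} ψ)` on `Q(q)`. If
`G_j ∈ L^∞(ℝⁿ; 𝔥_ω)`, then `Q(q) ⊂ D(p_j + A_j)`, so that all terms have their literal meaning. -/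
def form (ω : EuclideanSpace ℝ (Fin d) → ℝ≥0)
    (G : Fin n → EuclideanSpace ℝ (Fin n) → OneParticle d p) :
    formDomain n p ω →ₗ⋆[ℂ] formDomain n p ω →ₗ[ℂ] ℂ :=
  LinearMap.mk₂'ₛₗ (starRingEnd ℂ) (RingHom.id ℂ)
    (fun φ ψ =>
      ∑ j : Fin n, inner ℂ (onSubspace (kinetic G j) (formDomain n p ω) φ)
          (onSubspace (kinetic G j) (formDomain n p ω) ψ) +
        inner ℂ (onSubspace (fieldEnergySqrt n p ω) (formDomain n p ω) φ)
          (onSubspace (fieldEnergySqrt n p ω) (formDomain n p ω) ψ))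
    (fun φ φ' ψ => by
      simp only [map_add, inner_add_left, Finset.sum_add_distrib]; ring)
    (fun c φ ψ => by
      simp only [map_smul, inner_smul_left, smul_eq_mul, mul_add, Finset.mul_sum])
    (fun φ ψ ψ' => by
      simp only [map_add, inner_add_right, Finset.sum_add_distrib]; ring)
    (fun c φ ψ => by
      simp only [map_smul, inner_smul_right, smul_eq_mul, RingHom.id_apply, mul_add,
        Finset.mul_sum])

/-- The self-adjoint operator `T_A` associated with the quadratic form `q`. -/
def formHamiltonian (ω : EuclideanSpace ℝ (Fin d) → ℝ≥0)
    (G : Fin n → EuclideanSpace ℝ (Fin n) → OneParticle d p) : Hilb n d p →ₗ.[ℂ] Hilb n d p :=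
  formOperator (formDomain n p ω) (form ω G)

end Model

end PauliFierz

end

noncomputable section

open scoped Topology

namespace PauliFierz

/-! ### Graphs of unbounded operators -/

section Graphs

variable {H₁ H₂ H₃ : Type*} [AddCommGroup H₁] [Module ℂ H₁] [AddCommGroup H₂] [Module ℂ H₂]
  [AddCommGroup H₃] [Module ℂ H₃]

/-! It suffices to find, for φ in D(p²) ∩ D(H_f), one vector lying over φ both in the graph of T_A
and in the graph of (p + A)² + H_f; this is `exists_mem_graph_hamiltonian`. Once (p_j + A_j)φ is
known to lie in D(p_j + A_j) for every j, symmetry of p_j and of A_j moves one factor across each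
kinetic term of q(φ, ψ). The field energy term is handled by the pointwise identity √s · √s = s · 1.
Density of the form domain (`dense_formDomain`) ensures that the form determines T_A φ.

So everything rests on the domain statement `exists_mem_graph_kinetic`, where (p_j + A_j)²φ splits
into four terms. The term p_j p_j φ exists by assumption.

For A_j A_j φ one needs D(H_f) ⊂ D(Φ(G)²), `exists_mem_graph_coupling_coupling`. Writing h = √ω h'
and using the symmetry of the wave function, the factors √(m+1) of the annihilation operators are
absorbed by ω(k₁) + ⋯ + ω(k_m) (`norm_annihL_le`, `norm_annihL_annihL_le`). The commutation relation
`inner_createL_createL` carries the estimates over to creation operators, and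
`norm_fieldFin_fieldFin_sq_le` collects them. Cutting off the particle number and taking closures
gives the inclusion.

For A_j p_j φ one needs p_j φ ∈ D(H_f^{1/2}), `IsMulL2.exists_sqrt_of_isWeakDeriv`. With B_N =
min(H_f^{1/2}, N), which is bounded and commutes with p_j, ‖B_N p_j φ‖² = (p_j²φ, B_N²φ) ≤ ‖p_j²φ‖
‖H_f φ‖, uniformly in N.

For p_j A_j φ one needs the product rule ∂_j(Φ(G)φ) = Φ(∂_j G)φ + Φ(G)∂_jφ, `isWeakDeriv_coupling`.
Tested against a scalar function times a finite particle vector v, it becomes a product rule for the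
inner product of the bounded weakly differentiable function x ↦ φ(G(x))v with φ. That in turn is
integration by parts in L² (`IsWeakDeriv.inner_eq`), proved by differentiating translations. -/

theorem mem_graph_iff_exists {T : H₁ →ₗ.[ℂ] H₂} {x : H₁} {y : H₂} :
    (x, y) ∈ T.graph ↔ ∃ h : x ∈ T.domain, T ⟨x, h⟩ = y := by
  rw [LinearPMap.mem_graph_iff]
  constructor
  · rintro ⟨⟨z, hz⟩, rfl, h⟩
    exact ⟨hz, h⟩
  · rintro ⟨h, e⟩
    exact ⟨⟨x, h⟩, rfl, e⟩

theorem mem_graph_add {S R : H₁ →ₗ.[ℂ] H₂} {x : H₁} {y z : H₂} (hS : (x, y) ∈ S.graph)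
    (hR : (x, z) ∈ R.graph) : (x, y + z) ∈ (S + R).graph := by
  rw [mem_graph_iff_exists] at *
  obtain ⟨h, rfl⟩ := hS
  obtain ⟨h', rfl⟩ := hR
  exact ⟨⟨h, h'⟩, rfl⟩

theorem mem_graph_smul {S : H₁ →ₗ.[ℂ] H₂} {x : H₁} {y : H₂} (c : ℂ) (hS : (x, y) ∈ S.graph) :
    (x, c • y) ∈ (c • S).graph := by
  rw [mem_graph_iff_exists] at *
  obtain ⟨h, rfl⟩ := hS
  exact ⟨h, rfl⟩

theorem mem_graph_sum {ι : Type*} (s : Finset ι) {T : ι → H₁ →ₗ.[ℂ] H₂} {x : H₁} {y : ι → H₂}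
    (h : ∀ i ∈ s, (x, y i) ∈ (T i).graph) : (x, ∑ i ∈ s, y i) ∈ (∑ i ∈ s, T i).graph := by
  classical
  induction s using Finset.induction_on with
  | empty =>
    rw [Finset.sum_empty, Finset.sum_empty, mem_graph_iff_exists]
    exact ⟨Submodule.mem_top, rfl⟩
  | insert i s hi ih =>
    rw [Finset.sum_insert hi, Finset.sum_insert hi]
    exact mem_graph_add (h i (Finset.mem_insert_self _ _))
      (ih fun k hk => h k (Finset.mem_insert_of_mem hk))

theorem mem_graph_opComp {S : H₂ →ₗ.[ℂ] H₃} {R : H₁ →ₗ.[ℂ] H₂} {x : H₁} {z : H₃} :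
    (x, z) ∈ (opComp S R).graph ↔ ∃ y, (x, y) ∈ R.graph ∧ (y, z) ∈ S.graph := by
  constructor
  · intro h
    rw [mem_graph_iff_exists] at h
    obtain ⟨⟨y, hy, rfl⟩, rfl⟩ := h
    exact ⟨R y, LinearPMap.mem_graph R y, mem_graph_iff_exists.2 ⟨hy, rfl⟩⟩
  · rintro ⟨y, hR, hS⟩
    rw [mem_graph_iff_exists] at *
    obtain ⟨h, rfl⟩ := hR
    obtain ⟨h', rfl⟩ := hS
    exact ⟨⟨⟨x, h⟩, h', rfl⟩, rfl⟩

theorem mem_graph_domRestrict {T : H₁ →ₗ.[ℂ] H₂} {S : Submodule ℂ H₁} {x : H₁} {y : H₂} :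
    (x, y) ∈ (T.domRestrict S).graph ↔ x ∈ S ∧ (x, y) ∈ T.graph := by
  rw [mem_graph_iff_exists, mem_graph_iff_exists]
  constructor
  · rintro ⟨⟨h, h'⟩, e⟩
    exact ⟨h, h', e⟩
  · rintro ⟨h, h', e⟩
    exact ⟨⟨h, h'⟩, e⟩

theorem onSubspace_eq {T : H₁ →ₗ.[ℂ] H₂} {Q : Submodule ℂ H₁} (h : Q ≤ T.domain) {φ : Q} {y : H₂}
    (hy : ((φ : H₁), y) ∈ T.graph) : onSubspace T Q φ = y := by
  rw [onSubspace, dif_pos h]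
  exact (mem_graph_iff_exists.1 hy).2

theorem onSubspace_mem_graph {T : H₁ →ₗ.[ℂ] H₂} {Q : Submodule ℂ H₁} (h : Q ≤ T.domain) (φ : Q) :
    ((φ : H₁), onSubspace T Q φ) ∈ T.graph := by
  rw [onSubspace, dif_pos h]
  exact mem_graph_iff_exists.2 ⟨h φ.2, rfl⟩

end Graphs

/-! ### Form operators and closures in Hilbert spaces -/

section GraphsHilbert

variable {H₁ H₂ : Type*} [NormedAddCommGroup H₁] [InnerProductSpace ℂ H₁]
  [NormedAddCommGroup H₂] [InnerProductSpace ℂ H₂]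

/-- Density of `Q` makes `y` unique, so the relation defining `formOperator` is single-valued.
Without this, `Submodule.toLinearPMap` need not have that relation as its graph. -/
theorem mem_graph_formOperator {Q : Submodule ℂ H₁} (hQ : Dense (Q : Set H₁))
    (q : Q →ₗ⋆[ℂ] Q →ₗ[ℂ] ℂ) {x y : H₁} :
    (x, y) ∈ (formOperator Q q).graph ↔
      ∃ φ : Q, (φ : H₁) = x ∧ ∀ ψ : Q, q φ ψ = inner ℂ y (ψ : H₁) := by
  rw [formOperator, Submodule.toLinearPMap_graph_eq]
  · rfl
  · rintro ⟨x, y⟩ ⟨φ, hφ, h⟩ hx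
    dsimp only at hx hφ h ⊢
    have hφ0 : φ = 0 := Subtype.ext (hφ.trans hx)
    refine hQ.eq_zero_of_inner_left ℂ fun v hv => ?_
    rw [← h ⟨v, hv⟩, hφ0, map_zero, LinearMap.zero_apply]

/-- A duality relation on the graph of an operator extends to the graph of its closure. -/
theorem inner_eq_of_mem_graph_closure {T : H₁ →ₗ.[ℂ] H₂} {v : H₂} {w : H₁}
    (h : ∀ x y, (x, y) ∈ T.graph → inner ℂ v y = inner ℂ w x) {x : H₁} {y : H₂}
    (hxy : (x, y) ∈ T.closure.graph) : inner ℂ v y = inner ℂ w x := by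
  by_cases hT : T.IsClosable
  · rw [← hT.graph_closure_eq_closure_graph] at hxy
    have hcl : IsClosed {z : H₁ × H₂ | inner ℂ v z.2 = inner ℂ w z.1} :=
      isClosed_eq (by fun_prop) (by fun_prop)
    exact closure_minimal (fun z hz => h z.1 z.2 hz) hcl hxy
  -- By convention a non-closable operator is its own closure.
  · rw [LinearPMap.closure_def' hT] at hxy
    exact h x y hxy

theorem mem_graph_closure_of_mem_graph {T : H₁ →ₗ.[ℂ] H₂} {x : H₁} {y : H₂}
    (h : (x, y) ∈ T.graph) : (x, y) ∈ T.closure.graph :=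
  LinearPMap.le_graph_of_le T.le_closure h

/-- An operator with a densely defined formal adjoint is closable. -/
theorem isClosable_of_formalAdjoint {T : H₁ →ₗ.[ℂ] H₂} {D : Submodule ℂ H₂}
    (hD : ∀ y, (∀ v ∈ D, inner ℂ v y = 0) → y = 0)
    (h : ∀ v ∈ D, ∃ w, ∀ x y, (x, y) ∈ T.graph → inner ℂ v y = inner ℂ w x) : T.IsClosable := by
  refine ⟨T.graph.topologicalClosure.toLinearPMap, ?_⟩
  rw [Submodule.toLinearPMap_graph_eq]
  rintro ⟨x, y⟩ hxy hx
  dsimp only at hx ⊢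
  subst hx
  refine hD y fun v hv => ?_
  obtain ⟨w, hw⟩ := h v hv
  have hcl : IsClosed {z : H₁ × H₂ | inner ℂ v z.2 = inner ℂ w z.1} :=
    isClosed_eq (by fun_prop) (by fun_prop)
  -- The duality relation is a closed condition, so it survives on the closure of the graph. Over
  -- the zero vector it makes `y` orthogonal to `D`.
  have : inner ℂ v y = inner ℂ w (0 : H₁) :=
    closure_minimal (fun z hz => hw z.1 z.2 hz) hcl hxy
  rw [this, inner_zero_right]

theorem mem_graph_closure_of_tendsto {T : H₁ →ₗ.[ℂ] H₂} (hT : T.IsClosable) {x : ℕ → H₁}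
    {y : ℕ → H₂} {x₀ : H₁} {y₀ : H₂} (h : ∀ N, (x N, y N) ∈ T.graph)
    (hx : Tendsto x atTop (𝓝 x₀)) (hy : Tendsto y atTop (𝓝 y₀)) :
    (x₀, y₀) ∈ T.closure.graph := by
  rw [← hT.graph_closure_eq_closure_graph]
  exact mem_closure_of_tendsto (hx.prodMk_nhds hy) (Eventually.of_forall h)

end GraphsHilbert

/-! ### Graphs of multiplication operators and of fibrewise operators -/

section FockGraphs

variable {X : Type*} [MeasurableSpace X] (μ : Measure X) [SigmaFinite μ]

/-- The product with `g m` is determined almost everywhere in each sector, so the defining relation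
is single-valued and is the graph. -/
theorem mem_graph_fockMul (g : ∀ m : ℕ, (Fin m → X) → ℝ) {u v : Fock μ} :
    (u, v) ∈ (fockMul μ g).graph ↔
      ∀ m, ((v m : TensorPower μ m) : (Fin m → X) → ℂ)
        =ᵐ[Measure.pi fun _ : Fin m => μ]
          fun k => (g m k : ℂ) * ((u m : TensorPower μ m) : (Fin m → X) → ℂ) k := by
  rw [fockMul, Submodule.toLinearPMap_graph_eq]
  · rfl
  · rintro ⟨u, v⟩ h hu
    dsimp only at hu ⊢
    subst hu
    ext1; funext m
    refine Subtype.ext (Lp.ext ?_)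
    filter_upwards [h m, Lp.coeFn_zero ℂ 2 (Measure.pi fun _ : Fin m => μ)] with k h1 h2
    simp only [lp.coeFn_zero, Pi.zero_apply, Submodule.coe_zero] at h1 h2 ⊢
    rw [h1, h2, mul_zero]

variable {n : ℕ} {F : Type*} [NormedAddCommGroup F] [NormedSpace ℂ F]

theorem mem_graph_pointwise (T : EuclideanSpace ℝ (Fin n) → F →ₗ.[ℂ] F) {u v : L2 n F} :
    (u, v) ∈ (pointwise T).graph ↔ ∀ᵐ x, (u x, v x) ∈ (T x).graph := by
  rw [pointwise, Submodule.toLinearPMap_graph_eq]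
  · rfl
  · rintro ⟨u, v⟩ h hu
    dsimp only at hu ⊢
    subst hu
    refine Lp.ext ?_
    have h' : ∀ᵐ x, ((0 : L2 n F) x, v x) ∈ (T x).graph := h
    filter_upwards [h', Lp.coeFn_zero F 2 (volume : Measure (EuclideanSpace ℝ (Fin n)))]
      with x h1 h2
    rw [h2]
    exact (T x).graph_fst_eq_zero_snd h1 (by rw [h2]; rfl)

end FockGraphs

/-! ### Weak derivatives of square integrable functions -/

section WeakDeriv

variable {n : ℕ}

/-- Smooth compactly supported complex functions. -/
structure IsTest (f : EuclideanSpace ℝ (Fin n) → ℂ) : Prop where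
  smooth : ContDiff ℝ (⊤ : ℕ∞) f
  compact : HasCompactSupport f

theorem IsTest.continuous {f : EuclideanSpace ℝ (Fin n) → ℂ} (hf : IsTest f) : Continuous f :=
  hf.smooth.continuous

theorem IsTest.partialDeriv {f : EuclideanSpace ℝ (Fin n) → ℂ} (hf : IsTest f) (j : Fin n) :
    IsTest (partialDeriv j f) :=
  ⟨(hf.smooth.fderiv_right (by simp)).clm_apply contDiff_const, hf.compact.fderiv_apply (𝕜 := ℝ) _⟩

theorem IsTest.conj {f : EuclideanSpace ℝ (Fin n) → ℂ} (hf : IsTest f) :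
    IsTest fun x => starRingEnd ℂ (f x) :=
  ⟨Complex.conjCLE.contDiff.comp hf.smooth, hf.compact.comp_left (map_zero _)⟩

theorem IsTest.mul {f g : EuclideanSpace ℝ (Fin n) → ℂ} (hf : IsTest f) (hg : IsTest g) :
    IsTest fun x => f x * g x :=
  ⟨hf.smooth.mul hg.smooth, hf.compact.mul_right⟩

theorem IsTest.translate {f : EuclideanSpace ℝ (Fin n) → ℂ} (hf : IsTest f)
    (c : EuclideanSpace ℝ (Fin n)) : IsTest fun x => f (x - c) :=
  ⟨hf.smooth.comp (contDiff_id.sub contDiff_const),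
    hf.compact.comp_homeomorph (Homeomorph.subRight c)⟩

theorem IsTest.differentiable {f : EuclideanSpace ℝ (Fin n) → ℂ} (hf : IsTest f) :
    Differentiable ℝ f :=
  hf.smooth.differentiable (by simp)

theorem IsTest.memLp {f : EuclideanSpace ℝ (Fin n) → ℂ} (hf : IsTest f) (p : ℝ≥0∞) :
    MemLp f p volume :=
  hf.continuous.memLp_of_hasCompactSupport hf.compact

theorem partialDeriv_conj {f : EuclideanSpace ℝ (Fin n) → ℂ} (hf : IsTest f) (j : Fin n)
    (x : EuclideanSpace ℝ (Fin n)) :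
    partialDeriv j (fun x => starRingEnd ℂ (f x)) x = starRingEnd ℂ (partialDeriv j f x) := by
  have h := ((Complex.conjCLE : ℂ →L[ℝ] ℂ).hasFDerivAt.comp x (hf.differentiable x).hasFDerivAt)
  have e : fderiv ℝ (fun x => starRingEnd ℂ (f x)) x = _ := h.fderiv
  rw [partialDeriv, e]
  rfl

theorem partialDeriv_mul {f g : EuclideanSpace ℝ (Fin n) → ℂ} (hf : IsTest f) (hg : IsTest g)
    (j : Fin n) (x : EuclideanSpace ℝ (Fin n)) :
    partialDeriv j (fun x => f x * g x) x
      = partialDeriv j f x * g x + f x * partialDeriv j g x := by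
  have h := (hf.differentiable x).hasFDerivAt.mul (hg.differentiable x).hasFDerivAt
  have e : fderiv ℝ (fun x => f x * g x) x = _ := h.fderiv
  rw [partialDeriv, e]
  simp [partialDeriv]
  ring

theorem partialDeriv_translate (f : EuclideanSpace ℝ (Fin n) → ℂ) (j : Fin n)
    (c x : EuclideanSpace ℝ (Fin n)) :
    partialDeriv j (fun x => f (x - c)) x = partialDeriv j f (x - c) := by
  rw [partialDeriv, fderiv_comp_sub]
  rfl

variable {F : Type*} [NormedAddCommGroup F] [InnerProductSpace ℂ F]

/-- `η` is the distributional derivative `∂_j u`. -/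
def IsWeakDeriv (j : Fin n) (u η : L2 n F) : Prop :=
  ∀ f : EuclideanSpace ℝ (Fin n) → ℂ, IsTest f →
    ∫ x, partialDeriv j f x • u x = - ∫ x, f x • η x

theorem memLp_smul_const {f : EuclideanSpace ℝ (Fin n) → ℂ} (hf : IsTest f) (v : F) :
    MemLp (fun x => starRingEnd ℂ (f x) • v) 2 volume :=
  (hf.conj.continuous.smul continuous_const).memLp_of_hasCompactSupport
    (hf.conj.compact.smul_right (f' := fun _ => v))

/-- The vector `conj f ⊗ v` in `L²(ℝⁿ; F)`. -/
def testVec {f : EuclideanSpace ℝ (Fin n) → ℂ} (hf : IsTest f) (v : F) : L2 n F :=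
  (memLp_smul_const hf v).toLp _

theorem inner_testVec {f : EuclideanSpace ℝ (Fin n) → ℂ} (hf : IsTest f) (v : F) (u : L2 n F) :
    inner ℂ (testVec hf v) u = ∫ x, f x * inner ℂ v (u x) := by
  rw [L2.inner_def]
  refine integral_congr_ae ?_
  filter_upwards [(memLp_smul_const hf v).coeFn_toLp] with x hx
  rw [testVec, hx, inner_smul_left, Complex.conj_conj]

theorem inner_testVec_eq [CompleteSpace F] {f : EuclideanSpace ℝ (Fin n) → ℂ} (hf : IsTest f)
    (v : F) (u : L2 n F) : inner ℂ (testVec hf v) u = inner ℂ v (∫ x, f x • u x) := by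
  rw [inner_testVec, ← integral_inner (integrable_testFunction_smul hf.continuous hf.compact u)]
  simp only [inner_smul_right]

/-- The integrals of `u` against scalar test functions are vectors of `F`, where `D` separates
points. A locally integrable function for which all these integrals vanish is zero almost
everywhere. -/
theorem ext_testVec [CompleteSpace F] {D : Set F} (hD : Dense D) {u : L2 n F}
    (h : ∀ (f : EuclideanSpace ℝ (Fin n) → ℂ) (hf : IsTest f), ∀ v ∈ D,
      inner ℂ (testVec hf v) u = 0) : u = 0 := by
  have key : ∀ f : EuclideanSpace ℝ (Fin n) → ℂ, IsTest f → ∫ x, f x • u x = 0 := fun f hf =>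
    hD.eq_zero_of_inner_right ℂ fun v hv => by rw [← inner_testVec_eq hf]; exact h f hf v hv
  refine Lp.ext ?_
  have h0 : ∀ᵐ x, u x = 0 := by
    refine ae_eq_zero_of_integral_contDiff_smul_eq_zero
      ((Lp.memLp u).locallyIntegrable (by simp)) fun g hg hc => ?_
    have := key (fun x => (g x : ℂ))
      ⟨Complex.ofRealCLM.contDiff.comp hg, hc.comp_left (g := ((↑) : ℝ → ℂ)) rfl⟩
    simpa using this
  filter_upwards [h0, Lp.coeFn_zero F 2 (volume : Measure (EuclideanSpace ℝ (Fin n)))] with x h1 h2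
  rw [h1, h2]; rfl

/-- Test directions may be restricted to a dense set. Taken to be the finite particle vectors, it
makes the field operators explicit on the test side. -/
theorem isWeakDeriv_iff_inner [CompleteSpace F] {j : Fin n} {u η : L2 n F} {D : Set F}
    (hD : Dense D) :
    IsWeakDeriv j u η ↔ ∀ (f : EuclideanSpace ℝ (Fin n) → ℂ) (hf : IsTest f), ∀ v ∈ D,
      inner ℂ (testVec (hf.partialDeriv j) v) u = - inner ℂ (testVec hf v) η := by
  simp only [inner_testVec_eq, ← inner_neg_right]
  constructor
  · intro h f hf v _
    rw [h f hf]
  · intro h f hf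
    exact hD.eq_of_inner_right ℂ fun v hv => h f hf v hv

/-- Weak derivatives are unique, so the relation defining `momentum` is its graph. The factor
`Complex.I` expresses ∂_j = i p_j. -/
theorem mem_graph_momentum [CompleteSpace F] {j : Fin n} {u η : L2 n F} :
    (u, η) ∈ (momentum F j).graph ↔ IsWeakDeriv j u (Complex.I • η) := by
  have aux : ∀ {u η : L2 n F}, (∀ f : EuclideanSpace ℝ (Fin n) → ℂ, ContDiff ℝ (⊤ : ℕ∞) f →
      HasCompactSupport f → ∫ x, partialDeriv j f x • u x = - ∫ x, f x • (Complex.I • η x)) ↔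
      IsWeakDeriv j u (Complex.I • η) := by
    intro u η
    have e : ∀ f : EuclideanSpace ℝ (Fin n) → ℂ,
        ∫ x, f x • (Complex.I • η) x = ∫ x, f x • (Complex.I • η x) := fun f =>
      integral_congr_ae <| by
        filter_upwards [Lp.coeFn_smul Complex.I η] with x hx
        rw [hx, Pi.smul_apply]
    constructor
    · intro h f hf
      rw [e, h f hf.smooth hf.compact]
    · intro h f h1 h2
      rw [← e, h f ⟨h1, h2⟩]
  rw [momentum, Submodule.toLinearPMap_graph_eq]
  · exact aux
  · rintro ⟨u, η⟩ h hu
    dsimp only at hu ⊢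
    subst hu
    have h' := (isWeakDeriv_iff_inner dense_univ).1 (aux.1 h)
    have h0 : Complex.I • η = 0 := ext_testVec dense_univ fun f hf v hv => by
      rw [← neg_eq_zero, ← h' f hf v hv, inner_zero_right]
    exact (smul_eq_zero.1 h0).resolve_left Complex.I_ne_zero

theorem IsWeakDeriv.smul [CompleteSpace F] {j : Fin n} {u η : L2 n F} (c : ℂ)
    (h : IsWeakDeriv j u η) : IsWeakDeriv j (c • u) (c • η) := by
  rw [isWeakDeriv_iff_inner dense_univ] at *
  intro f hf v hv
  rw [inner_smul_right, inner_smul_right, h f hf v hv]; ring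

/-- A bounded operator on the fibre commutes with the integral over ℝⁿ. The application is to
bounded cut-offs of the field energy. -/
theorem IsWeakDeriv.compLpL [CompleteSpace F] {F' : Type*} [NormedAddCommGroup F']
    [InnerProductSpace ℂ F'] [CompleteSpace F'] (B : F →L[ℂ] F') {j : Fin n} {u η : L2 n F}
    (h : IsWeakDeriv j u η) : IsWeakDeriv j (B.compLpL 2 volume u) (B.compLpL 2 volume η) := by
  have e : ∀ (f : EuclideanSpace ℝ (Fin n) → ℂ), IsTest f → ∀ u : L2 n F,
      ∫ x, f x • (B.compLpL 2 volume u) x = B (∫ x, f x • u x) := by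
    intro f hf u
    rw [← B.integral_comp_comm (integrable_testFunction_smul hf.continuous hf.compact u)]
    refine integral_congr_ae ?_
    filter_upwards [B.coeFn_compLpL (p := 2) (μ := volume) u] with x hx
    rw [hx, map_smul]
  intro f hf
  rw [e _ (hf.partialDeriv j), e f hf, h f hf, map_neg]

/-- Translation by `c` in `L²(ℝⁿ; F)`. -/
def translate (c : EuclideanSpace ℝ (Fin n)) : L2 n F →ₗᵢ[ℂ] L2 n F :=
  Lp.compMeasurePreservingₗᵢ ℂ (fun x => x + c) (measurePreserving_add_right volume c)

theorem coeFn_translate (c : EuclideanSpace ℝ (Fin n)) (u : L2 n F) :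
    translate c u =ᵐ[volume] fun x => u (x + c) :=
  Lp.coeFn_compMeasurePreserving u (measurePreserving_add_right volume c)

theorem continuous_translate_smul (e : EuclideanSpace ℝ (Fin n)) (u : L2 n F) :
    Continuous fun t : ℝ => translate (t • e) u := by
  have hg : Continuous fun t : ℝ =>
      (⟨fun x => x + t • e, by fun_prop⟩ : C(EuclideanSpace ℝ (Fin n), EuclideanSpace ℝ (Fin n))) :=
    ContinuousMap.continuous_of_continuous_uncurry _ (by
      change Continuous fun p : ℝ × EuclideanSpace ℝ (Fin n) => p.2 + p.1 • e
      fun_prop)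
  exact Continuous.compMeasurePreservingLp (continuous_const (y := u)) hg
    (fun t => measurePreserving_add_right volume (t • e)) (by simp)

theorem translate_zero (u : L2 n F) : translate 0 u = u := by
  refine Lp.ext ?_
  filter_upwards [coeFn_translate 0 u] with x hx
  rw [hx, add_zero]

theorem inner_translate (c : EuclideanSpace ℝ (Fin n)) (u v : L2 n F) :
    inner ℂ (translate c u) v = inner ℂ u (translate (-c) v) := by
  have hq := (measurePreserving_add_right (volume : Measure (EuclideanSpace ℝ (Fin n))) c)
  rw [L2.inner_def, L2.inner_def,
    ← integral_add_right_eq_self (fun x => inner ℂ (u x) (translate (-c) v x)) c]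
  refine integral_congr_ae ?_
  filter_upwards [coeFn_translate c u,
    hq.quasiMeasurePreserving.ae (coeFn_translate (-c) v)] with x h1 h2
  rw [h1, h2, add_neg_cancel_right]

theorem translate_testVec (c : EuclideanSpace ℝ (Fin n)) {f : EuclideanSpace ℝ (Fin n) → ℂ}
    (hf : IsTest f) (v : F) : translate (-c) (testVec hf v) = testVec (hf.translate c) v := by
  have hq := (measurePreserving_add_right (volume : Measure (EuclideanSpace ℝ (Fin n))) (-c))
  refine Lp.ext ?_
  filter_upwards [coeFn_translate (-c) (testVec hf v),
    hq.quasiMeasurePreserving.ae (memLp_smul_const hf v).coeFn_toLp,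
    (memLp_smul_const (hf.translate c) v).coeFn_toLp] with x h1 h2 h3
  rw [h1, testVec, testVec, h2, h3, sub_eq_add_neg]

theorem inner_testVec_translate (c : EuclideanSpace ℝ (Fin n))
    {f : EuclideanSpace ℝ (Fin n) → ℂ} (hf : IsTest f) (v : F) (u : L2 n F) :
    inner ℂ (testVec hf v) (translate c u) = inner ℂ (testVec (hf.translate c) v) u := by
  rw [← translate_testVec, inner_translate, neg_neg]

/-- The translation is moved onto the smooth test function and differentiated under the integral.
The weak derivative relation, for the translated test function, then moves the derivative back to
`u`; its minus sign cancels that of `x - s • e`. -/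
theorem hasDerivAt_inner_translate [CompleteSpace F] {j : Fin n} {u η : L2 n F}
    (h : IsWeakDeriv j u η)
    {f : EuclideanSpace ℝ (Fin n) → ℂ} (hf : IsTest f) (v : F) (s₀ : ℝ) :
    HasDerivAt (fun s : ℝ => inner ℂ (testVec hf v) (translate (s • EuclideanSpace.single j (1 : ℝ)) u))
      (inner ℂ (testVec hf v) (translate (s₀ • EuclideanSpace.single j (1 : ℝ)) η)) s₀ := by
  set e : EuclideanSpace ℝ (Fin n) := EuclideanSpace.single j (1 : ℝ) with he
  obtain ⟨M, hM⟩ := (hf.partialDeriv j).compact.exists_bound_of_continuous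
    (hf.partialDeriv j).continuous
  -- This compact set contains the supports of all translates with parameter within distance 1 of
  -- `s₀`. Since `u` is locally integrable, the dominating function only has to be integrable on it.
  set K : Set (EuclideanSpace ℝ (Fin n)) :=
    (fun z : EuclideanSpace ℝ (Fin n) × ℝ => z.1 + z.2 • e) ''
      (tsupport f ×ˢ Set.Icc (s₀ - 1) (s₀ + 1)) with hKdef
  have hK : IsCompact K :=
    (hf.compact.isCompact.prod isCompact_Icc).image (by fun_prop)
  have hw : MemLp (fun x => inner ℂ v (u x)) 2 volume := (Lp.memLp u).const_inner v
  have hwK : IntegrableOn (fun x => inner ℂ v (u x)) K volume :=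
    (hw.locallyIntegrable (by simp)).integrableOn_isCompact hK
  have hsupp : ∀ x, ∀ s ∈ Set.Ioo (s₀ - 1) (s₀ + 1), x ∉ K → partialDeriv j f (x - s • e) = 0 := by
    intro x s hs hx
    by_contra hne
    refine hx ⟨(x - s • e, s), ⟨?_, Set.Ioo_subset_Icc_self hs⟩, by simp⟩
    have h1 : x - s • e ∈ Function.support (fderiv ℝ f) := fun h0 => hne (by
      rw [partialDeriv, h0]; rfl)
    exact support_fderiv_subset ℝ h1
  have main := hasDerivAt_integral_of_dominated_loc_of_deriv_le (μ := volume) (𝕜 := ℝ) (x₀ := s₀)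
    (s := Set.Ioo (s₀ - 1) (s₀ + 1))
    (F := fun s x => f (x - s • e) * inner ℂ v (u x))
    (F' := fun s x => - partialDeriv j f (x - s • e) * inner ℂ v (u x))
    (bound := K.indicator fun x => M * ‖inner ℂ v (u x)‖)
    (Ioo_mem_nhds (by linarith) (by linarith))
    (Eventually.of_forall fun s =>
      ((hf.translate (s • e)).continuous.aestronglyMeasurable.mul hw.1))
    (by
      have := integrable_testFunction_smul (hf.translate (s₀ • e)).continuous
        (hf.translate (s₀ • e)).compact (F := ℂ) hw.toLp
      refine this.congr ?_
      filter_upwards [hw.coeFn_toLp] with x hx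
      rw [hx, smul_eq_mul])
    (by
      have := ((hf.partialDeriv j).translate (s₀ • e)).continuous.aestronglyMeasurable
        (μ := volume)
      exact this.neg.mul hw.1)
    (Eventually.of_forall fun x s hs => by
      by_cases hx : x ∈ K
      · rw [Set.indicator_of_mem hx, norm_mul, norm_neg]
        exact mul_le_mul_of_nonneg_right (hM _) (norm_nonneg _)
      · rw [Set.indicator_of_notMem hx, hsupp x s hs hx]; simp)
    ((integrable_indicator_iff hK.measurableSet).2 (Integrable.const_mul (Integrable.norm hwK) M))
    (Eventually.of_forall fun x s _ => by
      have h1 : HasDerivAt (fun s : ℝ => x - s • e) (-e) s := by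
        have := ((hasDerivAt_id s).smul_const e).const_sub x
        simpa using this
      have h2 := (hf.differentiable (x - s • e)).hasFDerivAt.comp_hasDerivAt s h1
      have h3 := h2.mul_const (inner ℂ v (u x))
      simpa [partialDeriv] using h3)
  have h2 := main.2
  simp only [inner_testVec_translate]
  have e1 : ∀ s : ℝ, inner ℂ (testVec (hf.translate (s • e)) v) u
      = ∫ x, f (x - s • e) * inner ℂ v (u x) := fun s => inner_testVec _ _ _
  simp only [e1]
  have h3 := (isWeakDeriv_iff_inner dense_univ).1 h _ (hf.translate (s₀ • e)) v (Set.mem_univ _)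
  rw [← neg_eq_iff_eq_neg] at h3
  rw [← h3, inner_testVec, ← integral_neg]
  simpa only [partialDeriv_translate, neg_mul] using h2

/-- Testing against products and integrating the scalar derivatives shows that the translate of `u`
by `t` is `u` plus the integral from 0 to `t` of the translates of `η`. These depend continuously on
the parameter in norm, so the difference quotient converges in norm. -/
theorem IsWeakDeriv.hasDerivAt_translate [CompleteSpace F] {j : Fin n} {u η : L2 n F}
    (h : IsWeakDeriv j u η) :
    HasDerivAt (fun t : ℝ => translate (t • EuclideanSpace.single j (1 : ℝ)) u) η 0 := by
  set e : EuclideanSpace ℝ (Fin n) := EuclideanSpace.single j (1 : ℝ) with he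
  have hc := continuous_translate_smul e η
  have key : ∀ t : ℝ, translate (t • e) u = u + ∫ s in (0 : ℝ)..t, translate (s • e) η := by
    intro t
    rw [← sub_eq_zero]
    refine ext_testVec dense_univ fun f hf v _ => ?_
    have h1 : ∫ s in (0 : ℝ)..t, inner ℂ (testVec hf v) (translate (s • e) η)
        = inner ℂ (testVec hf v) (translate (t • e) u)
          - inner ℂ (testVec hf v) (translate ((0 : ℝ) • e) u) :=
      intervalIntegral.integral_eq_sub_of_hasDerivAt
        (fun s _ => hasDerivAt_inner_translate h hf v s)
        ((continuous_const.inner hc).intervalIntegrable _ _)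
    have h2 := (innerSL ℂ (testVec hf v)).intervalIntegral_comp_comm
      (hc.intervalIntegrable (μ := volume) 0 t)
    simp only [innerSL_apply_apply] at h2
    rw [zero_smul, translate_zero] at h1
    rw [inner_sub_right, inner_add_right, ← h2, h1]
    ring
  have h1 := (hc.integral_hasStrictDerivAt 0 0).hasDerivAt.const_add u
  simp only [zero_smul, translate_zero] at h1
  exact h1.congr_of_eventuallyEq (Eventually.of_forall key)

/-- Integration by parts in `L²(ℝⁿ; F)`. -/
theorem IsWeakDeriv.inner_eq [CompleteSpace F] {j : Fin n} {u η v ζ : L2 n F}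
    (hu : IsWeakDeriv j u η) (hv : IsWeakDeriv j v ζ) :
    inner ℂ η v = - inner ℂ u ζ := by
  have h1 := hu.hasDerivAt_translate.inner ℂ (hasDerivAt_const (0 : ℝ) v)
  -- The base point is written `-0` so that the chain rule with `t ↦ -t` applies at `0`.
  have hv' : HasDerivAt (fun t : ℝ => translate (t • EuclideanSpace.single j (1 : ℝ)) v) ζ (-0) := by
    rw [neg_zero]; exact hv.hasDerivAt_translate
  have h2 := (hasDerivAt_const (0 : ℝ) u).inner ℂ (hv'.scomp (0 : ℝ) (hasDerivAt_neg (0 : ℝ)))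
  -- Translations are unitary, so one scalar function of `t` is differentiated in two ways;
  -- uniqueness of its derivative is the integration by parts formula.
  have e : (fun t : ℝ => inner ℂ (translate (t • EuclideanSpace.single j (1 : ℝ)) u) v) =
      fun t : ℝ => inner ℂ u (translate ((-t) • EuclideanSpace.single j (1 : ℝ)) v) := by
    funext t
    rw [inner_translate, neg_smul]
  rw [e] at h1
  have := h1.unique h2
  simpa using this

/-- The momentum operators are symmetric. -/
theorem momentum_symmetric [CompleteSpace F] {j : Fin n} {u η v ζ : L2 n F}
    (hu : (u, η) ∈ (momentum F j).graph) (hv : (v, ζ) ∈ (momentum F j).graph) :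
    inner ℂ η v = inner ℂ u ζ := by
  have h := (mem_graph_momentum.1 hu).inner_eq (mem_graph_momentum.1 hv)
  rw [inner_smul_left, inner_smul_right, Complex.conj_I, neg_mul] at h
  exact mul_left_cancel₀ Complex.I_ne_zero (neg_injective h)

/-- `K` is the bounded distributional derivative `∂_j g` of the bounded function `g`. -/
structure IsBddWeakDeriv (j : Fin n) (g K : EuclideanSpace ℝ (Fin n) → F) : Prop where
  memLp : MemLp g ∞ volume
  memLp_deriv : MemLp K ∞ volume
  integral_eq : ∀ f : EuclideanSpace ℝ (Fin n) → ℂ, IsTest f →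
    ∫ x, partialDeriv j f x • g x = - ∫ x, f x • K x

theorem IsTest.memLp_smul {f : EuclideanSpace ℝ (Fin n) → ℂ} (hf : IsTest f)
    {g : EuclideanSpace ℝ (Fin n) → F} (hg : MemLp g ∞ volume) (p : ℝ≥0∞) :
    MemLp (fun x => f x • g x) p volume :=
  hg.smul (r := p) (hf.memLp p)

theorem IsTest.integrable_smul {f : EuclideanSpace ℝ (Fin n) → ℂ} (hf : IsTest f)
    {g : EuclideanSpace ℝ (Fin n) → F} (hg : MemLp g ∞ volume) :
    Integrable (fun x => f x • g x) volume :=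
  memLp_one_iff_integrable.1 (hf.memLp_smul hg 1)

/-- A test function factor brings the bounded function `g` into L², where integration by parts is
available. The product rule comes from using the product of two test functions as a test function
for `g`. -/
theorem IsBddWeakDeriv.isWeakDeriv_smul {j : Fin n} {g K : EuclideanSpace ℝ (Fin n) → F}
    (h : IsBddWeakDeriv j g K) {f : EuclideanSpace ℝ (Fin n) → ℂ} (hf : IsTest f) :
    IsWeakDeriv j ((hf.memLp_smul h.memLp 2).toLp _)
      (((hf.partialDeriv j).memLp_smul h.memLp 2).toLp _
        + (hf.memLp_smul h.memLp_deriv 2).toLp _) := by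
  intro f' hf'
  have e1 : ∫ x, partialDeriv j f' x • ((hf.memLp_smul h.memLp 2).toLp _ : L2 n F) x
      = ∫ x, (partialDeriv j (fun x => f' x * f x) x • g x
          - (f' x * partialDeriv j f x) • g x) := by
    refine integral_congr_ae ?_
    filter_upwards [(hf.memLp_smul h.memLp 2).coeFn_toLp] with x hx
    rw [hx, partialDeriv_mul hf' hf, smul_smul, ← sub_smul, add_sub_cancel_right]
  have e2 : ∫ x, f' x • (((hf.partialDeriv j).memLp_smul h.memLp 2).toLp _
        + (hf.memLp_smul h.memLp_deriv 2).toLp _ : L2 n F) x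
      = ∫ x, ((f' x * partialDeriv j f x) • g x + (f' x * f x) • K x) := by
    refine integral_congr_ae ?_
    filter_upwards [((hf.partialDeriv j).memLp_smul h.memLp 2).coeFn_toLp,
      (hf.memLp_smul h.memLp_deriv 2).coeFn_toLp,
      Lp.coeFn_add (((hf.partialDeriv j).memLp_smul h.memLp 2).toLp _)
        ((hf.memLp_smul h.memLp_deriv 2).toLp _)] with x h1 h2 h3
    rw [h3, Pi.add_apply, h1, h2, smul_add, smul_smul, smul_smul]
  have i1 := ((hf'.mul hf).partialDeriv j).integrable_smul h.memLp
  have i2 := (hf'.mul (hf.partialDeriv j)).integrable_smul h.memLp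
  have i3 := (hf'.mul hf).integrable_smul h.memLp_deriv
  rw [e1, e2, integral_sub i1 i2, integral_add i2 i3, h.integral_eq _ (hf'.mul hf)]
  abel

/-- The product rule `∂_j ⟨g, φ⟩ = ⟨∂_j g, φ⟩ + ⟨g, ∂_j φ⟩` in the sense of distributions. -/
theorem IsBddWeakDeriv.integral_inner [CompleteSpace F] {j : Fin n}
    {g K : EuclideanSpace ℝ (Fin n) → F}
    (h : IsBddWeakDeriv j g K) {φ η : L2 n F} (hφ : IsWeakDeriv j φ η)
    {f : EuclideanSpace ℝ (Fin n) → ℂ} (hf : IsTest f) :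
    ∫ x, partialDeriv j f x * inner ℂ (g x) (φ x)
      = - ∫ x, f x * (inner ℂ (K x) (φ x) + inner ℂ (g x) (η x)) := by
  -- The conjugate of `f` is used because the inner product is antilinear in its first argument.
  have key := (h.isWeakDeriv_smul hf.conj).inner_eq hφ
  have e : ∀ {f : EuclideanSpace ℝ (Fin n) → ℂ} (hf : IsTest f) {g : EuclideanSpace ℝ (Fin n) → F}
      (hg : MemLp g ∞ volume) (φ : L2 n F),
      inner ℂ ((hf.conj.memLp_smul hg 2).toLp _ : L2 n F) φ = ∫ x, f x * inner ℂ (g x) (φ x) := by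
    intro f hf g hg φ
    rw [L2.inner_def]
    refine integral_congr_ae ?_
    filter_upwards [(hf.conj.memLp_smul hg 2).coeFn_toLp] with x hx
    rw [hx, inner_smul_left, Complex.conj_conj]
  have e' : inner ℂ (((hf.conj.partialDeriv j).memLp_smul h.memLp 2).toLp _ : L2 n F) φ
      = ∫ x, partialDeriv j f x * inner ℂ (g x) (φ x) := by
    have e'' := MemLp.toLp_congr ((hf.conj.partialDeriv j).memLp_smul h.memLp 2)
      ((hf.partialDeriv j).conj.memLp_smul h.memLp 2)
      (Eventually.of_forall fun x => by simp only [partialDeriv_conj hf])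
    rw [e'', e (hf.partialDeriv j) h.memLp φ]
  have i : ∀ {f : EuclideanSpace ℝ (Fin n) → ℂ} (hf : IsTest f) {g : EuclideanSpace ℝ (Fin n) → F}
      (hg : MemLp g ∞ volume) (φ : L2 n F),
      Integrable (fun x => f x * inner ℂ (g x) (φ x)) volume := by
    intro f hf g hg φ
    refine (L2.integrable_inner (𝕜 := ℂ) ((hf.conj.memLp_smul hg 2).toLp _ : L2 n F) φ).congr ?_
    filter_upwards [(hf.conj.memLp_smul hg 2).coeFn_toLp] with x hx
    rw [hx, inner_smul_left, Complex.conj_conj]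
  rw [inner_add_left, e', e hf h.memLp_deriv, e hf h.memLp] at key
  simp only [mul_add]
  rw [integral_add (i hf h.memLp_deriv φ) (i hf h.memLp η)]
  linear_combination key

end WeakDeriv

/-! ### Product functions -/

section ProductDensity

variable {α β : Type*} [MeasurableSpace α] [MeasurableSpace β] {μ : Measure α} {ν : Measure β}
  [SigmaFinite μ] [SigmaFinite ν]

/-- A square integrable function on a product whose integrals over all rectangles of finite measure
vanish is zero. -/
theorem ae_eq_zero_of_setIntegral_prod {g : α × β → ℂ} (hg : MemLp g 2 (μ.prod ν))
    (h : ∀ (A : Set α) (B : Set β), MeasurableSet A → MeasurableSet B → μ A < ∞ → ν B < ∞ →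
      ∫ z in A ×ˢ B, g z ∂(μ.prod ν) = 0) : g =ᵐ[μ.prod ν] 0 := by
  have hint : ∀ s : Set (α × β), μ.prod ν s < ∞ → IntegrableOn g s (μ.prod ν) := fun s hs => by
    have : Fact ((μ.prod ν) s < ∞) := ⟨hs⟩
    exact (hg.restrict s).integrable (by norm_num)
  refine ae_eq_zero_of_forall_setIntegral_eq_of_sigmaFinite (fun s _ hs => hint s hs)
    fun s hs hfin => ?_
  set R : ℕ → Set (α × β) := fun n => spanningSets μ n ×ˢ spanningSets ν n with hR
  have hRm : ∀ n, MeasurableSet (R n) := fun n =>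
    (measurableSet_spanningSets μ n).prod (measurableSet_spanningSets ν n)
  have hRfin : ∀ n, μ.prod ν (R n) < ∞ := fun n => by
    rw [hR, Measure.prod_prod]
    exact ENNReal.mul_lt_top (measure_spanningSets_lt_top μ n) (measure_spanningSets_lt_top ν n)
  have hRmono : Monotone R := fun n k hnk =>
    Set.prod_mono (monotone_spanningSets μ hnk) (monotone_spanningSets ν hnk)
  have hRU : (⋃ n, R n) = Set.univ := by
    rw [hR, Set.iUnion_prod_of_monotone (monotone_spanningSets μ) (monotone_spanningSets ν),
      iUnion_spanningSets, iUnion_spanningSets, Set.univ_prod_univ]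
  -- The π-λ theorem with rectangles as π-system, run inside a rectangle of finite measure so that
  -- `g` is integrable and complements can be subtracted.
  have key : ∀ n, ∀ s, MeasurableSet s → ∫ z in s, g z ∂((μ.prod ν).restrict (R n)) = 0 := by
    intro n s hs
    have hi : Integrable g ((μ.prod ν).restrict (R n)) := hint _ (hRfin n)
    induction s, hs using MeasurableSpace.induction_on_inter generateFrom_prod.symm isPiSystem_prod
      with
    | empty => simp
    | basic t ht =>
      obtain ⟨A, hA, B, hB, rfl⟩ := ht
      rw [Measure.restrict_restrict (hA.prod hB), hR, Set.prod_inter_prod]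
      exact h _ _ (hA.inter (measurableSet_spanningSets μ n))
        (hB.inter (measurableSet_spanningSets ν n))
        ((measure_mono Set.inter_subset_right).trans_lt (measure_spanningSets_lt_top μ n))
        ((measure_mono Set.inter_subset_right).trans_lt (measure_spanningSets_lt_top ν n))
    | compl t ht ih =>
      rw [setIntegral_compl ht hi, ih, sub_zero]
      exact h _ _ (measurableSet_spanningSets μ n) (measurableSet_spanningSets ν n)
        (measure_spanningSets_lt_top μ n) (measure_spanningSets_lt_top ν n)
    | iUnion f hd hf ih =>
      rw [integral_iUnion hf hd hi.integrableOn]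
      simp [ih]
  have hlim := tendsto_setIntegral_of_monotone (μ := (μ.prod ν).restrict s) (f := g) hRm hRmono
    (by rw [hRU, integrableOn_univ]; exact hint s hfin)
  rw [hRU, Measure.restrict_univ] at hlim
  refine tendsto_nhds_unique hlim ?_
  have : ∀ n, ∫ z in R n, g z ∂((μ.prod ν).restrict s) = 0 := fun n => by
    rw [Measure.restrict_restrict (hRm n), Set.inter_comm, ← Measure.restrict_restrict hs]
    exact key n s hs
  simp only [this]
  exact tendsto_const_nhds

end ProductDensity

/-! ### Creation and annihilation operators on the particle sectors -/

section Sector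

variable {X : Type*} [MeasurableSpace X] (μ : Measure X) [SigmaFinite μ]

instance instNormedAddCommGroupSym (m : ℕ) : NormedAddCommGroup (Sym μ m) :=
  Submodule.normedAddCommGroup _

instance instInnerProductSpaceSym (m : ℕ) : InnerProductSpace ℂ (Sym μ m) :=
  Submodule.innerProductSpace _

instance instNormedSpaceSym (m : ℕ) : NormedSpace ℂ (Sym μ m) :=
  InnerProductSpace.toNormedSpace

instance instSeminormedAddCommGroupSym (m : ℕ) : SeminormedAddCommGroup (Sym μ m) :=
  (instNormedAddCommGroupSym μ m).toSeminormedAddCommGroup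

instance instModuleSym (m : ℕ) : Module ℂ (Sym μ m) := (instNormedSpaceSym μ m).toModule

instance instMulActionSym (m : ℕ) : MulAction ℂ (Sym μ m) :=
  (instModuleSym μ m).toDistribMulAction.toMulAction

instance instSeminormedAddCommGroupSymCLM (m l : ℕ) :
    SeminormedAddCommGroup (Sym μ m →L[ℂ] Sym μ l) :=
  ContinuousLinearMap.toSeminormedAddCommGroup

instance instNormedSpaceSymCLM (m l : ℕ) : NormedSpace ℂ (Sym μ m →L[ℂ] Sym μ l) :=
  ContinuousLinearMap.toNormedSpace

instance instModuleSymCLM (m l : ℕ) : Module ℂ (Sym μ m →L[ℂ] Sym μ l) :=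
  (instNormedSpaceSymCLM μ m l).toModule

theorem coeFn_tensor {m : ℕ} (h : Lp ℂ 2 μ) (f : TensorPower μ m) :
    tensor μ h f =ᵐ[Measure.pi fun _ : Fin (m + 1) => μ]
      fun k => h (k 0) * f (fun i : Fin m => k i.succ) :=
  (memLp_tensor μ h f).coeFn_toLp

theorem coeFn_permute {m : ℕ} (σ : Equiv.Perm (Fin m)) (f : TensorPower μ m) :
    permute μ σ f =ᵐ[Measure.pi fun _ : Fin m => μ] fun k => f (k ∘ σ) :=
  Lp.coeFn_compMeasurePreserving f (measurePreserving_perm μ σ)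

theorem quasiMeasurePreserving_head (m : ℕ) :
    Measure.QuasiMeasurePreserving (fun k : Fin (m + 1) → X => k 0)
      (Measure.pi fun _ : Fin (m + 1) => μ) μ :=
  Measure.quasiMeasurePreserving_fst.comp (measurePreserving_headTail μ m).quasiMeasurePreserving

theorem quasiMeasurePreserving_tail (m : ℕ) :
    Measure.QuasiMeasurePreserving (fun k : Fin (m + 1) → X => fun i : Fin m => k i.succ)
      (Measure.pi fun _ : Fin (m + 1) => μ) (Measure.pi fun _ : Fin m => μ) :=
  Measure.quasiMeasurePreserving_snd.comp (measurePreserving_headTail μ m).quasiMeasurePreserving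

theorem measurableEmbedding_headTail (m : ℕ) :
    MeasurableEmbedding (fun k : Fin (m + 1) → X => (k 0, fun i : Fin m => k i.succ)) :=
  (MeasurableEquiv.piFinSuccAbove (fun _ : Fin (m + 1) => X) 0).measurableEmbedding

theorem inner_tensor {m : ℕ} (h h' : Lp ℂ 2 μ) (f f' : TensorPower μ m) :
    inner ℂ (tensor μ h f) (tensor μ h' f') = inner ℂ h h' * inner ℂ f f' := by
  rw [L2.inner_def, L2.inner_def, L2.inner_def, ← integral_prod_mul,
    ← (measurePreserving_headTail μ m).integral_comp (measurableEmbedding_headTail m)]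
  refine integral_congr_ae ?_
  filter_upwards [coeFn_tensor μ h f, coeFn_tensor μ h' f'] with k h1 h2
  rw [h1, h2]
  simp only [RCLike.inner_apply, map_mul]
  ring

theorem norm_tensor {m : ℕ} (h : Lp ℂ 2 μ) (f : TensorPower μ m) :
    ‖tensor μ h f‖ = ‖h‖ * ‖f‖ := by
  have : (‖tensor μ h f‖ : ℂ) ^ 2 = ((‖h‖ * ‖f‖ : ℝ) : ℂ) ^ 2 := by
    rw [← RCLike.ofReal_eq_complex_ofReal, ← inner_self_eq_norm_sq_to_K (𝕜 := ℂ), inner_tensor,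
      inner_self_eq_norm_sq_to_K, inner_self_eq_norm_sq_to_K]
    push_cast
    simp only [RCLike.ofReal_eq_complex_ofReal]
    ring
  have h2 : ‖tensor μ h f‖ ^ 2 = (‖h‖ * ‖f‖) ^ 2 := by exact_mod_cast this
  exact (pow_left_inj₀ (norm_nonneg _) (by positivity) two_ne_zero).1 h2

theorem tensor_add_left {m : ℕ} (h h' : Lp ℂ 2 μ) (f : TensorPower μ m) :
    tensor μ (h + h') f = tensor μ h f + tensor μ h' f := by
  refine Lp.ext ?_
  filter_upwards [coeFn_tensor μ h f, coeFn_tensor μ h' f, coeFn_tensor μ (h + h') f,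
    Lp.coeFn_add (tensor μ h f) (tensor μ h' f),
    (quasiMeasurePreserving_head μ m).ae (Lp.coeFn_add h h')] with k h1 h2 h3 h4 h5
  rw [h3, h4, Pi.add_apply, h1, h2, h5, Pi.add_apply, add_mul]

theorem tensor_smul_left {m : ℕ} (c : ℂ) (h : Lp ℂ 2 μ) (f : TensorPower μ m) :
    tensor μ (c • h) f = c • tensor μ h f := by
  refine Lp.ext ?_
  filter_upwards [coeFn_tensor μ h f, coeFn_tensor μ (c • h) f,
    Lp.coeFn_smul c (tensor μ h f),
    (quasiMeasurePreserving_head μ m).ae (Lp.coeFn_smul c h)] with k h1 h3 h4 h5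
  rw [h3, h4, Pi.smul_apply, h1, h5, Pi.smul_apply, smul_eq_mul, smul_eq_mul, mul_assoc]

/-- The bounded bilinear map `(h, f) ↦ h ⊗ f`. -/
def tensorL (m : ℕ) : Lp ℂ 2 μ →L[ℂ] TensorPower μ m →L[ℂ] TensorPower μ (m + 1) :=
  LinearMap.mkContinuous₂
    { toFun := fun h => tensor μ h
      map_add' := fun h h' => LinearMap.ext fun f => tensor_add_left μ h h' f
      map_smul' := fun c h => LinearMap.ext fun f => tensor_smul_left μ c h f } 1
    fun h f => by rw [one_mul]; exact (norm_tensor μ h f).le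

/-- Two vectors with the same inner products with all products `h ⊗ f` agree. -/
theorem eq_zero_of_inner_tensor {m : ℕ} {g : TensorPower μ (m + 1)}
    (hg : ∀ (h : Lp ℂ 2 μ) (f : TensorPower μ m), inner ℂ (tensor μ h f) g = 0) : g = 0 := by
  set e := MeasurableEquiv.piFinSuccAbove (fun _ : Fin (m + 1) => X) 0 with he
  have hmp := measurePreserving_headTail μ m
  have hmp' : MeasurePreserving e (Measure.pi fun _ : Fin (m + 1) => μ)
    (μ.prod (Measure.pi fun _ : Fin m => μ)) := hmp
  have hg' : MemLp (g ∘ e.symm) 2 (μ.prod (Measure.pi fun _ : Fin m => μ)) :=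
    (Lp.memLp g).comp_measurePreserving (hmp'.symm e)
  have h0 : g ∘ e.symm =ᵐ[μ.prod (Measure.pi fun _ : Fin m => μ)] 0 := by
    refine ae_eq_zero_of_setIntegral_prod hg' fun A B hA hB hAf hBf => ?_
    have := hg (indicatorConstLp 2 hA hAf.ne 1) (indicatorConstLp 2 hB hBf.ne 1)
    rw [← this, L2.inner_def, ← integral_indicator (hA.prod hB),
      ← hmp.integral_comp (measurableEmbedding_headTail m)]
    refine integral_congr_ae ?_
    filter_upwards [coeFn_tensor μ (indicatorConstLp 2 hA hAf.ne 1) (indicatorConstLp 2 hB hBf.ne 1),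
      (quasiMeasurePreserving_head μ m).ae
        (indicatorConstLp_coeFn (p := 2) (hs := hA) (hμs := hAf.ne) (c := (1 : ℂ))),
      (quasiMeasurePreserving_tail μ m).ae
        (indicatorConstLp_coeFn (p := 2) (hs := hB) (hμs := hBf.ne) (c := (1 : ℂ)))]
      with k h1 h2 h3
    have e1 : e.symm (k 0, fun i : Fin m => k i.succ) = k := e.symm_apply_apply k
    rw [h1, h2, h3]
    by_cases ha : k 0 ∈ A <;> by_cases hb : (fun i : Fin m => k i.succ) ∈ B <;>
      simp [Set.indicator, ha, hb, e1]
  refine Lp.ext ?_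
  filter_upwards [hmp.quasiMeasurePreserving.ae h0,
    Lp.coeFn_zero ℂ 2 (Measure.pi fun _ : Fin (m + 1) => μ)] with k h1 h2
  have e1 : e.symm (k 0, fun i : Fin m => k i.succ) = k := e.symm_apply_apply k
  rw [h2, ← e1]
  exact h1

theorem permute_mul {m : ℕ} (σ τ : Equiv.Perm (Fin m)) (f : TensorPower μ m) :
    permute μ (σ * τ) f = permute μ σ (permute μ τ f) := by
  refine Lp.ext ?_
  filter_upwards [coeFn_permute μ (σ * τ) f, coeFn_permute μ σ (permute μ τ f),
    (measurePreserving_perm μ σ).quasiMeasurePreserving.ae (coeFn_permute μ τ f)] with k h1 h2 h3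
  rw [h1, h2, h3]
  rfl

theorem permute_one {m : ℕ} (f : TensorPower μ m) : permute μ 1 f = f := by
  refine Lp.ext ?_
  filter_upwards [coeFn_permute μ 1 f] with k h1
  rw [h1]
  rfl

theorem inner_permute {m : ℕ} (σ : Equiv.Perm (Fin m)) (f g : TensorPower μ m) :
    inner ℂ (permute μ σ f) (permute μ σ g) = inner ℂ f g :=
  (permute μ σ).inner_map_map f g

theorem inner_permute_left {m : ℕ} (σ : Equiv.Perm (Fin m)) (f g : TensorPower μ m) :
    inner ℂ (permute μ σ f) g = inner ℂ f (permute μ σ⁻¹ g) := by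
  rw [← inner_permute μ σ f, ← permute_mul, mul_inv_cancel, permute_one]

/-- The permutation `decomposeFin.symm (0, ρ)` fixes the first variable, which carries `h`, and acts
by `ρ` on the others. -/
theorem permute_tensor {m : ℕ} (ρ : Equiv.Perm (Fin m)) (h : Lp ℂ 2 μ) (f : TensorPower μ m) :
    permute μ (Equiv.Perm.decomposeFin.symm (0, ρ)) (tensor μ h f) = tensor μ h (permute μ ρ f) := by
  refine Lp.ext ?_
  filter_upwards [coeFn_permute μ (Equiv.Perm.decomposeFin.symm (0, ρ)) (tensor μ h f),
    (measurePreserving_perm μ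
      (Equiv.Perm.decomposeFin.symm (0, ρ))).quasiMeasurePreserving.ae (coeFn_tensor μ h f),
    coeFn_tensor μ h (permute μ ρ f),
    (quasiMeasurePreserving_tail μ m).ae (coeFn_permute μ ρ f)] with k h1 h2 h3 h4
  rw [h1, h2, h3, h4]
  simp [Function.comp_def, Equiv.Perm.decomposeFin_symm_apply_succ]

theorem exists_decomposeFin_of_fix {m : ℕ} {σ : Equiv.Perm (Fin (m + 1))} (hσ : σ 0 = 0) :
    ∃ ρ, σ = Equiv.Perm.decomposeFin.symm (0, ρ) := by
  obtain ⟨⟨i, ρ⟩, rfl⟩ := Equiv.Perm.decomposeFin.symm.surjective σ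
  rw [Equiv.Perm.decomposeFin_symm_apply_zero] at hσ
  exact ⟨ρ, by rw [hσ]⟩

theorem permute_tensor_of_fix {m : ℕ} {σ : Equiv.Perm (Fin (m + 1))} (hσ : σ 0 = 0)
    (h : Lp ℂ 2 μ) (f : Sym μ m) : permute μ σ (tensor μ h f) = tensor μ h f := by
  obtain ⟨ρ, rfl⟩ := exists_decomposeFin_of_fix hσ
  rw [permute_tensor, f.2 ρ]

/-- Symmetrization of a function which is already symmetric in all but the first variable. -/
theorem orthogonalProjection_of_fix {m : ℕ} {f : TensorPower μ (m + 1)}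
    (hf : ∀ σ : Equiv.Perm (Fin (m + 1)), σ 0 = 0 → permute μ σ f = f) :
    ((Sym μ (m + 1)).orthogonalProjectionOnto f : TensorPower μ (m + 1))
      = ((m + 1 : ℝ)⁻¹ : ℂ) • ∑ i, permute μ (Equiv.swap 0 i) f := by
  have hm : ((m : ℂ) + 1) ≠ 0 := by exact_mod_cast Nat.succ_ne_zero m
  rw [Submodule.coe_orthogonalProjectionOnto_apply]
  refine Submodule.eq_starProjection_of_mem_of_inner_eq_zero ?_ ?_
  · intro σ
    rw [map_smul, map_sum]
    congr 1
    -- The permutations `σ * swap 0 i` and `swap 0 (σ i)` differ on the right by a permutation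
    -- fixing `0`, which does not change `f`. Hence `σ` only rearranges the summands.
    have e : ∀ i, permute μ σ (permute μ (Equiv.swap 0 i) f) = permute μ (Equiv.swap 0 (σ i)) f := by
      intro i
      set ρ := (Equiv.swap 0 (σ i))⁻¹ * σ * Equiv.swap 0 i with hρ
      have h0 : ρ 0 = 0 := by simp [hρ]
      have h1 : σ * Equiv.swap 0 i = Equiv.swap 0 (σ i) * ρ := by
        rw [hρ, mul_assoc, mul_inv_cancel_left]
      rw [← permute_mul, h1, permute_mul, hf ρ h0]
    simp only [e]
    exact Equiv.sum_comp σ fun i => permute μ (Equiv.swap 0 i) f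
  -- Against a symmetric `w` every summand has the same inner product as `f`, so the average has it
  -- too.
  · intro w hw
    rw [inner_sub_left, inner_smul_left, sum_inner]
    have e : ∀ i, inner ℂ (permute μ (Equiv.swap 0 i) f) w = inner ℂ f w := fun i => by
      rw [inner_permute_left, hw]
    simp only [e, Finset.sum_const, Finset.card_univ, Fintype.card_fin, nsmul_eq_mul]
    push_cast
    simp only [map_inv₀, map_add, map_natCast, map_one]
    field_simp
    ring

theorem inner_createSector {m : ℕ} (h : Lp ℂ 2 μ) (ψ : Sym μ m) (χ : Sym μ (m + 1)) :
    inner ℂ (createSector μ h m ψ) χ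
      = ((Real.sqrt (m + 1) : ℝ) : ℂ) * inner ℂ (tensor μ h ψ) (χ : TensorPower μ (m + 1)) := by
  have e : createSector μ h m ψ = ((Real.sqrt (m + 1) : ℝ) : ℂ) •
    (Sym μ (m + 1)).orthogonalProjectionOnto (tensor μ h ψ) := rfl
  rw [e, inner_smul_left, Submodule.inner_orthogonalProjectionOnto_eq_of_mem_right,
    Complex.conj_ofReal]

theorem coe_createSector {m : ℕ} (h : Lp ℂ 2 μ) (ψ : Sym μ m) :
    (createSector μ h m ψ : TensorPower μ (m + 1)) = (((Real.sqrt (m + 1))⁻¹ : ℝ) : ℂ) •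
      ∑ i, permute μ (Equiv.swap 0 i) (tensor μ h ψ) := by
  have e : (createSector μ h m ψ : TensorPower μ (m + 1)) = ((Real.sqrt (m + 1) : ℝ) : ℂ) •
    ((Sym μ (m + 1)).orthogonalProjectionOnto (tensor μ h ψ) : TensorPower μ (m + 1)) := rfl
  rw [e, orthogonalProjection_of_fix μ fun σ hσ => permute_tensor_of_fix μ hσ h ψ, smul_smul]
  congr 1
  have h1 : (0 : ℝ) < (m : ℝ) + 1 := by positivity
  have : Real.sqrt (m + 1) * (m + 1 : ℝ)⁻¹ = (Real.sqrt (m + 1))⁻¹ := by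
    have h2 := Real.mul_self_sqrt h1.le
    have h3 := (Real.sqrt_pos.2 h1).ne'
    field_simp
    nlinarith
  rw [← this]
  push_cast
  ring

theorem norm_createSector_le {m : ℕ} (h : Lp ℂ 2 μ) (ψ : Sym μ m) :
    ‖createSector μ h m ψ‖ ≤ Real.sqrt (m + 1) * ‖h‖ * ‖ψ‖ := by
  have e : createSector μ h m ψ = ((Real.sqrt (m + 1) : ℝ) : ℂ) •
    (Sym μ (m + 1)).orthogonalProjectionOnto (tensor μ h ψ) := rfl
  rw [e, norm_smul, Complex.norm_real, Real.norm_of_nonneg (Real.sqrt_nonneg _), mul_assoc]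
  refine mul_le_mul_of_nonneg_left ?_ (Real.sqrt_nonneg _)
  exact ((Sym μ (m + 1)).norm_orthogonalProjectionOnto_apply_le _).trans (norm_tensor μ h _).le

/-- The creation operators on the `m`-particle space as a bounded bilinear map. -/
def createL (m : ℕ) : Lp ℂ 2 μ →L[ℂ] Sym μ m →L[ℂ] Sym μ (m + 1) :=
  LinearMap.mkContinuous₂
    { toFun := fun h => createSector μ h m
      map_add' := fun h h' => LinearMap.ext fun f => ext_inner_right ℂ fun χ => by
        rw [LinearMap.add_apply, inner_add_left, inner_createSector, inner_createSector,
          inner_createSector, tensor_add_left, inner_add_left, mul_add]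
      map_smul' := fun c h => LinearMap.ext fun f => ext_inner_right ℂ fun χ => by
        rw [RingHom.id_apply, LinearMap.smul_apply, inner_smul_left, inner_createSector,
          inner_createSector, tensor_smul_left, inner_smul_left, mul_left_comm] }
    (Real.sqrt (m + 1)) fun h f => norm_createSector_le μ h f

theorem createL_apply {m : ℕ} (h : Lp ℂ 2 μ) (f : Sym μ m) :
    createL μ m h f = createSector μ h m f := rfl

/-- The annihilation operator from the `(m+1)`-particle space to the `m`-particle space. -/
def annihL (m : ℕ) (h : Lp ℂ 2 μ) : Sym μ (m + 1) →L[ℂ] Sym μ m :=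
  ContinuousLinearMap.adjoint (createL μ m h)

theorem inner_annihL_left {m : ℕ} (h : Lp ℂ 2 μ) (χ : Sym μ (m + 1)) (ψ : Sym μ m) :
    inner ℂ (annihL μ m h χ) ψ = inner ℂ χ (createL μ m h ψ) :=
  ContinuousLinearMap.adjoint_inner_left _ _ _

theorem inner_annihL_right {m : ℕ} (h : Lp ℂ 2 μ) (χ : Sym μ (m + 1)) (ψ : Sym μ m) :
    inner ℂ ψ (annihL μ m h χ) = inner ℂ (createL μ m h ψ) χ :=
  ContinuousLinearMap.adjoint_inner_right _ _ _

/-- Contraction of the first variable with `h`. -/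
def contract (m : ℕ) (h : Lp ℂ 2 μ) : TensorPower μ (m + 1) →L[ℂ] TensorPower μ m :=
  ContinuousLinearMap.adjoint (tensorL μ m h)

theorem inner_contract_left {m : ℕ} (h : Lp ℂ 2 μ) (g : TensorPower μ (m + 1))
    (f : TensorPower μ m) : inner ℂ (contract μ m h g) f = inner ℂ g (tensor μ h f) :=
  ContinuousLinearMap.adjoint_inner_left _ _ _

theorem inner_contract_right {m : ℕ} (h : Lp ℂ 2 μ) (g : TensorPower μ (m + 1))
    (f : TensorPower μ m) : inner ℂ f (contract μ m h g) = inner ℂ (tensor μ h f) g :=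
  ContinuousLinearMap.adjoint_inner_right _ _ _

/-- A permutation of the remaining variables extends to one fixing the contracted variable, under
which `ψ` is invariant. -/
theorem contract_mem_sym {m : ℕ} (h : Lp ℂ 2 μ) (ψ : Sym μ (m + 1)) :
    contract μ m h ψ ∈ Sym μ m := by
  intro σ
  refine ext_inner_left ℂ fun v => ?_
  have h1 : inner ℂ v (permute μ σ (contract μ m h ψ))
      = inner ℂ (permute μ σ⁻¹ v) (contract μ m h ψ) := by
    rw [inner_permute_left, inv_inv]
  rw [h1, inner_contract_right, inner_contract_right, ← permute_tensor, inner_permute_left, ψ.2]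

theorem annihL_eq {m : ℕ} (h : Lp ℂ 2 μ) (ψ : Sym μ (m + 1)) :
    annihL μ m h ψ = ((Real.sqrt (m + 1) : ℝ) : ℂ) • ⟨contract μ m h ψ, contract_mem_sym μ h ψ⟩ :=
  ext_inner_left ℂ fun v => by
    rw [inner_annihL_right, createL_apply, inner_createSector, inner_smul_right, Submodule.coe_inner,
      inner_contract_right]

theorem swap_tensor_tensor {m : ℕ} (h u : Lp ℂ 2 μ) (f : TensorPower μ m) :
    permute μ (Equiv.swap 0 1) (tensor μ h (tensor μ u f)) = tensor μ u (tensor μ h f) := by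
  refine Lp.ext ?_
  filter_upwards [coeFn_permute μ (Equiv.swap 0 1) (tensor μ h (tensor μ u f)),
    (measurePreserving_perm μ (Equiv.swap (0 : Fin (m + 2)) 1)).quasiMeasurePreserving.ae
      (coeFn_tensor μ h (tensor μ u f)),
    (measurePreserving_perm μ (Equiv.swap (0 : Fin (m + 2)) 1)).quasiMeasurePreserving.ae
      ((quasiMeasurePreserving_tail μ (m + 1)).ae (coeFn_tensor μ u f)),
    coeFn_tensor μ u (tensor μ h f),
    (quasiMeasurePreserving_tail μ (m + 1)).ae (coeFn_tensor μ h f)] with k h1 h2 h3 h4 h5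
  have hs : ∀ i : Fin m, Equiv.swap (0 : Fin (m + 2)) 1 i.succ.succ = i.succ.succ := fun i =>
    Equiv.swap_apply_of_ne_of_ne (Fin.succ_ne_zero _) (fun h => by
      rw [← Fin.succ_zero_eq_one, Fin.succ_inj] at h
      exact Fin.succ_ne_zero _ h)
  rw [h1, h2, h3, h4, h5]
  simp only [Function.comp_apply, Equiv.swap_apply_left, Fin.succ_zero_eq_one,
    Equiv.swap_apply_right, hs]
  ring

/-- Contraction of the first variable commutes with the insertion of a second one. -/
theorem inner_tensor_swap_tensor {m : ℕ} (h h' : Lp ℂ 2 μ) (f g : TensorPower μ (m + 1)) :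
    inner ℂ (tensor μ h f) (permute μ (Equiv.swap 0 1) (tensor μ h' g))
      = inner ℂ (contract μ m h' f) (contract μ m h g) := by
  -- Contracting the second variable leaves the factor `h` in the first one alone. The identity is
  -- tested on products, which separate vectors.
  have key : contract μ (m + 1) h' (permute μ (Equiv.swap 0 1) (tensor μ h f))
      = tensor μ h (contract μ m h' f) := by
    rw [← sub_eq_zero]
    refine eq_zero_of_inner_tensor μ fun u x => ?_
    rw [inner_sub_right, inner_contract_right, inner_tensor, inner_contract_right]
    have e : permute μ (Equiv.swap 0 1) (permute μ (Equiv.swap 0 1) (tensor μ h f))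
        = tensor μ h f := by rw [← permute_mul, Equiv.swap_mul_self, permute_one]
    rw [← inner_permute μ (Equiv.swap 0 1), e, swap_tensor_tensor, inner_tensor, sub_self]
  have e2 : inner ℂ (tensor μ h f) (permute μ (Equiv.swap 0 1) (tensor μ h' g))
      = inner ℂ (permute μ (Equiv.swap 0 1) (tensor μ h f)) (tensor μ h' g) := by
    rw [inner_permute_left, Equiv.swap_inv]
  rw [e2, ← inner_contract_left, key, inner_contract_right]

/-- One of the two symmetrisations can be dropped because the projection is self-adjoint and
idempotent. The normalisations √(m+1) and 1/√(m+1) then cancel. -/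
theorem inner_createSector_createSector {m : ℕ} (h : Lp ℂ 2 μ) (ψ χ : Sym μ m) :
    inner ℂ (createSector μ h m ψ) (createSector μ h m χ)
      = ∑ i, inner ℂ (tensor μ h (ψ : TensorPower μ m))
          (permute μ (Equiv.swap 0 i) (tensor μ h (χ : TensorPower μ m))) := by
  rw [inner_createSector, coe_createSector, inner_smul_right, inner_sum, ← mul_assoc,
    ← Complex.ofReal_mul, mul_inv_cancel₀ (Real.sqrt_pos.2 (by positivity)).ne', Complex.ofReal_one,
    one_mul]

theorem inner_createL_createL_zero (h : Lp ℂ 2 μ) (ψ χ : Sym μ 0) :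
    inner ℂ (createL μ 0 h ψ) (createL μ 0 h χ) = inner ℂ h h * inner ℂ ψ χ := by
  rw [createL_apply, createL_apply, inner_createSector_createSector]
  simp only [Nat.reduceAdd, Finset.univ_unique, Fin.default_eq_zero, Finset.sum_singleton,
    Equiv.swap_self]
  rw [← Equiv.Perm.one_def, permute_one, inner_tensor, Submodule.coe_inner]

/-- The canonical commutation relation `a(h) a*(h) = a*(h) a(h) + ‖h‖²`. -/
theorem inner_createL_createL {m : ℕ} (h : Lp ℂ 2 μ) (ψ χ : Sym μ (m + 1)) :
    inner ℂ (createL μ (m + 1) h ψ) (createL μ (m + 1) h χ)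
      = inner ℂ (annihL μ m h ψ) (annihL μ m h χ) + inner ℂ h h * inner ℂ ψ χ := by
  rw [createL_apply, createL_apply, inner_createSector_createSector, Fin.sum_univ_succ,
    Equiv.swap_self, ← Equiv.Perm.one_def, permute_one, inner_tensor]
  -- The unpermuted term has already produced the contribution of the norm of `h`. The other `m + 1`
  -- terms all agree: `swap 0 i.succ` is conjugate to `swap 0 1` by a permutation fixing `0`. Their
  -- number supplies the two factors √(m+1) in the annihilation operators.
  have e : ∀ i : Fin (m + 1),
      inner ℂ (tensor μ h ψ) (permute μ (Equiv.swap 0 i.succ) (tensor μ h χ))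
        = inner ℂ (contract μ m h ψ) (contract μ m h χ) := by
    intro i
    set ρ : Equiv.Perm (Fin (m + 2)) := Equiv.swap 1 i.succ with hρ
    have h0 : ρ 0 = 0 :=
      Equiv.swap_apply_of_ne_of_ne (by simp) (Fin.succ_ne_zero _).symm
    have h0' : ρ⁻¹ 0 = 0 := by rw [hρ, Equiv.swap_inv]; exact h0
    have h1 : Equiv.swap 0 i.succ = ρ * Equiv.swap 0 1 * ρ⁻¹ := by
      rw [← Equiv.swap_apply_apply, h0, hρ, Equiv.swap_apply_left]
    rw [h1, permute_mul, permute_mul, permute_tensor_of_fix μ h0', ← inner_tensor_swap_tensor,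
      ← inner_permute μ ρ (tensor μ h ψ) (permute μ (Equiv.swap 0 1) _),
      permute_tensor_of_fix μ h0]
  simp only [e, Finset.sum_const, Finset.card_univ, Fintype.card_fin, nsmul_eq_mul]
  rw [annihL_eq, annihL_eq, inner_smul_left, inner_smul_right, Complex.conj_ofReal, ← mul_assoc,
    ← Complex.ofReal_mul, Real.mul_self_sqrt (by positivity), Submodule.coe_inner,
    Submodule.coe_inner, add_comm]
  push_cast
  rfl

theorem annihL_createL {m : ℕ} (h : Lp ℂ 2 μ) (χ : Sym μ (m + 1)) :
    annihL μ (m + 1) h (createL μ (m + 1) h χ)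
      = createL μ m h (annihL μ m h χ) + inner ℂ h h • χ :=
  ext_inner_left ℂ fun v => by
    rw [inner_annihL_right, inner_createL_createL, inner_add_right, inner_smul_right,
      inner_annihL_left]

theorem annihL_createL_zero (h : Lp ℂ 2 μ) (χ : Sym μ 0) :
    annihL μ 0 h (createL μ 0 h χ) = inner ℂ h h • χ :=
  ext_inner_left ℂ fun v => by
    rw [inner_annihL_right, inner_createL_createL_zero, inner_smul_right]

end Sector

/-! ### Relative bounds for creation and annihilation operators -/

section Bounds

variable {X : Type*} [MeasurableSpace X] (μ : Measure X) [SigmaFinite μ]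

theorem norm_sq_eq_integral {α E : Type*} [MeasurableSpace α] {ν : Measure α} [NormedAddCommGroup E]
    [InnerProductSpace ℂ E] (f : Lp E 2 ν) :
    ‖f‖ ^ 2 = ∫ x, ‖f x‖ ^ 2 ∂ν := by
  have h : (inner ℂ f f : ℂ) = ((∫ x, ‖f x‖ ^ 2 ∂ν : ℝ) : ℂ) := by
    rw [L2.inner_def]
    refine Eq.trans ?_ (integral_ofReal (𝕜 := ℂ) (f := fun x => ‖f x‖ ^ 2) (μ := ν))
    refine integral_congr_ae (Eventually.of_forall fun x => ?_)
    simp [inner_self_eq_norm_sq_to_K]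
  rw [inner_self_eq_norm_sq_to_K] at h
  refine Complex.ofReal_injective ?_
  simpa using h

theorem integrable_norm_sq {α E : Type*} [MeasurableSpace α] {ν : Measure α} [NormedAddCommGroup E]
    [InnerProductSpace ℂ E] (f : Lp E 2 ν) :
    Integrable (fun x => ‖f x‖ ^ 2) ν :=
  (memLp_two_iff_integrable_sq_norm (Lp.memLp f).1).1 (Lp.memLp f)

/-- Permutations act isometrically, so the left side is the integral of the sum of the permuted
densities of `f`. This trades a combinatorial factor for a sum over the variables. -/
theorem card_mul_norm_sq_le {M : ℕ} {ι : Type*} [Fintype ι] (σ : ι → Equiv.Perm (Fin M))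
    (f χ : TensorPower μ M)
    (h : ∀ᵐ k ∂(Measure.pi fun _ : Fin M => μ), ∑ i, ‖f (k ∘ σ i)‖ ^ 2 ≤ ‖χ k‖ ^ 2) :
    (Fintype.card ι : ℝ) * ‖f‖ ^ 2 ≤ ‖χ‖ ^ 2 := by
  have e : (Fintype.card ι : ℝ) * ‖f‖ ^ 2 = ∑ i, ‖permute μ (σ i) f‖ ^ 2 := by
    simp
  rw [e]
  simp only [norm_sq_eq_integral]
  rw [← integral_finsetSum _ fun i _ => integrable_norm_sq _]
  refine integral_mono_ae (integrable_finsetSum _ fun i _ => integrable_norm_sq _)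
    (integrable_norm_sq _) ?_
  have h' : ∀ᵐ k ∂(Measure.pi fun _ : Fin M => μ), ∀ i, permute μ (σ i) f k = f (k ∘ σ i) :=
    ae_all_iff.2 fun i => coeFn_permute μ (σ i) f
  filter_upwards [h, h'] with k h1 h2
  simpa only [h2] using h1

/-- The function `w(k₁) + ⋯ + w(k_m)`. -/
def weight (w : X → ℝ≥0) (m : ℕ) (k : Fin m → X) : ℝ := ∑ i, (w (k i) : ℝ)

omit [MeasurableSpace X] in
theorem weight_nonneg (w : X → ℝ≥0) (m : ℕ) (k : Fin m → X) : 0 ≤ weight w m k :=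
  Finset.sum_nonneg fun _ _ => NNReal.coe_nonneg _

theorem measurable_weight {w : X → ℝ≥0} (hw : Measurable w) (m : ℕ) : Measurable (weight w m) :=
  Finset.measurable_fun_sum _ fun i _ => (hw.comp (measurable_pi_apply i)).coe_nnreal_real

omit [MeasurableSpace X] in
theorem weight_perm (w : X → ℝ≥0) {m : ℕ} (σ : Equiv.Perm (Fin m)) (k : Fin m → X) :
    weight w m (k ∘ σ) = weight w m k :=
  Equiv.sum_comp σ fun i => (w (k i) : ℝ)

omit [MeasurableSpace X] in
theorem le_weight (w : X → ℝ≥0) {m : ℕ} (k : Fin m → X) (i : Fin m) : (w (k i) : ℝ) ≤ weight w m k :=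
  Finset.single_le_sum (f := fun i => (w (k i) : ℝ)) (fun _ _ => NNReal.coe_nonneg _)
    (Finset.mem_univ i)

/-- `χ` is the product of the function `g` with `ψ`. -/
def IsMul {m : ℕ} (g : (Fin m → X) → ℝ) (ψ χ : Sym μ m) : Prop :=
  ((χ : TensorPower μ m) : (Fin m → X) → ℂ) =ᵐ[Measure.pi fun _ : Fin m => μ]
    fun k => (g k : ℂ) * ((ψ : TensorPower μ m) : (Fin m → X) → ℂ) k

variable {μ}

theorem norm_le_of_inner_le {E : Type*} [NormedAddCommGroup E] [InnerProductSpace ℂ E] {x : E}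
    {C : ℝ} (hC : 0 ≤ C) (h : ∀ g : E, ‖(inner ℂ g x : ℂ)‖ ≤ ‖g‖ * C) : ‖x‖ ≤ C := by
  have h1 := h x
  rw [inner_self_eq_norm_sq_to_K] at h1
  rcases (norm_nonneg x).eq_or_lt with h0 | h0
  · rw [← h0]; exact hC
  · have h2 : ‖x‖ * ‖x‖ ≤ ‖x‖ * C := by
      simpa [pow_two] using h1
    exact le_of_mul_le_mul_left h2 h0

theorem sym_ae {m : ℕ} (ψ : Sym μ m) (σ : Equiv.Perm (Fin m)) :
    ∀ᵐ k ∂(Measure.pi fun _ : Fin m => μ),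
      (ψ : TensorPower μ m) (k ∘ σ) = (ψ : TensorPower μ m) k := by
  filter_upwards [coeFn_permute μ σ (ψ : TensorPower μ m)] with k hk
  rw [← hk, ψ.2 σ]

/-- Moving √w from `h` to `ψ` bounds the annihilated vector by √(m+1) ‖h'‖ ‖√w(k₀) ψ‖. By symmetry
(m+1) ‖√w(k₀) ψ‖² is the sum over all variables, that is ‖χ‖², so the estimate is independent of the
particle number. -/
theorem norm_annihL_le {w : X → ℝ≥0} (hw : Measurable w) {h h' : Lp ℂ 2 μ}
    (hh : h =ᵐ[μ] fun x => (Real.sqrt (w x) : ℂ) * h' x) {m : ℕ} {ψ χ : Sym μ (m + 1)}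
    (hχ : IsMul μ (fun k => Real.sqrt (weight w (m + 1) k)) ψ χ) :
    ‖annihL μ m h ψ‖ ≤ ‖h'‖ * ‖χ‖ := by
  have hmeas : Measurable fun k : Fin (m + 1) → X => (Real.sqrt (w (k 0)) : ℂ) := by fun_prop
  have hmem : MemLp (fun k : Fin (m + 1) → X => (Real.sqrt (w (k 0)) : ℂ)
      * (ψ : TensorPower μ (m + 1)) k) 2 (Measure.pi fun _ : Fin (m + 1) => μ) := by
    refine (Lp.memLp (χ : TensorPower μ (m + 1))).mono
      (hmeas.aestronglyMeasurable.mul (Lp.memLp _).1) ?_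
    filter_upwards [hχ] with k hk
    rw [hk, norm_mul, norm_mul, Complex.norm_real, Complex.norm_real,
      Real.norm_of_nonneg (Real.sqrt_nonneg _), Real.norm_of_nonneg (Real.sqrt_nonneg _)]
    exact mul_le_mul_of_nonneg_right (Real.sqrt_le_sqrt (le_weight w k 0)) (norm_nonneg _)
  set θ : TensorPower μ (m + 1) := hmem.toLp _ with hθ
  have hθe := hmem.coeFn_toLp
  have hcard := card_mul_norm_sq_le μ (fun i : Fin (m + 1) => Equiv.swap 0 i) θ
    (χ : TensorPower μ (m + 1)) (by
      have h1 : ∀ᵐ k ∂(Measure.pi fun _ : Fin (m + 1) => μ), ∀ i : Fin (m + 1),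
          θ (k ∘ Equiv.swap 0 i) = (Real.sqrt (w ((k ∘ Equiv.swap 0 i) 0)) : ℂ)
            * (ψ : TensorPower μ (m + 1)) (k ∘ Equiv.swap 0 i) :=
        ae_all_iff.2 fun i =>
          (measurePreserving_perm μ (Equiv.swap 0 i)).quasiMeasurePreserving.ae hθe
      have h2 := ae_all_iff.2 fun i : Fin (m + 1) => sym_ae ψ (Equiv.swap 0 i)
      filter_upwards [h1, h2, hχ] with k h1 h2 h3
      simp only [h1, h2, h3, norm_mul, Complex.norm_real, mul_pow, Real.norm_eq_abs, sq_abs,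
        Function.comp_apply, Equiv.swap_apply_left]
      rw [← Finset.sum_mul, Real.sq_sqrt (weight_nonneg w _ k)]
      refine mul_le_mul_of_nonneg_right (le_of_eq ?_) (by positivity)
      exact Finset.sum_congr rfl fun i _ => Real.sq_sqrt (NNReal.coe_nonneg _))
  rw [Fintype.card_fin] at hcard
  have hcard' : Real.sqrt (m + 1) * ‖θ‖ ≤ ‖χ‖ := by
    refine abs_le_of_sq_le_sq' ?_ (norm_nonneg _) |>.2
    rw [mul_pow, Real.sq_sqrt (by positivity)]
    exact_mod_cast hcard
  refine norm_le_of_inner_le (by positivity) fun g => ?_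
  have e : inner ℂ (tensor μ h (g : TensorPower μ m)) (ψ : TensorPower μ (m + 1))
      = inner ℂ (tensor μ h' (g : TensorPower μ m)) θ := by
    rw [L2.inner_def, L2.inner_def]
    refine integral_congr_ae ?_
    filter_upwards [coeFn_tensor μ h (g : TensorPower μ m), coeFn_tensor μ h' (g : TensorPower μ m),
      hθe, (quasiMeasurePreserving_head μ m).ae hh] with k h1 h2 h3 h4
    rw [h1, h2, hθ, h3, h4]
    simp only [RCLike.inner_apply, map_mul, Complex.conj_ofReal]
    ring
  rw [inner_annihL_right, createL_apply, inner_createSector, e, norm_mul, Complex.norm_real,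
    Real.norm_of_nonneg (Real.sqrt_nonneg _)]
  calc Real.sqrt (m + 1) * ‖inner ℂ (tensor μ h' (g : TensorPower μ m)) θ‖
      ≤ Real.sqrt (m + 1) * (‖h'‖ * ‖g‖ * ‖θ‖) := by
        refine mul_le_mul_of_nonneg_left ?_ (Real.sqrt_nonneg _)
        exact (norm_inner_le_norm _ _).trans (by rw [norm_tensor]; rfl)
    _ = ‖g‖ * (‖h'‖ * (Real.sqrt (m + 1) * ‖θ‖)) := by ring
    _ ≤ ‖g‖ * (‖h'‖ * ‖χ‖) := by gcongr

/-- The argument for one annihilation operator, with pairs of variables: the two square root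
prefactors square to (m+2)(m+1), the number of ordered pairs of distinct variables, and ∑_{i≠j}
w(k_i) w(k_j) ≤ (∑_i w(k_i))². -/
theorem norm_annihL_annihL_le {w : X → ℝ≥0} (hw : Measurable w) {h h' : Lp ℂ 2 μ}
    (hh : h =ᵐ[μ] fun x => (Real.sqrt (w x) : ℂ) * h' x) {m : ℕ} {ψ χ : Sym μ (m + 2)}
    (hχ : IsMul μ (weight w (m + 2)) ψ χ) :
    ‖annihL μ m h (annihL μ (m + 1) h ψ)‖ ≤ ‖h'‖ ^ 2 * ‖χ‖ := by
  have hmeas : Measurable fun k : Fin (m + 2) → X =>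
      (Real.sqrt (w (k 0)) * Real.sqrt (w (k 1)) : ℂ) := by fun_prop
  have hmem : MemLp (fun k : Fin (m + 2) → X => (Real.sqrt (w (k 0)) * Real.sqrt (w (k 1)) : ℂ)
      * (ψ : TensorPower μ (m + 2)) k) 2 (Measure.pi fun _ : Fin (m + 2) => μ) := by
    refine (Lp.memLp (χ : TensorPower μ (m + 2))).mono
      (hmeas.aestronglyMeasurable.mul (Lp.memLp _).1) ?_
    filter_upwards [hχ] with k hk
    rw [hk, norm_mul, norm_mul, norm_mul, Complex.norm_real, Complex.norm_real, Complex.norm_real,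
      Real.norm_of_nonneg (Real.sqrt_nonneg _), Real.norm_of_nonneg (Real.sqrt_nonneg _),
      Real.norm_of_nonneg (weight_nonneg w _ k)]
    refine mul_le_mul_of_nonneg_right ?_ (norm_nonneg _)
    calc Real.sqrt (w (k 0)) * Real.sqrt (w (k 1))
        ≤ Real.sqrt (weight w (m + 2) k) * Real.sqrt (weight w (m + 2) k) :=
          mul_le_mul (Real.sqrt_le_sqrt (le_weight w k 0)) (Real.sqrt_le_sqrt (le_weight w k 1))
            (Real.sqrt_nonneg _) (Real.sqrt_nonneg _)
      _ = weight w (m + 2) k := Real.mul_self_sqrt (weight_nonneg w _ k)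
  set θ : TensorPower μ (m + 2) := hmem.toLp _ with hθ
  have hθe := hmem.coeFn_toLp
  -- The images of `0` and `1` under `σ p` run through all ordered pairs of distinct indices: first
  -- `p.1`, then `swap 0 p.1` of a nonzero index, which differs from `p.1`.
  set σ : Fin (m + 2) × Fin (m + 1) → Equiv.Perm (Fin (m + 2)) :=
    fun p => Equiv.swap 0 p.1 * Equiv.swap 1 p.2.succ with hσ
  have hσ0 : ∀ p, σ p 0 = p.1 := fun p => by
    rw [hσ, Equiv.Perm.mul_apply, Equiv.swap_apply_of_ne_of_ne (by simp) (Fin.succ_ne_zero _).symm,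
      Equiv.swap_apply_left]
  have hσ1 : ∀ p, σ p 1 = Equiv.swap 0 p.1 p.2.succ := fun p => by
    rw [hσ, Equiv.Perm.mul_apply, Equiv.swap_apply_left]
  have hcard := card_mul_norm_sq_le μ σ θ (χ : TensorPower μ (m + 2)) (by
      have h1 : ∀ᵐ k ∂(Measure.pi fun _ : Fin (m + 2) => μ), ∀ p,
          θ (k ∘ σ p) = (Real.sqrt (w ((k ∘ σ p) 0)) * Real.sqrt (w ((k ∘ σ p) 1)) : ℂ)
            * (ψ : TensorPower μ (m + 2)) (k ∘ σ p) :=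
        ae_all_iff.2 fun p => (measurePreserving_perm μ (σ p)).quasiMeasurePreserving.ae hθe
      have h2 := ae_all_iff.2 fun p => sym_ae ψ (σ p)
      filter_upwards [h1, h2, hχ] with k h1 h2 h3
      simp only [h1, h2, h3, norm_mul, Complex.norm_real, mul_pow, Real.norm_eq_abs, sq_abs,
        Function.comp_apply, hσ0, hσ1]
      rw [← Finset.sum_mul]
      refine mul_le_mul_of_nonneg_right ?_ (by positivity)
      simp only [Real.sq_sqrt (NNReal.coe_nonneg _)]
      rw [Fintype.sum_prod_type, pow_two]
      have e : ∀ i : Fin (m + 2), ∑ j : Fin (m + 1), (w (k i) : ℝ) * w (k (Equiv.swap 0 i j.succ))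
          ≤ w (k i) * weight w (m + 2) k := by
        intro i
        rw [← Finset.mul_sum]
        refine mul_le_mul_of_nonneg_left ?_ (NNReal.coe_nonneg _)
        rw [← weight_perm w (Equiv.swap 0 i) k, weight,
          Fin.sum_univ_succ fun l => (w ((k ∘ Equiv.swap 0 i) l) : ℝ)]
        exact le_add_of_nonneg_left (NNReal.coe_nonneg _)
      refine (Finset.sum_le_sum fun i _ => e i).trans (le_of_eq ?_)
      rw [← Finset.sum_mul]
      rfl)
  rw [Fintype.card_prod, Fintype.card_fin, Fintype.card_fin] at hcard
  have hcard' : Real.sqrt (m + 1) * (Real.sqrt ((m + 1 : ℕ) + 1) * ‖θ‖) ≤ ‖χ‖ := by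
    refine abs_le_of_sq_le_sq' ?_ (norm_nonneg _) |>.2
    rw [mul_pow, mul_pow, Real.sq_sqrt (by positivity), Real.sq_sqrt (by positivity)]
    calc ((m : ℝ) + 1) * ((((m + 1 : ℕ) : ℝ) + 1) * ‖θ‖ ^ 2)
        = (((m + 2) * (m + 1) : ℕ) : ℝ) * ‖θ‖ ^ 2 := by push_cast; ring
      _ ≤ ‖χ‖ ^ 2 := hcard
  refine norm_le_of_inner_le (by positivity) fun g => ?_
  have e : inner ℂ (tensor μ h (tensor μ h (g : TensorPower μ m))) (ψ : TensorPower μ (m + 2))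
      = inner ℂ (tensor μ h' (tensor μ h' (g : TensorPower μ m))) θ := by
    rw [L2.inner_def, L2.inner_def]
    refine integral_congr_ae ?_
    filter_upwards [coeFn_tensor μ h (tensor μ h (g : TensorPower μ m)),
      (quasiMeasurePreserving_tail μ (m + 1)).ae (coeFn_tensor μ h (g : TensorPower μ m)),
      coeFn_tensor μ h' (tensor μ h' (g : TensorPower μ m)),
      (quasiMeasurePreserving_tail μ (m + 1)).ae (coeFn_tensor μ h' (g : TensorPower μ m)),
      hθe, (quasiMeasurePreserving_head μ (m + 1)).ae hh,
      (quasiMeasurePreserving_tail μ (m + 1)).ae ((quasiMeasurePreserving_head μ m).ae hh)]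
      with k h1 h2 h3 h4 h5 h6 h7
    rw [h1, h2, h3, h4, hθ, h5, h6, h7]
    simp only [RCLike.inner_apply, map_mul, Complex.conj_ofReal, Fin.succ_zero_eq_one]
    ring
  rw [inner_annihL_right, createL_apply, inner_createSector, annihL_eq, Submodule.coe_smul,
    inner_smul_right, inner_contract_right, e, norm_mul, norm_mul, Complex.norm_real,
    Complex.norm_real, Real.norm_of_nonneg (Real.sqrt_nonneg _),
    Real.norm_of_nonneg (Real.sqrt_nonneg _)]
  calc Real.sqrt (m + 1) * (Real.sqrt ((m + 1 : ℕ) + 1)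
        * ‖inner ℂ (tensor μ h' (tensor μ h' (g : TensorPower μ m))) θ‖)
      ≤ Real.sqrt (m + 1) * (Real.sqrt ((m + 1 : ℕ) + 1) * (‖h'‖ * (‖h'‖ * ‖g‖) * ‖θ‖)) := by
        gcongr
        exact (norm_inner_le_norm _ _).trans (by rw [norm_tensor, norm_tensor]; rfl)
    _ = ‖g‖ * (‖h'‖ ^ 2 * (Real.sqrt (m + 1) * (Real.sqrt ((m + 1 : ℕ) + 1) * ‖θ‖))) := by ring
    _ ≤ ‖g‖ * (‖h'‖ ^ 2 * ‖χ‖) := by gcongr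

theorem norm_createL_sq_zero (h : Lp ℂ 2 μ) (ψ : Sym μ 0) :
    ‖createL μ 0 h ψ‖ ^ 2 = ‖h‖ ^ 2 * ‖ψ‖ ^ 2 := by
  have e := inner_createL_createL_zero μ h ψ ψ
  rw [inner_self_eq_norm_sq_to_K, inner_self_eq_norm_sq_to_K, inner_self_eq_norm_sq_to_K] at e
  exact_mod_cast e

theorem norm_createL_sq_succ {m : ℕ} (h : Lp ℂ 2 μ) (ψ : Sym μ (m + 1)) :
    ‖createL μ (m + 1) h ψ‖ ^ 2 = ‖annihL μ m h ψ‖ ^ 2 + ‖h‖ ^ 2 * ‖ψ‖ ^ 2 := by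
  have e := inner_createL_createL μ h ψ ψ
  rw [inner_self_eq_norm_sq_to_K, inner_self_eq_norm_sq_to_K, inner_self_eq_norm_sq_to_K,
    inner_self_eq_norm_sq_to_K] at e
  exact_mod_cast e

theorem norm_add_sq_le_two {E : Type*} [NormedAddCommGroup E] (x y : E) :
    ‖x + y‖ ^ 2 ≤ 2 * ‖x‖ ^ 2 + 2 * ‖y‖ ^ 2 := by
  nlinarith [norm_add_le x y, norm_nonneg (x + y), sq_nonneg (‖x‖ - ‖y‖), norm_nonneg x,
    norm_nonneg y]

/-- `h` and `h / √w` are bounded by `C` in norm. -/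
structure WeightBound (w : X → ℝ≥0) (h : Lp ℂ 2 μ) (C : ℝ) : Prop where
  nonneg : 0 ≤ C
  norm_le : ‖h‖ ≤ C
  exists_div : ∃ h' : Lp ℂ 2 μ, ‖h'‖ ≤ C ∧ h =ᵐ[μ] fun x => (Real.sqrt (w x) : ℂ) * h' x

section

variable {w : X → ℝ≥0} {h : Lp ℂ 2 μ} {C : ℝ}

theorem WeightBound.annihL (hw : Measurable w) (H : WeightBound w h C) {m : ℕ}
    {ψ χ : Sym μ (m + 1)} (hχ : IsMul μ (fun k => Real.sqrt (weight w (m + 1) k)) ψ χ) :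
    ‖annihL μ m h ψ‖ ^ 2 ≤ C ^ 2 * ‖χ‖ ^ 2 := by
  obtain ⟨h', hC, hh⟩ := H.exists_div
  rw [← mul_pow]
  have := H.nonneg
  exact pow_le_pow_left₀ (norm_nonneg _)
    ((norm_annihL_le hw hh hχ).trans (mul_le_mul_of_nonneg_right hC (norm_nonneg _))) 2

/-- The commutation relation gives ‖a*(h)ψ‖² = ‖a(h)ψ‖² + ‖h‖²‖ψ‖². The vacuum sector is separate
since there is nothing to annihilate. -/
theorem WeightBound.createL (hw : Measurable w) (H : WeightBound w h C) {m : ℕ}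
    {ψ χ : Sym μ m} (hχ : IsMul μ (fun k => Real.sqrt (weight w m k)) ψ χ) :
    ‖createL μ m h ψ‖ ^ 2 ≤ C ^ 2 * (‖χ‖ ^ 2 + ‖ψ‖ ^ 2) := by
  have h1 : ‖h‖ ^ 2 * ‖ψ‖ ^ 2 ≤ C ^ 2 * ‖ψ‖ ^ 2 := by
    gcongr; exact H.norm_le
  rw [mul_add]
  cases m with
  | zero =>
    rw [norm_createL_sq_zero]
    have : 0 ≤ C ^ 2 * ‖χ‖ ^ 2 := by positivity
    linarith
  | succ m =>
    rw [norm_createL_sq_succ]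
    exact add_le_add (H.annihL hw hχ) h1

theorem WeightBound.annihL_annihL (hw : Measurable w) (H : WeightBound w h C) {m : ℕ}
    {ψ χ : Sym μ (m + 2)} (hχ : IsMul μ (weight w (m + 2)) ψ χ) :
    ‖PauliFierz.annihL μ m h (PauliFierz.annihL μ (m + 1) h ψ)‖ ^ 2 ≤ C ^ 4 * ‖χ‖ ^ 2 := by
  obtain ⟨h', hC, hh⟩ := H.exists_div
  have e : C ^ 4 * ‖χ‖ ^ 2 = (C ^ 2 * ‖χ‖) ^ 2 := by ring
  rw [e]
  have := H.nonneg
  exact pow_le_pow_left₀ (norm_nonneg _)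
    ((norm_annihL_annihL_le hw hh hχ).trans (by gcongr)) 2

/-- The commutation relation, applied to the vector a(h)ψ, reduces the norm to those of a(h)a(h)ψ
and a(h)ψ. -/
theorem WeightBound.createL_annihL (hw : Measurable w) (H : WeightBound w h C) {m : ℕ}
    {ψ χ₁ χ₂ : Sym μ (m + 1)} (hχ₁ : IsMul μ (fun k => Real.sqrt (weight w (m + 1) k)) ψ χ₁)
    (hχ₂ : IsMul μ (weight w (m + 1)) ψ χ₂) :
    ‖PauliFierz.createL μ m h (PauliFierz.annihL μ m h ψ)‖ ^ 2
      ≤ C ^ 4 * (‖χ₁‖ ^ 2 + ‖χ₂‖ ^ 2) := by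
  have h1 : ‖h‖ ^ 2 * ‖PauliFierz.annihL μ m h ψ‖ ^ 2 ≤ C ^ 4 * ‖χ₁‖ ^ 2 := by
    calc ‖h‖ ^ 2 * ‖PauliFierz.annihL μ m h ψ‖ ^ 2 ≤ C ^ 2 * (C ^ 2 * ‖χ₁‖ ^ 2) := by
          gcongr
          · exact H.norm_le
          · exact H.annihL hw hχ₁
      _ = _ := by ring
  cases m with
  | zero =>
    rw [norm_createL_sq_zero]
    have : 0 ≤ C ^ 4 * ‖χ₂‖ ^ 2 := by positivity
    linarith
  | succ m =>
    rw [norm_createL_sq_succ]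
    have := H.annihL_annihL hw hχ₂
    linarith

/-- Normal ordering: a(h)a*(h) = a*(h)a(h) + ‖h‖². The factors 2 come from squaring the triangle
inequality. -/
theorem WeightBound.annihL_createL (hw : Measurable w) (H : WeightBound w h C) {m : ℕ}
    {ψ χ₁ χ₂ : Sym μ m} (hχ₁ : IsMul μ (fun k => Real.sqrt (weight w m k)) ψ χ₁)
    (hχ₂ : IsMul μ (weight w m) ψ χ₂) :
    ‖PauliFierz.annihL μ m h (PauliFierz.createL μ m h ψ)‖ ^ 2
      ≤ C ^ 4 * (2 * ‖χ₁‖ ^ 2 + 2 * ‖χ₂‖ ^ 2 + 2 * ‖ψ‖ ^ 2) := by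
  have h1 : ‖(inner ℂ h h : ℂ) • ψ‖ ^ 2 ≤ C ^ 4 * ‖ψ‖ ^ 2 := by
    have e : ‖(inner ℂ h h : ℂ)‖ = ‖h‖ ^ 2 := by
      rw [inner_self_eq_norm_sq_to_K]; simp
    rw [norm_smul, e, mul_pow, ← pow_mul]
    have := H.norm_le
    gcongr
  cases m with
  | zero =>
    rw [annihL_createL_zero]
    have : 0 ≤ C ^ 4 * (2 * ‖χ₁‖ ^ 2 + 2 * ‖χ₂‖ ^ 2 + ‖ψ‖ ^ 2) := by positivity
    linarith
  | succ m =>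
    rw [PauliFierz.annihL_createL]
    refine (norm_add_sq_le_two _ _).trans ?_
    have := H.createL_annihL hw hχ₁ hχ₂
    linarith

/-- By the commutation relation the norm reduces to those of a(h)a*(h)ψ and a*(h)ψ; the coefficients
3 are 2 from the former plus 1 from the latter. -/
theorem WeightBound.createL_createL (hw : Measurable w) (H : WeightBound w h C) {m : ℕ}
    {ψ χ₁ χ₂ : Sym μ m} (hχ₁ : IsMul μ (fun k => Real.sqrt (weight w m k)) ψ χ₁)
    (hχ₂ : IsMul μ (weight w m) ψ χ₂) :
    ‖PauliFierz.createL μ (m + 1) h (PauliFierz.createL μ m h ψ)‖ ^ 2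
      ≤ C ^ 4 * (3 * ‖χ₁‖ ^ 2 + 2 * ‖χ₂‖ ^ 2 + 3 * ‖ψ‖ ^ 2) := by
  rw [norm_createL_sq_succ]
  have h1 := H.annihL_createL hw hχ₁ hχ₂
  have h2 : ‖h‖ ^ 2 * ‖PauliFierz.createL μ m h ψ‖ ^ 2 ≤ C ^ 2 * (C ^ 2 * (‖χ₁‖ ^ 2 + ‖ψ‖ ^ 2)) := by
    gcongr
    · exact H.norm_le
    · exact H.createL hw hχ₁
  nlinarith

/-- The second order bounds in terms of `ψ` and `S ψ` only. -/
theorem norm_sq_le_of_isMul_sqrt {m : ℕ} {ψ χ₁ χ₂ : Sym μ m}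
    (hχ₁ : IsMul μ (fun k => Real.sqrt (weight w m k)) ψ χ₁) (hχ₂ : IsMul μ (weight w m) ψ χ₂) :
    ‖χ₁‖ ^ 2 ≤ ‖χ₂‖ ^ 2 + ‖ψ‖ ^ 2 := by
  have e1 : ‖χ₁‖ ^ 2 = ‖(χ₁ : TensorPower μ m)‖ ^ 2 := rfl
  have e2 : ‖χ₂‖ ^ 2 = ‖(χ₂ : TensorPower μ m)‖ ^ 2 := rfl
  have e3 : ‖ψ‖ ^ 2 = ‖(ψ : TensorPower μ m)‖ ^ 2 := rfl
  rw [e1, e2, e3, norm_sq_eq_integral, norm_sq_eq_integral, norm_sq_eq_integral,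
    ← integral_add (integrable_norm_sq _) (integrable_norm_sq _)]
  refine integral_mono_ae (integrable_norm_sq _)
    ((integrable_norm_sq _).add (integrable_norm_sq _)) ?_
  filter_upwards [hχ₁, hχ₂] with k h1 h2
  have h0 := weight_nonneg w m k
  simp only [h1, h2, norm_mul, Complex.norm_real, mul_pow, Real.norm_eq_abs, sq_abs,
    Real.sq_sqrt h0]
  have : 0 ≤ ‖(ψ : TensorPower μ m) k‖ ^ 2 := by positivity
  -- Pointwise this is s ≤ s² + 1 for the weight s.
  nlinarith [sq_nonneg (weight w m k - 1)]

theorem isMul_sqrt_exists (hw : Measurable w) {m : ℕ} {ψ χ₂ : Sym μ m}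
    (hχ₂ : IsMul μ (weight w m) ψ χ₂) :
    ∃ χ₁, IsMul μ (fun k => Real.sqrt (weight w m k)) ψ χ₁ := by
  have hmem : MemLp (fun k : Fin m → X => (Real.sqrt (weight w m k) : ℂ)
      * (ψ : TensorPower μ m) k) 2 (Measure.pi fun _ : Fin m => μ) := by
    have hm := measurable_weight hw m
    have hmeas : Measurable fun k : Fin m → X => (Real.sqrt (weight w m k) : ℂ) := by fun_prop
    refine ((Lp.memLp (χ₂ : TensorPower μ m)).norm.add (Lp.memLp (ψ : TensorPower μ m)).norm).mono
      (hmeas.aestronglyMeasurable.mul (Lp.memLp _).1) ?_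
    filter_upwards [hχ₂] with k hk
    have h0 := weight_nonneg w m k
    rw [Pi.add_apply, hk, Real.norm_of_nonneg (by positivity), norm_mul, norm_mul,
      Complex.norm_real, Complex.norm_real, Real.norm_of_nonneg (Real.sqrt_nonneg _),
      Real.norm_of_nonneg h0]
    have h1 : Real.sqrt (weight w m k) ≤ weight w m k + 1 := by
      rw [Real.sqrt_le_left (by positivity)]
      nlinarith
    nlinarith [norm_nonneg ((ψ : TensorPower μ m) k)]
  refine ⟨⟨hmem.toLp _, fun σ => Lp.ext ?_⟩, hmem.coeFn_toLp⟩
  filter_upwards [coeFn_permute μ σ (hmem.toLp _),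
    (measurePreserving_perm μ σ).quasiMeasurePreserving.ae hmem.coeFn_toLp, hmem.coeFn_toLp,
    sym_ae ψ σ] with k h1 h2 h3 h4
  rw [h1, h2, h3, weight_perm, h4]

end

end Bounds

/-! ### Operators in Fock space -/

section FockOps

variable {X : Type*} [MeasurableSpace X] (μ : Measure X) [SigmaFinite μ]

instance instNormedAddCommGroupFock : NormedAddCommGroup (Fock μ) := lp.normedAddCommGroup

instance instInnerProductSpaceFock : InnerProductSpace ℂ (Fock μ) := lp.instInnerProductSpace

instance instNormedSpaceFock : NormedSpace ℂ (Fock μ) := InnerProductSpace.toNormedSpace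

instance instSeminormedAddCommGroupFock : SeminormedAddCommGroup (Fock μ) :=
  (instNormedAddCommGroupFock μ).toSeminormedAddCommGroup

instance instModuleFock : Module ℂ (Fock μ) := (instNormedSpaceFock μ).toModule

instance instCompleteSpaceFock : CompleteSpace (Fock μ) := lp.completeSpace

variable {μ}

theorem hasSum_norm_sq (u : Fock μ) : HasSum (fun m => ‖u m‖ ^ 2) (‖u‖ ^ 2) := by
  have := lp.hasSum_norm (p := 2) (by norm_num) u
  simpa using this

/-- Sums sectorwise estimates in which sector `m` of `v` is controlled by the energy of sector `f
m`; injectivity uses each energy at most once. It is required only where `v m ≠ 0`, since the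
truncated shifts `m - 1` and `m - 2` identify the lowest sectors. -/
theorem norm_sq_le_of_shift {v : Fock μ} {E : ℕ → ℝ} {T : ℝ} (hE : HasSum E T) (h0 : ∀ m, 0 ≤ E m)
    (f : ℕ → ℕ) (hf : Set.InjOn f {m | v m ≠ 0}) (h : ∀ m, v m ≠ 0 → ‖v m‖ ^ 2 ≤ E (f m)) :
    ‖v‖ ^ 2 ≤ T := by
  classical
  rw [← (hasSum_norm_sq v).tsum_eq]
  refine (hasSum_norm_sq v).summable.tsum_le_of_sum_le fun s => ?_
  have h1 : ∑ m ∈ s, ‖v m‖ ^ 2 = ∑ m ∈ s with v m ≠ 0, ‖v m‖ ^ 2 := by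
    rw [Finset.sum_filter]
    refine Finset.sum_congr rfl fun m _ => ?_
    by_cases hm : v m = 0 <;> simp [hm]
  rw [h1]
  calc ∑ m ∈ s with v m ≠ 0, ‖v m‖ ^ 2 ≤ ∑ m ∈ s with v m ≠ 0, E (f m) :=
        Finset.sum_le_sum fun m hm => h m (Finset.mem_filter.1 hm).2
    _ = ∑ l ∈ (s.filter fun m => v m ≠ 0).image f, E l := by
        rw [Finset.sum_image]
        exact fun x hx y hy hxy => hf (Finset.mem_filter.1 hx).2 (Finset.mem_filter.1 hy).2 hxy
    _ ≤ T := sum_le_hasSum _ (fun i _ => h0 i) hE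

theorem single_mem_fockFin (m : ℕ) (x : Sym μ m) :
    (lp.single 2 m x : Fock μ) ∈ fockFin μ :=
  ⟨m + 1, fun l hl => by
    have hlm : l ≠ m := by omega
    exact lp.single_apply_ne (E := fun m => Sym μ m) 2 m x hlm⟩

theorem eq_zero_of_inner_fockFin {y : Fock μ} (h : ∀ v ∈ fockFin μ, inner ℂ v y = 0) : y = 0 := by
  ext1; funext m
  have := h _ (single_mem_fockFin m (y m))
  rw [lp.inner_single_left] at this
  exact inner_self_eq_zero.1 this

theorem dense_fockFin : Dense (fockFin μ : Set (Fock μ)) := by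
  rw [Submodule.dense_iff_topologicalClosure_eq_top, Submodule.topologicalClosure_eq_top_iff,
    Submodule.eq_bot_iff]
  exact fun y hy => eq_zero_of_inner_fockFin fun v hv => (Submodule.mem_orthogonal _ _).1 hy v hv

theorem memℓp_of_finite {u : ∀ m, Sym μ m} (h : ∃ N : ℕ, ∀ m, N ≤ m → u m = 0) : Memℓp u 2 := by
  obtain ⟨N, hN⟩ := h
  refine (memℓp_zero ((Set.finite_Iio N).subset fun m hm => ?_)).of_exponent_ge (by simp)
  by_contra hlt
  exact hm (hN m (by simpa using hlt))

/-- The creation operator as a map of the finite particle vectors. -/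
def creFin (h : Lp ℂ 2 μ) : fockFin μ →ₗ[ℂ] fockFin μ where
  toFun u := ⟨createFin μ h u, by
    obtain ⟨N, hN⟩ := u.2
    refine ⟨N + 1, fun m hm => ?_⟩
    cases m with
    | zero => rfl
    | succ m =>
      change createSector μ h m ((u : Fock μ) m) = 0
      rw [hN m (by omega), map_zero]⟩
  map_add' u v := Subtype.ext ((createFin μ h).map_add u v)
  map_smul' c u := Subtype.ext ((createFin μ h).map_smul c u)

theorem creFin_zero (h : Lp ℂ 2 μ) (u : fockFin μ) : (creFin h u : Fock μ) 0 = 0 := rfl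

theorem creFin_succ (h : Lp ℂ 2 μ) (u : fockFin μ) (m : ℕ) :
    (creFin h u : Fock μ) (m + 1) = createL μ m h ((u : Fock μ) m) := rfl

/-- The annihilation operator as a map of the finite particle vectors. -/
def annFin (h : Lp ℂ 2 μ) : fockFin μ →ₗ[ℂ] fockFin μ where
  toFun u := ⟨⟨fun m => annihL μ m h ((u : Fock μ) (m + 1)), memℓp_of_finite (by
      obtain ⟨N, hN⟩ := u.2
      exact ⟨N, fun m hm => by rw [hN (m + 1) (by omega), map_zero]⟩)⟩, by
    obtain ⟨N, hN⟩ := u.2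
    exact ⟨N, fun m hm => by
      change annihL μ m h ((u : Fock μ) (m + 1)) = 0
      rw [hN (m + 1) (by omega), map_zero]⟩⟩
  map_add' u v := Subtype.ext <| by
    ext1; funext m
    exact map_add (annihL μ m h) _ _
  map_smul' c u := Subtype.ext <| by
    ext1; funext m
    exact map_smul (annihL μ m h) _ _

theorem annFin_apply (h : Lp ℂ 2 μ) (u : fockFin μ) (m : ℕ) :
    (annFin h u : Fock μ) m = annihL μ m h ((u : Fock μ) (m + 1)) := rfl

theorem inner_annFin_left (h : Lp ℂ 2 μ) (v u : fockFin μ) :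
    inner ℂ (annFin h v : Fock μ) (u : Fock μ) = inner ℂ (v : Fock μ) (creFin h u : Fock μ) := by
  rw [lp.inner_eq_tsum, (lp.hasSum_inner (v : Fock μ) (creFin h u : Fock μ)).tsum_eq.symm,
    (lp.hasSum_inner (𝕜 := ℂ) (v : Fock μ) (creFin h u : Fock μ)).summable.tsum_eq_zero_add,
    creFin_zero, inner_zero_right, zero_add]
  simp only [creFin_succ, annFin_apply, inner_annihL_left]

/-- The field operator as a map of the finite particle vectors. -/
def fieldFin (h : Lp ℂ 2 μ) : fockFin μ →ₗ[ℂ] fockFin μ :=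
  (((Real.sqrt 2)⁻¹ : ℝ) : ℂ) • (annFin h + creFin h)

theorem fieldFin_apply (h : Lp ℂ 2 μ) (u : fockFin μ) :
    fieldFin h u = (((Real.sqrt 2)⁻¹ : ℝ) : ℂ) • (annFin h u + creFin h u) := rfl

theorem fieldFin_symmetric (h : Lp ℂ 2 μ) (v u : fockFin μ) :
    inner ℂ (fieldFin h v : Fock μ) (u : Fock μ) = inner ℂ (v : Fock μ) (fieldFin h u : Fock μ) := by
  have h' : inner ℂ (creFin h v : Fock μ) (u : Fock μ)
      = inner ℂ (v : Fock μ) (annFin h u : Fock μ) := by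
    rw [← inner_conj_symm, ← inner_annFin_left, inner_conj_symm]
  rw [fieldFin_apply, fieldFin_apply, Submodule.coe_smul, Submodule.coe_smul, Submodule.coe_add,
    Submodule.coe_add, inner_smul_left, inner_smul_right, inner_add_left, inner_add_right,
    inner_annFin_left, h', Complex.conj_ofReal]
  ring

/-- The adjoint relation between `annFin` and `createFin` is stable under closing the creation
operator, and the density of its domain fixes the value of the adjoint. -/
theorem mem_graph_annihilate (h : Lp ℂ 2 μ) (v : fockFin μ) :
    ((v : Fock μ), (annFin h v : Fock μ)) ∈ (annihilate μ h).graph := by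
  have hdense : Dense ((create μ h).domain : Set (Fock μ)) :=
    dense_fockFin.mono (LinearPMap.le_closure (createFin μ h)).1
  have key : ∀ x : (create μ h).domain,
      inner ℂ (annFin h v : Fock μ) (x : Fock μ) = inner ℂ (v : Fock μ) (create μ h x) := by
    intro x
    refine (inner_eq_of_mem_graph_closure (T := createFin μ h) ?_
      (LinearPMap.mem_graph (create μ h) x)).symm
    intro y z hyz
    obtain ⟨hy, rfl⟩ := mem_graph_iff_exists.1 hyz
    exact (inner_annFin_left h v ⟨y, hy⟩).symm
  rw [mem_graph_iff_exists]
  have hmem : (v : Fock μ) ∈ (annihilate μ h).domain :=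
    LinearPMap.mem_adjoint_domain_of_exists _ ⟨_, key⟩
  exact ⟨hmem, LinearPMap.adjoint_apply_eq hdense _ key⟩

theorem mem_graph_field (h : Lp ℂ 2 μ) (v : fockFin μ) :
    ((v : Fock μ), (fieldFin h v : Fock μ)) ∈ (field μ h).graph := by
  refine mem_graph_closure_of_mem_graph (mem_graph_domRestrict.2 ⟨v.2, ?_⟩)
  refine mem_graph_smul _ (mem_graph_add (mem_graph_annihilate h v)
    (mem_graph_closure_of_mem_graph ?_))
  exact mem_graph_iff_exists.2 ⟨v.2, rfl⟩

theorem mem_graph_field_iff (h : Lp ℂ 2 μ) (v : fockFin μ) {y : Fock μ} :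
    ((v : Fock μ), y) ∈ (field μ h).graph ↔ y = fieldFin h v :=
  ⟨fun hy => (field μ h).mem_graph_snd_inj hy (mem_graph_field h v) rfl,
    fun hy => hy ▸ mem_graph_field h v⟩

/-! ### Relative bounds for the field operators -/

section

variable {w : X → ℝ≥0} {h : Lp ℂ 2 μ} {C : ℝ}

theorem hasSum_energy (K : ℝ) (u χ : Fock μ) :
    HasSum (fun m => K * (‖χ m‖ ^ 2 + ‖u m‖ ^ 2)) (K * (‖χ‖ ^ 2 + ‖u‖ ^ 2)) :=
  ((hasSum_norm_sq χ).add (hasSum_norm_sq u)).mul_left K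

theorem injOn_pred_of_zero {v : Fock μ} (h0 : v 0 = 0) : Set.InjOn Nat.pred {m | v m ≠ 0} := by
  intro a ha b hb hab
  have ha' : a ≠ 0 := fun e => ha (by rw [e]; exact h0)
  have hb' : b ≠ 0 := fun e => hb (by rw [e]; exact h0)
  simp only [Nat.pred_eq_sub_one] at hab
  omega

theorem norm_annFin_sq_le (hw : Measurable w) (H : WeightBound w h C) (u : fockFin μ) {χ : Fock μ}
    (hχ : ∀ m, IsMul μ (fun k => Real.sqrt (weight w m k)) ((u : Fock μ) m) (χ m)) :
    ‖(annFin h u : Fock μ)‖ ^ 2 ≤ C ^ 2 * (‖χ‖ ^ 2 + ‖(u : Fock μ)‖ ^ 2) := by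
  refine norm_sq_le_of_shift (hasSum_energy _ _ _) (fun m => by positivity) Nat.succ
    Nat.succ_injective.injOn fun m _ => ?_
  refine (H.annihL hw (hχ (m + 1))).trans ?_
  exact mul_le_mul_of_nonneg_left (le_add_of_nonneg_right (by positivity)) (by positivity)

theorem norm_creFin_sq_le (hw : Measurable w) (H : WeightBound w h C) (u : fockFin μ) {χ : Fock μ}
    (hχ : ∀ m, IsMul μ (fun k => Real.sqrt (weight w m k)) ((u : Fock μ) m) (χ m)) :
    ‖(creFin h u : Fock μ)‖ ^ 2 ≤ C ^ 2 * (‖χ‖ ^ 2 + ‖(u : Fock μ)‖ ^ 2) := by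
  refine norm_sq_le_of_shift (hasSum_energy _ _ _) (fun m => by positivity) Nat.pred
    (injOn_pred_of_zero rfl) fun m hm => ?_
  cases m with
  | zero => exact absurd rfl hm
  | succ m => exact H.createL hw (hχ m)

theorem norm_inv_sqrt_two_smul_sq (x : Fock μ) :
    ‖(((Real.sqrt 2)⁻¹ : ℝ) : ℂ) • x‖ ^ 2 = 2⁻¹ * ‖x‖ ^ 2 := by
  rw [norm_smul, mul_pow, Complex.norm_real, Real.norm_eq_abs, sq_abs, inv_pow,
    Real.sq_sqrt (by norm_num)]

theorem norm_fieldFin_sq_le (hw : Measurable w) (H : WeightBound w h C) (u : fockFin μ)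
    {χ : Fock μ}
    (hχ : ∀ m, IsMul μ (fun k => Real.sqrt (weight w m k)) ((u : Fock μ) m) (χ m)) :
    ‖(fieldFin h u : Fock μ)‖ ^ 2 ≤ 2 * C ^ 2 * (‖χ‖ ^ 2 + ‖(u : Fock μ)‖ ^ 2) := by
  rw [fieldFin_apply, Submodule.coe_smul, norm_inv_sqrt_two_smul_sq, Submodule.coe_add]
  have h1 := norm_add_sq_le_two (annFin h u : Fock μ) (creFin h u)
  have h2 := norm_annFin_sq_le hw H u hχ
  have h3 := norm_creFin_sq_le hw H u hχ
  linarith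

/-- Up to the factor 1/2, φ(h)² is the sum of aa, aa*, a*a and a*a*. Each squared norm is at most
6C⁴ times the energy, 6 arising when `χ₁` is eliminated. Two rounds of ‖x + y‖² ≤ 2‖x‖² + 2‖y‖² and
the prefactor 1/4 yield 24. -/
theorem norm_fieldFin_fieldFin_sq_le (hw : Measurable w) (H : WeightBound w h C) (u : fockFin μ)
    {χ : Fock μ} (hχ : ∀ m, IsMul μ (weight w m) ((u : Fock μ) m) (χ m)) :
    ‖(fieldFin h (fieldFin h u) : Fock μ)‖ ^ 2
      ≤ 24 * C ^ 4 * (‖χ‖ ^ 2 + ‖(u : Fock μ)‖ ^ 2) := by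
  choose χ₁ hχ₁ using fun m => isMul_sqrt_exists hw (hχ m)
  have hle : ∀ m, ‖χ₁ m‖ ^ 2 ≤ ‖χ m‖ ^ 2 + ‖(u : Fock μ) m‖ ^ 2 := fun m =>
    norm_sq_le_of_isMul_sqrt (hχ₁ m) (hχ m)
  have hC4 : 0 ≤ C ^ 4 := by have := H.nonneg; positivity
  have bound : ∀ m, ∀ t : ℝ, t ≤ C ^ 4 * (3 * ‖χ₁ m‖ ^ 2 + 2 * ‖χ m‖ ^ 2 + 3 * ‖(u : Fock μ) m‖ ^ 2) →
      t ≤ 6 * C ^ 4 * (‖χ m‖ ^ 2 + ‖(u : Fock μ) m‖ ^ 2) := by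
    intro m t ht
    refine ht.trans ?_
    have e : 6 * C ^ 4 * (‖χ m‖ ^ 2 + ‖(u : Fock μ) m‖ ^ 2)
      = C ^ 4 * (6 * (‖χ m‖ ^ 2 + ‖(u : Fock μ) m‖ ^ 2)) := by ring
    rw [e]
    refine mul_le_mul_of_nonneg_left ?_ hC4
    have := hle m
    have h1 : 0 ≤ ‖χ m‖ ^ 2 := by positivity
    linarith
  have mono : ∀ m, ∀ t x : ℝ, t ≤ C ^ 4 * x →
      x ≤ 3 * ‖χ₁ m‖ ^ 2 + 2 * ‖χ m‖ ^ 2 + 3 * ‖(u : Fock μ) m‖ ^ 2 →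
      t ≤ 6 * C ^ 4 * (‖χ m‖ ^ 2 + ‖(u : Fock μ) m‖ ^ 2) := fun m t x ht hx =>
    bound m t (ht.trans (mul_le_mul_of_nonneg_left hx hC4))
  have pos : ∀ m, 0 ≤ ‖χ₁ m‖ ^ 2 ∧ 0 ≤ ‖χ m‖ ^ 2 ∧ 0 ≤ ‖(u : Fock μ) m‖ ^ 2 := fun m =>
    ⟨by positivity, by positivity, by positivity⟩
  have haa : ‖(annFin h (annFin h u) : Fock μ)‖ ^ 2
      ≤ 6 * C ^ 4 * (‖χ‖ ^ 2 + ‖(u : Fock μ)‖ ^ 2) := by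
    refine norm_sq_le_of_shift (hasSum_energy _ _ _) (fun m => by positivity) (· + 2)
      (add_left_injective 2).injOn fun m _ => ?_
    obtain ⟨p1, p2, p3⟩ := pos (m + 2)
    exact mono (m + 2) _ _ (H.annihL_annihL hw (hχ (m + 2))) (by linarith)
  have hac : ‖(annFin h (creFin h u) : Fock μ)‖ ^ 2
      ≤ 6 * C ^ 4 * (‖χ‖ ^ 2 + ‖(u : Fock μ)‖ ^ 2) := by
    refine norm_sq_le_of_shift (hasSum_energy _ _ _) (fun m => by positivity) id
      Function.injective_id.injOn fun m _ => ?_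
    obtain ⟨p1, p2, p3⟩ := pos m
    exact mono m _ _ (H.annihL_createL hw (hχ₁ m) (hχ m)) (by linarith)
  have hca : ‖(creFin h (annFin h u) : Fock μ)‖ ^ 2
      ≤ 6 * C ^ 4 * (‖χ‖ ^ 2 + ‖(u : Fock μ)‖ ^ 2) := by
    refine norm_sq_le_of_shift (hasSum_energy _ _ _) (fun m => by positivity) id
      Function.injective_id.injOn fun m hm => ?_
    cases m with
    | zero => exact absurd rfl hm
    | succ m =>
      obtain ⟨p1, p2, p3⟩ := pos (m + 1)
      exact mono (m + 1) _ _ (H.createL_annihL hw (hχ₁ (m + 1)) (hχ (m + 1))) (by linarith)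
  have hcc : ‖(creFin h (creFin h u) : Fock μ)‖ ^ 2
      ≤ 6 * C ^ 4 * (‖χ‖ ^ 2 + ‖(u : Fock μ)‖ ^ 2) := by
    -- Two creations leave the sectors 0 and 1 empty, so `m - 2` is injective on the nonzero ones.
    have h0 : (creFin h (creFin h u) : Fock μ) 0 = 0 := rfl
    have h1 : (creFin h (creFin h u) : Fock μ) 1 = 0 := map_zero (createL μ 0 h)
    refine norm_sq_le_of_shift (hasSum_energy _ _ _) (fun m => by positivity) (fun m => m - 2)
      (fun a ha b hb hab => ?_) fun m hm => ?_
    · have a0 : a ≠ 0 := fun e => ha (by rw [e]; exact h0)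
      have a1 : a ≠ 1 := fun e => ha (by rw [e]; exact h1)
      have b0 : b ≠ 0 := fun e => hb (by rw [e]; exact h0)
      have b1 : b ≠ 1 := fun e => hb (by rw [e]; exact h1)
      simp only at hab
      omega
    · match m, hm with
      | 0, hm => exact absurd h0 hm
      | 1, hm => exact absurd h1 hm
      | m + 2, _ => exact bound m _ (H.createL_createL hw (hχ₁ m) (hχ m))
  have e : (fieldFin h (fieldFin h u) : Fock μ) = (((Real.sqrt 2)⁻¹ : ℝ) : ℂ) •
      ((((Real.sqrt 2)⁻¹ : ℝ) : ℂ) • (((annFin h (annFin h u) : Fock μ) + annFin h (creFin h u))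
        + ((creFin h (annFin h u) : Fock μ) + creFin h (creFin h u)))) := by
    rw [fieldFin_apply, fieldFin_apply]
    simp only [map_smul, map_add, Submodule.coe_smul, Submodule.coe_add, ← smul_add]
  rw [e, norm_inv_sqrt_two_smul_sq, norm_inv_sqrt_two_smul_sq]
  have h1 := norm_add_sq_le_two ((annFin h (annFin h u) : Fock μ) + annFin h (creFin h u))
    ((creFin h (annFin h u) : Fock μ) + creFin h (creFin h u))
  have h2 := norm_add_sq_le_two (annFin h (annFin h u) : Fock μ) (annFin h (creFin h u))
  have h3 := norm_add_sq_le_two (creFin h (annFin h u) : Fock μ) (creFin h (creFin h u))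
  linarith

end

end FockOps

/-! ### Bounded multiplication operators -/

/-- Bounded measurable symmetric real functions of the momenta in each particle sector. -/
structure Multiplier (X : Type*) [MeasurableSpace X] where
  /-- the underlying function -/
  toFun : ∀ m : ℕ, (Fin m → X) → ℝ
  measurable : ∀ m, Measurable (toFun m)
  perm : ∀ {m : ℕ} (σ : Equiv.Perm (Fin m)) (k : Fin m → X), toFun m (k ∘ σ) = toFun m k
  bounded : ∃ C : ℝ, ∀ m k, |toFun m k| ≤ C

namespace Multiplier

variable {X : Type*} [MeasurableSpace X]

instance : CoeFun (Multiplier X) (fun _ => ∀ m : ℕ, (Fin m → X) → ℝ) := ⟨toFun⟩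

theorem ext' {a b : Multiplier X} (h : ∀ m k, a m k = b m k) : a = b := by
  cases a; cases b
  congr 1
  funext m k
  exact h m k

/-- A bound of a multiplier. -/
def bd (a : Multiplier X) : ℝ := max a.bounded.choose 0

theorem bd_nonneg (a : Multiplier X) : 0 ≤ a.bd := le_max_right _ _

theorem abs_le_bd (a : Multiplier X) (m : ℕ) (k : Fin m → X) : |a m k| ≤ a.bd :=
  (a.bounded.choose_spec m k).trans (le_max_left _ _)

/-- The pointwise product. -/
def mul (a b : Multiplier X) : Multiplier X where
  toFun m k := a m k * b m k
  measurable m := (a.measurable m).mul (b.measurable m)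
  perm σ k := by rw [a.perm, b.perm]
  bounded := ⟨a.bd * b.bd, fun m k => by
    rw [abs_mul]
    exact mul_le_mul (a.abs_le_bd m k) (b.abs_le_bd m k) (abs_nonneg _) a.bd_nonneg⟩

theorem mul_apply (a b : Multiplier X) (m : ℕ) (k : Fin m → X) :
    a.mul b m k = a m k * b m k := rfl

/-- The pointwise square root. -/
def sqrt (a : Multiplier X) : Multiplier X where
  toFun m k := Real.sqrt (a m k)
  measurable m := (a.measurable m).sqrt
  perm σ k := by rw [a.perm]
  bounded := ⟨Real.sqrt a.bd, fun m k => by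
    rw [abs_of_nonneg (Real.sqrt_nonneg _)]
    exact Real.sqrt_le_sqrt (abs_le.1 (a.abs_le_bd m k)).2⟩

theorem sqrt_apply (a : Multiplier X) (m : ℕ) (k : Fin m → X) :
    a.sqrt m k = Real.sqrt (a m k) := rfl

/-- The constant multiplier `1`. -/
def one : Multiplier X where
  toFun _ _ := 1
  measurable _ := measurable_const
  perm _ _ := rfl
  bounded := ⟨1, fun _ _ => by simp⟩

variable {μ : Measure X} [SigmaFinite μ]

omit [SigmaFinite μ] in
theorem memLp_mul (a : Multiplier X) {m : ℕ} (ψ : TensorPower μ m) :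
    MemLp (fun k => (a m k : ℂ) * ψ k) 2 (Measure.pi fun _ : Fin m => μ) :=
  (Lp.memLp ψ).of_le_mul (c := a.bd)
    ((Complex.measurable_ofReal.comp (a.measurable m)).aestronglyMeasurable.mul
      (Lp.aestronglyMeasurable ψ))
    (ae_of_all _ fun k => by
      rw [norm_mul, Complex.norm_real]
      exact mul_le_mul_of_nonneg_right (a.abs_le_bd m k) (norm_nonneg _))

/-- Multiplication on the `m`-particle tensors. -/
def onTensor (a : Multiplier X) (m : ℕ) : TensorPower μ m →L[ℂ] TensorPower μ m :=
  LinearMap.mkContinuous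
    { toFun := fun ψ => (a.memLp_mul ψ).toLp _
      map_add' := fun ψ χ => by
        rw [← MemLp.toLp_add]
        refine MemLp.toLp_congr _ _ ?_
        filter_upwards [Lp.coeFn_add ψ χ] with k hk
        simp only [hk, Pi.add_apply, mul_add]
      map_smul' := fun c ψ => by
        rw [RingHom.id_apply, ← MemLp.toLp_const_smul]
        refine MemLp.toLp_congr _ _ ?_
        filter_upwards [Lp.coeFn_smul c ψ] with k hk
        simp only [hk, Pi.smul_apply, smul_eq_mul, mul_left_comm] }
    a.bd fun ψ => by
      refine Lp.norm_le_mul_norm_of_ae_le_mul ?_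
      filter_upwards [(a.memLp_mul ψ).coeFn_toLp] with k hk
      change ‖((a.memLp_mul ψ).toLp _ : (Fin m → X) → ℂ) k‖ ≤ _
      rw [hk, norm_mul, Complex.norm_real]
      exact mul_le_mul_of_nonneg_right (a.abs_le_bd m k) (norm_nonneg _)

omit [SigmaFinite μ] in
theorem coeFn_onTensor (a : Multiplier X) {m : ℕ} (ψ : TensorPower μ m) :
    a.onTensor m ψ =ᵐ[Measure.pi fun _ : Fin m => μ] fun k => (a m k : ℂ) * ψ k :=
  (a.memLp_mul ψ).coeFn_toLp

omit [SigmaFinite μ] in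
theorem norm_onTensor_le (a : Multiplier X) {m : ℕ} (ψ : TensorPower μ m) :
    ‖a.onTensor m ψ‖ ≤ a.bd * ‖ψ‖ :=
  ((a.onTensor m).le_opNorm ψ).trans
    (mul_le_mul_of_nonneg_right (LinearMap.mkContinuous_norm_le _ a.bd_nonneg _) (norm_nonneg _))

theorem onTensor_mem_sym (a : Multiplier X) {m : ℕ} {ψ : TensorPower μ m} (hψ : ψ ∈ Sym μ m) :
    a.onTensor m ψ ∈ Sym μ m := by
  intro σ
  refine Lp.ext ?_
  filter_upwards [coeFn_permute μ σ (a.onTensor m ψ), a.coeFn_onTensor ψ,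
    (measurePreserving_perm μ σ).quasiMeasurePreserving.ae (a.coeFn_onTensor ψ),
    sym_ae ⟨ψ, hψ⟩ σ] with k h1 h2 h3 h4
  rw [h1, h3, h2, a.perm, h4]

/-- Multiplication on the `m`-particle space. -/
def onSym (a : Multiplier X) (m : ℕ) : Sym μ m →L[ℂ] Sym μ m :=
  ((a.onTensor m).comp (Sym μ m).subtypeL).codRestrict (Sym μ m)
    fun ψ => a.onTensor_mem_sym ψ.2

theorem isMul_onSym (a : Multiplier X) {m : ℕ} (ψ : Sym μ m) : IsMul μ (a m) ψ (a.onSym m ψ) :=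
  a.coeFn_onTensor _

theorem norm_onSym_le (a : Multiplier X) (m : ℕ) : ‖(a.onSym m : Sym μ m →L[ℂ] Sym μ m)‖ ≤ a.bd :=
  ContinuousLinearMap.opNorm_le_bound _ a.bd_nonneg fun _ => a.norm_onTensor_le _

/-- Multiplication on Fock space. -/
def onFock (a : Multiplier X) : Fock μ →L[ℂ] Fock μ :=
  lp.mapCLM 2 (fun m => a.onSym m) a.bd_nonneg a.norm_onSym_le

theorem onFock_apply (a : Multiplier X) (u : Fock μ) (m : ℕ) :
    a.onFock u m = a.onSym m (u m) := rfl

variable {n : ℕ}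

variable (μ n) in
/-- Multiplication on `L²(ℝⁿ; 𝓕)`. -/
def onL2 (a : Multiplier X) : L2 n (Fock μ) →L[ℂ] L2 n (Fock μ) :=
  (a.onFock (μ := μ)).compLpL 2 volume

theorem coeFn_onL2 (a : Multiplier X) (u : L2 n (Fock μ)) :
    ∀ᵐ x, a.onL2 μ n u x = a.onFock (u x) :=
  ContinuousLinearMap.coeFn_compLpL _ _

end Multiplier

/-! ### Calculus of multiplication operators on L²(ℝⁿ; 𝓕) -/

section

variable {X : Type*} [MeasurableSpace X] {μ : Measure X} [SigmaFinite μ] {n : ℕ}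

theorem IsMul.unique {m : ℕ} {g : (Fin m → X) → ℝ} {ψ χ χ' : Sym μ m} (h : IsMul μ g ψ χ)
    (h' : IsMul μ g ψ χ') : χ = χ' :=
  Subtype.ext (Lp.ext (h.trans h'.symm))

theorem IsMul.comp {m : ℕ} {g g' : (Fin m → X) → ℝ} {ψ χ χ' : Sym μ m} (h : IsMul μ g ψ χ)
    (h' : IsMul μ g' χ χ') : IsMul μ (fun k => g k * g' k) ψ χ' := by
  filter_upwards [h, h'] with k h1 h2
  rw [h2, h1]
  push_cast
  ring

/-- Real multipliers move freely across the inner product, so only the product of the two matters.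
-/
theorem IsMul.inner_eq {m : ℕ} {g g' f f' : (Fin m → X) → ℝ} {ψ χ ψ' χ' α α' : Sym μ m}
    (h : IsMul μ g ψ χ) (h' : IsMul μ g' ψ' χ') (k : IsMul μ f ψ α) (k' : IsMul μ f' ψ' α')
    (hg : ∀ x, g x * g' x = f x * f' x) :
    (inner ℂ χ χ' : ℂ) = inner ℂ α α' := by
  rw [Submodule.coe_inner, Submodule.coe_inner, L2.inner_def, L2.inner_def]
  refine integral_congr_ae ?_
  filter_upwards [h, h', k, k'] with x h1 h2 h3 h4
  simp only [RCLike.inner_apply, h1, h2, h3, h4, map_mul, Complex.conj_ofReal]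
  have := congrArg (fun r : ℝ => (r : ℂ)) (hg x)
  push_cast at this
  linear_combination ((starRingEnd ℂ) ((ψ : TensorPower μ m) x) * (ψ' : TensorPower μ m) x) * this

/-- `χ = g ψ` in `L²(ℝⁿ; 𝓕)`. -/
def IsMulL2 (g : ∀ m : ℕ, (Fin m → X) → ℝ) (ψ χ : L2 n (Fock μ)) : Prop :=
  ∀ᵐ x, ∀ m, IsMul μ (g m) (ψ x m) (χ x m)

theorem mem_graph_pointwise_fockMul {g : ∀ m : ℕ, (Fin m → X) → ℝ} {ψ χ : L2 n (Fock μ)} :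
    (ψ, χ) ∈ (pointwise fun _ => fockMul μ g).graph ↔ IsMulL2 g ψ χ := by
  rw [mem_graph_pointwise]
  simp only [mem_graph_fockMul]
  rfl

theorem IsMulL2.unique {g : ∀ m : ℕ, (Fin m → X) → ℝ} {ψ χ χ' : L2 n (Fock μ)}
    (h : IsMulL2 g ψ χ) (h' : IsMulL2 g ψ χ') : χ = χ' := by
  refine Lp.ext ?_
  filter_upwards [h, h'] with x h1 h2
  ext1; funext m
  exact (h1 m).unique (h2 m)

theorem IsMulL2.comp {g g' : ∀ m : ℕ, (Fin m → X) → ℝ} {ψ χ χ' : L2 n (Fock μ)}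
    (h : IsMulL2 g ψ χ) (h' : IsMulL2 g' χ χ') : IsMulL2 (fun m k => g m k * g' m k) ψ χ' := by
  filter_upwards [h, h'] with x h1 h2 m
  exact (h1 m).comp (h2 m)

theorem IsMulL2.inner_eq {g g' f f' : ∀ m : ℕ, (Fin m → X) → ℝ}
    {ψ χ ψ' χ' α α' : L2 n (Fock μ)}
    (h : IsMulL2 g ψ χ) (h' : IsMulL2 g' ψ' χ') (k : IsMulL2 f ψ α) (k' : IsMulL2 f' ψ' α')
    (hg : ∀ m x, g m x * g' m x = f m x * f' m x) :
    (inner ℂ χ χ' : ℂ) = inner ℂ α α' := by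
  rw [L2.inner_def, L2.inner_def]
  refine integral_congr_ae ?_
  filter_upwards [h, h', k, k'] with x h1 h2 h3 h4
  simp only [lp.inner_eq_tsum]
  exact tsum_congr fun m => (h1 m).inner_eq (h2 m) (h3 m) (h4 m) (hg m)

theorem isMulL2_onL2 (a : Multiplier X) (ψ : L2 n (Fock μ)) : IsMulL2 a ψ (a.onL2 μ n ψ) := by
  filter_upwards [a.coeFn_onL2 ψ] with x hx m
  rw [hx, a.onFock_apply]
  exact a.isMul_onSym _

theorem isMulL2_one (ψ : L2 n (Fock μ)) : IsMulL2 (Multiplier.one (X := X)) ψ ψ := by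
  refine ae_of_all _ fun x m => ae_of_all _ fun k => ?_
  simp [Multiplier.one]

theorem onL2_eq_iff {a : Multiplier X} {ψ χ : L2 n (Fock μ)} :
    a.onL2 μ n ψ = χ ↔ IsMulL2 a ψ χ :=
  ⟨fun h => h ▸ isMulL2_onL2 a ψ, fun h => (isMulL2_onL2 a ψ).unique h⟩

theorem onL2_onL2 (a b : Multiplier X) (ψ : L2 n (Fock μ)) :
    a.onL2 μ n (b.onL2 μ n ψ) = (b.mul a).onL2 μ n ψ :=
  ((isMulL2_onL2 b ψ).comp (isMulL2_onL2 a _)).unique (isMulL2_onL2 (b.mul a) ψ)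

theorem IsMul.norm_le {m : ℕ} {g g' : (Fin m → X) → ℝ} {ψ χ χ' : Sym μ m} (h : IsMul μ g ψ χ)
    (h' : IsMul μ g' ψ χ') (hg : ∀ k, |g k| ≤ |g' k|) : ‖χ‖ ≤ ‖χ'‖ := by
  change ‖(χ : TensorPower μ m)‖ ≤ ‖(χ' : TensorPower μ m)‖
  refine Lp.norm_le_norm_of_ae_le ?_
  filter_upwards [h, h'] with k h1 h2
  rw [h1, h2, norm_mul, norm_mul, Complex.norm_real, Complex.norm_real]
  exact mul_le_mul_of_nonneg_right (hg k) (norm_nonneg _)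

theorem IsMulL2.norm_le {g g' : ∀ m : ℕ, (Fin m → X) → ℝ} {ψ χ χ' : L2 n (Fock μ)}
    (h : IsMulL2 g ψ χ) (h' : IsMulL2 g' ψ χ') (hg : ∀ m k, |g m k| ≤ |g' m k|) :
    ‖χ‖ ≤ ‖χ'‖ := by
  refine Lp.norm_le_norm_of_ae_le ?_
  filter_upwards [h, h'] with x h1 h2
  exact lp.norm_mono (by norm_num) fun m => (h1 m).norm_le (h2 m) (hg m)

/-- Expand the square on the left. For 0 ≤ b ≤ a the cross term (aψ, bψ) equals ‖√(ab) ψ‖², which is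
at least ‖bψ‖². -/
theorem norm_sq_onL2_sub (a b : Multiplier X) (hb : ∀ m k, 0 ≤ b m k) (h : ∀ m k, b m k ≤ a m k)
    (ψ : L2 n (Fock μ)) :
    ‖a.onL2 μ n ψ - b.onL2 μ n ψ‖ ^ 2 ≤ ‖a.onL2 μ n ψ‖ ^ 2 - ‖b.onL2 μ n ψ‖ ^ 2 := by
  have h1 : (inner ℂ (a.onL2 μ n ψ) (b.onL2 μ n ψ) : ℂ)
      = inner ℂ ((a.mul b).sqrt.onL2 μ n ψ) ((a.mul b).sqrt.onL2 μ n ψ) := by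
    refine (isMulL2_onL2 a ψ).inner_eq (isMulL2_onL2 b ψ) (isMulL2_onL2 _ ψ) (isMulL2_onL2 _ ψ) ?_
    intro m k
    rw [Multiplier.sqrt_apply, Multiplier.mul_apply,
      Real.mul_self_sqrt (mul_nonneg ((hb m k).trans (h m k)) (hb m k))]
  have h2 : ‖b.onL2 μ n ψ‖ ≤ ‖(a.mul b).sqrt.onL2 μ n ψ‖ := by
    refine (isMulL2_onL2 b ψ).norm_le (isMulL2_onL2 _ ψ) fun m k => ?_
    rw [Multiplier.sqrt_apply, Multiplier.mul_apply, abs_of_nonneg (hb m k),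
      abs_of_nonneg (Real.sqrt_nonneg _)]
    exact Real.le_sqrt_of_sq_le (by nlinarith [hb m k, h m k])
  have h3 := norm_sub_sq (𝕜 := ℂ) (a.onL2 μ n ψ) (b.onL2 μ n ψ)
  rw [h1, inner_self_eq_norm_sq] at h3
  have h4 := pow_le_pow_left₀ (norm_nonneg _) h2 2
  linarith

/-- A form of monotone convergence: the squared norms increase and are bounded, hence converge, and
`norm_sq_onL2_sub` makes the vectors a Cauchy sequence. -/
theorem exists_tendsto_onL2 {B : ℕ → Multiplier X} (h0 : ∀ N m k, 0 ≤ B N m k)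
    (hB : ∀ m k, Monotone fun N => B N m k) {ψ : L2 n (Fock μ)} {C : ℝ}
    (hC : ∀ N, ‖(B N).onL2 μ n ψ‖ ≤ C) :
    ∃ χ, Tendsto (fun N => (B N).onL2 μ n ψ) atTop (𝓝 χ) := by
  set r : ℕ → ℝ := fun N => ‖(B N).onL2 μ n ψ‖ ^ 2 with hr
  have hmono : Monotone r := fun M N hMN => by
    refine pow_le_pow_left₀ (norm_nonneg _) ?_ 2
    refine (isMulL2_onL2 _ ψ).norm_le (isMulL2_onL2 _ ψ) fun m k => ?_
    rw [abs_of_nonneg (h0 _ _ _), abs_of_nonneg (h0 _ _ _)]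
    exact hB m k hMN
  have hbdd : BddAbove (Set.range r) := ⟨C ^ 2, by
    rintro _ ⟨N, rfl⟩
    exact pow_le_pow_left₀ (norm_nonneg _) (hC N) 2⟩
  have hlim := (tendsto_atTop_ciSup hmono hbdd).cauchySeq
  refine cauchySeq_tendsto_of_complete (Metric.cauchySeq_iff'.2 fun ε hε => ?_)
  obtain ⟨M, hM⟩ := Metric.cauchySeq_iff'.1 hlim (ε ^ 2) (by positivity)
  refine ⟨M, fun N hN => ?_⟩
  have h1 := norm_sq_onL2_sub (B N) (B M) (h0 M) (fun m k => hB m k hN) ψ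
  have h2 := hM N hN
  rw [Real.dist_eq] at h2
  rw [dist_eq_norm]
  exact lt_of_pow_lt_pow_left₀ 2 hε.le (h1.trans_lt ((le_abs_self _).trans_lt h2))

end

/-! ### Cut-offs in particle number and field energy -/

namespace Multiplier

variable {X : Type*} [MeasurableSpace X]

/-- The projection onto fewer than `N` particles. -/
def numCut (X : Type*) [MeasurableSpace X] (N : ℕ) : Multiplier X where
  toFun m _ := if m < N then 1 else 0
  measurable _ := measurable_const
  perm _ _ := rfl
  bounded := ⟨1, fun m _ => by split_ifs <;> simp⟩

theorem numCut_apply (N m : ℕ) (k : Fin m → X) : numCut X N m k = if m < N then 1 else 0 := rfl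

/-- The multiplier `min(√(w(k₁) + ⋯ + w(k_m)), N)`. -/
def rootCut {w : X → ℝ≥0} (hw : Measurable w) (N : ℕ) : Multiplier X where
  toFun m k := min (Real.sqrt (weight w m k)) N
  measurable m := (measurable_weight hw m).sqrt.min measurable_const
  perm σ k := by rw [weight_perm]
  bounded := ⟨N, fun m k => by
    rw [abs_of_nonneg (le_min (Real.sqrt_nonneg _) (Nat.cast_nonneg _))]
    exact min_le_right _ _⟩

theorem rootCut_apply {w : X → ℝ≥0} (hw : Measurable w) (N m : ℕ) (k : Fin m → X) :
    rootCut hw N m k = min (Real.sqrt (weight w m k)) N := rfl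

theorem rootCut_nonneg {w : X → ℝ≥0} (hw : Measurable w) (N m : ℕ) (k : Fin m → X) :
    0 ≤ rootCut hw N m k := le_min (Real.sqrt_nonneg _) (Nat.cast_nonneg _)

/-- The indicator function of `√(w(k₁) + ⋯ + w(k_m)) ≤ N`. -/
def energyCut {w : X → ℝ≥0} (hw : Measurable w) (N : ℕ) : Multiplier X where
  toFun m k := if Real.sqrt (weight w m k) ≤ N then 1 else 0
  measurable m := Measurable.ite (measurableSet_le (measurable_weight hw m).sqrt measurable_const)
    measurable_const measurable_const
  perm σ k := by rw [weight_perm]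
  bounded := ⟨1, fun m _ => by split_ifs <;> simp⟩

theorem energyCut_apply {w : X → ℝ≥0} (hw : Measurable w) (N m : ℕ) (k : Fin m → X) :
    energyCut hw N m k = if Real.sqrt (weight w m k) ≤ N then 1 else 0 := rfl

end Multiplier

open Multiplier

/-! ### Removal of cut-offs and domains of square roots -/

section

variable {X : Type*} [MeasurableSpace X] {μ : Measure X} [SigmaFinite μ] {n : ℕ}

theorem norm_numCut_le (N : ℕ) (ψ : L2 n (Fock μ)) : ‖(numCut X N).onL2 μ n ψ‖ ≤ ‖ψ‖ := by
  refine (isMulL2_onL2 _ ψ).norm_le (isMulL2_one ψ) fun m k => ?_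
  rw [numCut_apply]
  simp only [Multiplier.one]
  split_ifs <;> simp

/-- Convergence follows from monotonicity. The limit is identified by applying a fixed cut-off to
it, which agrees with that cut-off of `ψ`. -/
theorem tendsto_numCut (ψ : L2 n (Fock μ)) :
    Tendsto (fun N => (numCut X N).onL2 μ n ψ) atTop (𝓝 ψ) := by
  obtain ⟨χ, hχ⟩ := exists_tendsto_onL2 (B := numCut X) (ψ := ψ) (C := ‖ψ‖)
    (fun N m k => by rw [numCut_apply]; split_ifs <;> simp)
    (fun m k M N hMN => by
      simp only [numCut_apply]
      split_ifs with h1 h2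
      · exact le_rfl
      · omega
      · exact zero_le_one
      · exact le_rfl) (fun N => norm_numCut_le N ψ)
  have key : ∀ M, (numCut X M).onL2 μ n χ = (numCut X M).onL2 μ n ψ := by
    intro M
    refine tendsto_nhds_unique ((((numCut X M).onL2 μ n).continuous.tendsto χ).comp hχ) ?_
    refine tendsto_const_nhds.congr' ?_
    filter_upwards [eventually_ge_atTop M] with N hN
    rw [Function.comp_apply, onL2_onL2]
    congr 1
    refine congrArg (fun a : Multiplier X => a.onL2 μ n) (Multiplier.ext' fun m k => ?_)
    rw [mul_apply, numCut_apply, numCut_apply]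
    split_ifs <;> first | omega | simp
  have : χ = ψ := by
    refine Lp.ext ?_
    filter_upwards [ae_all_iff.2 fun M => (numCut X M).coeFn_onL2 χ,
      ae_all_iff.2 fun M => (numCut X M).coeFn_onL2 ψ] with x h1 h2
    ext1; funext m
    -- The cut-off `m + 1` is the smallest one that retains sector `m`.
    have h3 : (numCut X (m + 1)).onSym m (χ x m) = (numCut X (m + 1)).onSym m (ψ x m) := by
      rw [← onFock_apply, ← onFock_apply, ← h1, ← h2, key]
    have h4 : ∀ u : Sym μ m, (numCut X (m + 1)).onSym m u = u := fun u =>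
      (isMul_onSym _ u).unique (ae_of_all _ fun k => by simp [numCut_apply])
    rwa [h4, h4] at h3
  rwa [this] at hχ

variable {w : X → ℝ≥0}

/-- Membership in the domain of the square root follows from a bound uniform in `N`. The vectors
converge by monotonicity; where √s ≤ M the cut-off at `N ≥ M` is inactive, which identifies the
limit there, and these regions exhaust the space. -/
theorem exists_isMulL2_sqrt (hw : Measurable w) {ψ : L2 n (Fock μ)} {C : ℝ}
    (hC : ∀ N, ‖(rootCut hw N).onL2 μ n ψ‖ ≤ C) :
    ∃ χ, IsMulL2 (fun m k => Real.sqrt (weight w m k)) ψ χ := by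
  obtain ⟨χ, hχ⟩ := exists_tendsto_onL2 (B := rootCut hw) (ψ := ψ) (C := C)
    (rootCut_nonneg hw)
    (fun m k M N hMN => min_le_min_left _ (Nat.cast_le.2 hMN)) hC
  refine ⟨χ, ?_⟩
  have key : ∀ M, (energyCut hw M).onL2 μ n χ
      = ((rootCut hw M).mul (energyCut hw M)).onL2 μ n ψ := by
    intro M
    refine tendsto_nhds_unique ((((energyCut hw M).onL2 μ n).continuous.tendsto χ).comp hχ) ?_
    refine tendsto_const_nhds.congr' ?_
    filter_upwards [eventually_ge_atTop M] with N hN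
    rw [Function.comp_apply, onL2_onL2]
    congr 1
    refine congrArg (fun a : Multiplier X => a.onL2 μ n) (Multiplier.ext' fun m k => ?_)
    simp only [mul_apply, energyCut_apply, rootCut_apply]
    split_ifs with h
    · rw [min_eq_left h, min_eq_left (h.trans (Nat.cast_le.2 hN))]
    · simp
  have h1 : ∀ M, IsMulL2 (energyCut hw M) χ (((rootCut hw M).mul (energyCut hw M)).onL2 μ n ψ) :=
    fun M => onL2_eq_iff.1 (key M)
  have h2 : ∀ M, IsMulL2 ((rootCut hw M).mul (energyCut hw M)) ψ
    (((rootCut hw M).mul (energyCut hw M)).onL2 μ n ψ) := fun M => isMulL2_onL2 _ ψ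
  filter_upwards [ae_all_iff.2 h1, ae_all_iff.2 h2] with x h3 h4 m
  filter_upwards [ae_all_iff.2 fun M => h3 M m, ae_all_iff.2 fun M => h4 M m] with k h5 h6
  obtain ⟨M, hM⟩ := exists_nat_ge (Real.sqrt (weight w m k))
  have h7 := (h5 M).symm.trans (h6 M)
  simpa [mul_apply, energyCut_apply, rootCut_apply, hM] using h7

theorem norm_rootCut_rootCut_le (hw : Measurable w) {ψ χ : L2 n (Fock μ)}
    (h : IsMulL2 (weight w) ψ χ) (N : ℕ) :
    ‖(rootCut hw N).onL2 μ n ((rootCut hw N).onL2 μ n ψ)‖ ≤ ‖χ‖ := by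
  rw [onL2_onL2]
  refine (isMulL2_onL2 _ ψ).norm_le h fun m k => ?_
  rw [mul_apply, abs_of_nonneg (mul_nonneg (rootCut_nonneg hw _ _ _) (rootCut_nonneg hw _ _ _)),
    abs_of_nonneg (weight_nonneg w m k)]
  calc _ ≤ Real.sqrt (weight w m k) * Real.sqrt (weight w m k) :=
        mul_le_mul (min_le_left _ _) (min_le_left _ _) (rootCut_nonneg hw _ _ _)
          (Real.sqrt_nonneg _)
    _ = weight w m k := Real.mul_self_sqrt (weight_nonneg w m k)

theorem inner_onL2_onL2 (a : Multiplier X) (ψ χ : L2 n (Fock μ)) :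
    (inner ℂ (a.onL2 μ n ψ) (a.onL2 μ n χ) : ℂ) = inner ℂ ψ (a.onL2 μ n (a.onL2 μ n χ)) := by
  rw [onL2_onL2]
  refine (isMulL2_onL2 a ψ).inner_eq (isMulL2_onL2 a χ) (isMulL2_one ψ) (isMulL2_onL2 _ χ) ?_
  intro m k
  rw [mul_apply]
  simp [Multiplier.one]

theorem norm_rootCut_sq (hw : Measurable w) (ψ : L2 n (Fock μ)) (N : ℕ) :
    ‖(rootCut hw N).onL2 μ n ψ‖ ^ 2
      = ‖(inner ℂ ψ ((rootCut hw N).onL2 μ n ((rootCut hw N).onL2 μ n ψ)) : ℂ)‖ := by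
  rw [← inner_onL2_onL2, inner_self_eq_norm_sq_to_K]
  simp

/-- With B_N = min(√s, N), ‖B_N ψ‖² is the modulus of (ψ, B_N²ψ), and B_N² ≤ s bounds it by ‖ψ‖ ‖χ‖
for all N. -/
theorem IsMulL2.exists_sqrt (hw : Measurable w) {ψ χ : L2 n (Fock μ)}
    (h : IsMulL2 (weight w) ψ χ) : ∃ χ₁, IsMulL2 (fun m k => Real.sqrt (weight w m k)) ψ χ₁ := by
  refine exists_isMulL2_sqrt hw (C := Real.sqrt (‖ψ‖ * ‖χ‖)) fun N => Real.le_sqrt_of_sq_le ?_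
  rw [norm_rootCut_sq]
  exact (norm_inner_le_norm _ _).trans
    (mul_le_mul_of_nonneg_left (norm_rootCut_rootCut_le hw h N) (norm_nonneg _))

/-- The derivative of `ψ ∈ D(∂_j²) ∩ D(H_f)` belongs to `D(H_f^{1/2})`. -/
theorem IsMulL2.exists_sqrt_of_isWeakDeriv (hw : Measurable w) {j : Fin n}
    {ψ χ η ζ : L2 n (Fock μ)} (h : IsMulL2 (weight w) ψ χ) (hη : IsWeakDeriv j ψ η)
    (hζ : IsWeakDeriv j η ζ) : ∃ χ₁, IsMulL2 (fun m k => Real.sqrt (weight w m k)) η χ₁ := by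
  refine exists_isMulL2_sqrt hw (C := Real.sqrt (‖ζ‖ * ‖χ‖)) fun N => Real.le_sqrt_of_sq_le ?_
  -- The cut-off operator is bounded and acts in the fibre only, so it commutes with the derivative.
  have h1 : IsWeakDeriv j ((rootCut hw N).onL2 μ n ((rootCut hw N).onL2 μ n ψ))
      ((rootCut hw N).onL2 μ n ((rootCut hw N).onL2 μ n η)) :=
    (hη.compLpL _).compLpL _
  -- Integration by parts places both cut-off factors on `ψ` itself, where `χ` controls them
  -- uniformly in `N`.
  have h2 : (inner ℂ η ((rootCut hw N).onL2 μ n ((rootCut hw N).onL2 μ n η)) : ℂ)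
      = - inner ℂ ζ ((rootCut hw N).onL2 μ n ((rootCut hw N).onL2 μ n ψ)) := by
    rw [hζ.inner_eq h1, neg_neg]
  rw [norm_rootCut_sq, h2, norm_neg]
  exact (norm_inner_le_norm _ _).trans
    (mul_le_mul_of_nonneg_left (norm_rootCut_rootCut_le hw h N) (norm_nonneg _))

/-- The vectors of Fock space in the domain of `dΓ(w)^{1/2}`. -/
def sqrtDomain (μ : Measure X) [SigmaFinite μ] (w : X → ℝ≥0) : Submodule ℂ (Fock μ) :=
  (fockMul μ fun m k => Real.sqrt (weight w m k)).domain

theorem mem_sqrtDomain {v : Fock μ} : v ∈ sqrtDomain μ w ↔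
    ∃ χ : Fock μ, ∀ m, IsMul μ (fun k => Real.sqrt (weight w m k)) (v m) (χ m) := by
  rw [sqrtDomain, LinearPMap.mem_domain_iff]
  simp only [mem_graph_fockMul]
  rfl

/-- Energy cut-offs of any vector lie in the domain. If `y` is orthogonal to it, each cut-off of `y`
is orthogonal to `y`, and the cut-off being a projection this makes it zero; the cut-offs exhaust
`y`. -/
theorem dense_sqrtDomain (hw : Measurable w) : Dense (sqrtDomain μ w : Set (Fock μ)) := by
  rw [Submodule.dense_iff_topologicalClosure_eq_top, Submodule.topologicalClosure_eq_top_iff,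
    Submodule.eq_bot_iff]
  intro y hy
  have h1 : ∀ M, (energyCut hw M).onFock y ∈ sqrtDomain μ w := fun M => by
    refine mem_sqrtDomain.2 ⟨(rootCut hw M).onFock ((energyCut hw M).onFock y), fun m => ?_⟩
    change IsMul μ _ ((energyCut hw M).onSym m (y m))
      ((rootCut hw M).onSym m ((energyCut hw M).onSym m (y m)))
    filter_upwards [isMul_onSym (rootCut hw M) ((energyCut hw M).onSym m (y m)),
      isMul_onSym (energyCut hw M) (y m)] with k h2 h3
    rw [h2, h3, rootCut_apply, energyCut_apply]
    split_ifs with h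
    · rw [min_eq_left h]
    · simp
  have h2 : ∀ M m, (energyCut hw M).onSym m (y m) = 0 := fun M m => by
    have h3 := (Submodule.mem_orthogonal _ _).1 hy _ (h1 M)
    have h4 : (inner ℂ ((energyCut hw M).onFock y) y : ℂ)
        = inner ℂ ((energyCut hw M).onFock y) ((energyCut hw M).onFock y) := by
      rw [lp.inner_eq_tsum, lp.inner_eq_tsum]
      refine tsum_congr fun m => ?_
      refine (isMul_onSym _ (y m)).inner_eq (g' := fun _ => 1)
        (ae_of_all _ fun k => by simp) (isMul_onSym _ (y m)) (isMul_onSym _ (y m)) fun k => ?_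
      rw [energyCut_apply]
      split_ifs <;> simp
    rw [h4, inner_self_eq_zero] at h3
    rw [← onFock_apply, h3]
    rfl
  ext1; funext m
  refine (show IsMul μ (fun _ => 1) (y m) (y m) from ae_of_all _ fun k => by simp).unique ?_
  have h3 : ∀ M, IsMul μ (energyCut hw M m) (y m) 0 := fun M => h2 M m ▸ isMul_onSym _ _
  filter_upwards [ae_all_iff.2 h3] with k hk
  obtain ⟨M, hM⟩ := exists_nat_ge (Real.sqrt (weight w m k))
  have := hk M
  rw [energyCut_apply, if_pos hM] at this
  exact this

end

theorem isBddWeakDeriv_of_inner {n : ℕ} {F : Type*} [NormedAddCommGroup F] [InnerProductSpace ℂ F]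
    [CompleteSpace F] {D : Set F} (hD : Dense D) {j : Fin n}
    {g K : EuclideanSpace ℝ (Fin n) → F} (hg : MemLp g ∞ volume) (hK : MemLp K ∞ volume)
    (h : ∀ w ∈ D, ∀ f : EuclideanSpace ℝ (Fin n) → ℂ, IsTest f →
      ∫ x, partialDeriv j f x * inner ℂ w (g x) = - ∫ x, f x * inner ℂ w (K x)) :
    IsBddWeakDeriv j g K := by
  refine ⟨hg, hK, fun f hf => ?_⟩
  refine hD.eq_of_inner_right (𝕜 := ℂ) fun w hw => ?_
  rw [inner_neg_right, ← integral_inner ((hf.partialDeriv j).integrable_smul hg),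
    ← integral_inner (hf.integrable_smul hK)]
  simp only [inner_smul_right]
  exact h w hw f hf

/-! ### Field operators with bounded particle number -/

section FieldTrunc

variable {X : Type*} [MeasurableSpace X] {μ : Measure X} [SigmaFinite μ]

theorem eq_sum_single {v : Fock μ} {N : ℕ} (hv : ∀ m, N ≤ m → v m = 0) :
    v = ∑ m ∈ Finset.range N, (lp.single 2 m (v m) : Fock μ) := by
  ext1; funext l
  rw [lp.coeFn_sum, Finset.sum_apply]
  by_cases hl : l < N
  · rw [Finset.sum_eq_single_of_mem l (Finset.mem_range.2 hl) fun b _ hb =>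
      lp.single_apply_ne (E := fun m => Sym μ m) 2 b (v b) hb.symm]
    exact (lp.single_apply_self (E := fun m => Sym μ m) 2 l (v l)).symm
  · rw [hv l (not_lt.1 hl), Finset.sum_eq_zero]
    intro b hb
    have : l ≠ b := by have := Finset.mem_range.1 hb; omega
    exact lp.single_apply_ne (E := fun m => Sym μ m) 2 b (v b) this

theorem creFin_eq_sum (h : Lp ℂ 2 μ) {u : fockFin μ} {N : ℕ}
    (hu : ∀ m, N ≤ m → (u : Fock μ) m = 0) :
    (creFin h u : Fock μ)
      = ∑ m ∈ Finset.range N, (lp.single 2 (m + 1) (createL μ m h ((u : Fock μ) m)) : Fock μ) := by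
  have h1 : ∀ m, N + 1 ≤ m → (creFin h u : Fock μ) m = 0 := by
    intro m hm
    cases m with
    | zero => rfl
    | succ m => rw [creFin_succ, hu m (by omega), map_zero]
  have h0 : (lp.single 2 0 ((creFin h u : Fock μ) 0) : Fock μ) = 0 := by
    rw [creFin_zero]
    exact map_zero (lp.singleContinuousLinearMap ℂ (fun m => Sym μ m) 2 0)
  rw [eq_sum_single h1, Finset.sum_range_succ', h0, add_zero]
  rfl

theorem annFin_eq_sum (h : Lp ℂ 2 μ) {u : fockFin μ} {N : ℕ}
    (hu : ∀ m, N ≤ m → (u : Fock μ) m = 0) :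
    (annFin h u : Fock μ)
      = ∑ m ∈ Finset.range N, (lp.single 2 m (annihL μ m h ((u : Fock μ) (m + 1))) : Fock μ) := by
  have h1 : ∀ m, N ≤ m → (annFin h u : Fock μ) m = 0 := by
    intro m hm
    rw [annFin_apply, hu (m + 1) (by omega), map_zero]
  rw [eq_sum_single h1]
  rfl

/-- The field operator, cut off at `N` particles. -/
def fieldTrunc (N : ℕ) (h : Lp ℂ 2 μ) (u : Fock μ) : Fock μ :=
  (((Real.sqrt 2)⁻¹ : ℝ) : ℂ) • ∑ m ∈ Finset.range N,
    ((lp.single 2 m (annihL μ m h (u (m + 1))) : Fock μ)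
      + (lp.single 2 (m + 1) (createL μ m h (u m)) : Fock μ))

theorem fieldFin_eq_fieldTrunc (h : Lp ℂ 2 μ) {u : fockFin μ} {N : ℕ}
    (hu : ∀ m, N ≤ m → (u : Fock μ) m = 0) :
    (fieldFin h u : Fock μ) = fieldTrunc N h u := by
  rw [fieldFin_apply, Submodule.coe_smul, Submodule.coe_add, creFin_eq_sum h hu,
    annFin_eq_sum h hu, ← Finset.sum_add_distrib]
  rfl

theorem norm_annihL_apply_le (m : ℕ) (h : Lp ℂ 2 μ) (χ : Sym μ (m + 1)) :
    ‖annihL μ m h χ‖ ≤ ‖createL μ m‖ * ‖h‖ * ‖χ‖ := by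
  refine ((annihL μ m h).le_opNorm χ).trans (mul_le_mul_of_nonneg_right ?_ (norm_nonneg _))
  rw [annihL, LinearIsometryEquiv.norm_map]
  exact (createL μ m).le_opNorm h

/-- Below `N` particles only finitely many bounded maps occur, linear in the vector and linear or
antilinear in `h`. Joint continuity gives the measurability in `x` of φ(G(x))ψ(x). -/
theorem continuous_fieldTrunc (N : ℕ) :
    Continuous fun z : Lp ℂ 2 μ × Fock μ => fieldTrunc N z.1 z.2 := by
  have hev : ∀ m, Continuous fun z : Lp ℂ 2 μ × Fock μ => z.2 m := fun m =>
    (lp.evalCLM ℂ (fun m => Sym μ m) 2 m).continuous.comp continuous_snd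
  have h1 : ∀ m, Continuous fun z : Lp ℂ 2 μ × Fock μ =>
      (lp.single 2 m (annihL μ m z.1 (z.2 (m + 1))) : Fock μ) := fun m => by
    refine (lp.isometry_single (E := fun m => Sym μ m) (p := 2) m).continuous.comp ?_
    have h : Continuous fun z : Lp ℂ 2 μ × Fock μ => annihL μ m z.1 :=
      (ContinuousLinearMap.adjoint (𝕜 := ℂ) (E := Sym μ m) (F := Sym μ (m + 1))).continuous.comp
        ((createL μ m).continuous.comp continuous_fst)
    exact h.clm_apply (hev (m + 1))
  have h2 : ∀ m, Continuous fun z : Lp ℂ 2 μ × Fock μ =>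
      (lp.single 2 (m + 1) (createL μ m z.1 (z.2 m)) : Fock μ) := fun m => by
    refine (lp.isometry_single (E := fun m => Sym μ m) (p := 2) (m + 1)).continuous.comp ?_
    exact ((createL μ m).continuous.comp continuous_fst).clm_apply (hev m)
  have h3 : ∀ m, Continuous fun z : Lp ℂ 2 μ × Fock μ =>
      (lp.single 2 m (annihL μ m z.1 (z.2 (m + 1))) : Fock μ)
        + (lp.single 2 (m + 1) (createL μ m z.1 (z.2 m)) : Fock μ) := fun m => (h1 m).add (h2 m)
  have h4 : Continuous fun z : Lp ℂ 2 μ × Fock μ => ∑ m ∈ Finset.range N,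
      ((lp.single 2 m (annihL μ m z.1 (z.2 (m + 1))) : Fock μ)
        + (lp.single 2 (m + 1) (createL μ m z.1 (z.2 m)) : Fock μ)) :=
    continuous_finsetSum _ fun m _ => h3 m
  have h5 := h4.const_smul (((Real.sqrt 2)⁻¹ : ℝ) : ℂ)
  exact h5

theorem aestronglyMeasurable_fieldTrunc {α : Type*} [MeasurableSpace α] {ν : Measure α} (N : ℕ)
    {g : α → Lp ℂ 2 μ} {u : α → Fock μ} (hg : AEStronglyMeasurable g ν)
    (hu : AEStronglyMeasurable u ν) :
    AEStronglyMeasurable (fun x => fieldTrunc N (g x) (u x)) ν := by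
  have h1 : AEStronglyMeasurable (fun x => (g x, u x)) ν := hg.prodMk hu
  have h2 := (continuous_fieldTrunc N).comp_aestronglyMeasurable h1
  exact h2

theorem exists_norm_fieldTrunc_le (μ : Measure X) [SigmaFinite μ] (N : ℕ) :
    ∃ K : ℝ, 0 ≤ K ∧ ∀ (h : Lp ℂ 2 μ) (u : Fock μ), ‖fieldTrunc N h u‖ ≤ K * (‖h‖ * ‖u‖) := by
  refine ⟨‖(((Real.sqrt 2)⁻¹ : ℝ) : ℂ)‖ * ∑ m ∈ Finset.range N, 2 * ‖createL μ m‖, by positivity,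
    fun h u => ?_⟩
  rw [fieldTrunc, norm_smul, mul_assoc, Finset.sum_mul]
  refine mul_le_mul_of_nonneg_left (norm_sum_le_of_le _ fun m _ => ?_) (norm_nonneg _)
  refine (norm_add_le _ _).trans ?_
  rw [lp.norm_single (E := fun m => Sym μ m) (by norm_num),
    lp.norm_single (E := fun m => Sym μ m) (by norm_num)]
  have hu : ∀ m, ‖u m‖ ≤ ‖u‖ := lp.norm_apply_le_norm (by norm_num) u
  have h1 : ‖annihL μ m h (u (m + 1))‖ ≤ ‖createL μ m‖ * ‖h‖ * ‖u‖ :=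
    (norm_annihL_apply_le m h _).trans (mul_le_mul_of_nonneg_left (hu _) (by positivity))
  have h2 : ‖createL μ m h (u m)‖ ≤ ‖createL μ m‖ * ‖h‖ * ‖u‖ :=
    ((createL μ m).le_opNorm₂ h _).trans (mul_le_mul_of_nonneg_left (hu _) (by positivity))
  linarith

/-- Riesz representation: the matrix element involves finitely many sectors, so it is a bounded
linear functional of `h`. It reduces weak differentiability of φ(G(x))v to the scalar condition on
G. -/
theorem exists_inner_creFin (w v : fockFin μ) :
    ∃ ℓ : Lp ℂ 2 μ, ∀ h, (inner ℂ (w : Fock μ) (creFin h v : Fock μ) : ℂ) = inner ℂ ℓ h := by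
  obtain ⟨N, hN⟩ := v.2
  let L : Lp ℂ 2 μ →L[ℂ] ℂ := ∑ m ∈ Finset.range N,
    (innerSL ℂ ((w : Fock μ) (m + 1))).comp ((createL μ m).flip ((v : Fock μ) m))
  refine ⟨(InnerProductSpace.toDual ℂ _).symm L, fun h => ?_⟩
  rw [InnerProductSpace.toDual_symm_apply, creFin_eq_sum h hN, inner_sum,
    sum_apply]
  refine Finset.sum_congr rfl fun m _ => ?_
  rw [lp.inner_single_right]
  rfl

theorem exists_inner_fieldFin (w v : fockFin μ) :
    ∃ ℓ ℓ' : Lp ℂ 2 μ, ∀ h, (inner ℂ (w : Fock μ) (fieldFin h v : Fock μ) : ℂ)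
      = inner ℂ ℓ h + starRingEnd ℂ (inner ℂ ℓ' h) := by
  obtain ⟨ℓ, hℓ⟩ := exists_inner_creFin w v
  obtain ⟨ℓ', hℓ'⟩ := exists_inner_creFin v w
  refine ⟨(((Real.sqrt 2)⁻¹ : ℝ) : ℂ) • ℓ, (((Real.sqrt 2)⁻¹ : ℝ) : ℂ) • ℓ', fun h => ?_⟩
  have h1 : (inner ℂ (w : Fock μ) (annFin h v : Fock μ) : ℂ) = starRingEnd ℂ (inner ℂ ℓ' h) := by
    rw [← hℓ', ← inner_annFin_left, inner_conj_symm]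
  rw [fieldFin_apply, Submodule.coe_smul, Submodule.coe_add, inner_smul_right, inner_add_right,
    hℓ, h1, inner_smul_left, inner_smul_left, map_mul, Complex.conj_conj, Complex.conj_ofReal]
  ring

variable {n : ℕ}

/-- The field operators `φ(G(x))` depend weakly differentiably on `x` if `G` does. -/
theorem isBddWeakDeriv_fieldFin {j : Fin n} {G K : EuclideanSpace ℝ (Fin n) → Lp ℂ 2 μ}
    (hG : MemLp G ∞ volume) (hK : MemLp K ∞ volume)
    (h : ∀ (ℓ : Lp ℂ 2 μ) (f : EuclideanSpace ℝ (Fin n) → ℂ), IsTest f →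
      ∫ x, partialDeriv j f x * inner ℂ ℓ (G x) = - ∫ x, f x * inner ℂ ℓ (K x))
    (v : fockFin μ) :
    IsBddWeakDeriv j (fun x => (fieldFin (G x) v : Fock μ)) fun x => (fieldFin (K x) v : Fock μ) := by
  have hmem : ∀ {g : EuclideanSpace ℝ (Fin n) → Lp ℂ 2 μ}, MemLp g ∞ volume →
      MemLp (fun x => (fieldFin (g x) v : Fock μ)) ∞ volume := by
    intro g hg
    obtain ⟨N, hN⟩ := v.2
    obtain ⟨C, -, hC⟩ := exists_norm_fieldTrunc_le μ N
    have hb : ∀ x, ‖fieldTrunc N (g x) v‖ ≤ C * ‖(v : Fock μ)‖ * ‖g x‖ := fun x =>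
      (hC (g x) v).trans_eq (by ring)
    have hm : AEStronglyMeasurable (fun x => fieldTrunc N (g x) v) volume :=
      aestronglyMeasurable_fieldTrunc N hg.1 aestronglyMeasurable_const
    have he : (fun x => (fieldFin (g x) v : Fock μ)) = fun x => fieldTrunc N (g x) v :=
      funext fun x => fieldFin_eq_fieldTrunc (g x) hN
    rw [he]
    exact hg.of_le_mul hm (ae_of_all _ hb)
  refine isBddWeakDeriv_of_inner dense_fockFin (hmem hG) (hmem hK) fun w hw f hf => ?_
  obtain ⟨ℓ, ℓ', hℓ⟩ := exists_inner_fieldFin ⟨w, hw⟩ v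
  simp only at hℓ
  simp only [hℓ, mul_add]
  have hint : ∀ {f : EuclideanSpace ℝ (Fin n) → ℂ}, IsTest f →
      ∀ {g : EuclideanSpace ℝ (Fin n) → Lp ℂ 2 μ}, MemLp g ∞ volume → ∀ ℓ : Lp ℂ 2 μ,
      Integrable (fun x => f x * inner ℂ ℓ (g x)) := fun hf g hg ℓ =>
    hf.integrable_smul (hg.const_inner (𝕜 := ℂ) ℓ)
  have hintc : ∀ {f : EuclideanSpace ℝ (Fin n) → ℂ}, IsTest f →
      ∀ {g : EuclideanSpace ℝ (Fin n) → Lp ℂ 2 μ}, MemLp g ∞ volume → ∀ ℓ : Lp ℂ 2 μ,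
      Integrable (fun x => f x * starRingEnd ℂ (inner ℂ ℓ (g x))) := fun hf g hg ℓ =>
    hf.integrable_smul (hg.const_inner (𝕜 := ℂ) ℓ).star
  rw [integral_add (hint (hf.partialDeriv j) hG ℓ) (hintc (hf.partialDeriv j) hG ℓ'),
    integral_add (hint hf hK ℓ) (hintc hf hK ℓ'), h ℓ f hf]
  -- The antilinear, annihilation part obeys the conjugate of the scalar relation, taken for the
  -- conjugate test function.
  have h2 := congrArg (starRingEnd ℂ) (h ℓ' _ hf.conj)
  rw [map_neg, ← integral_conj, ← integral_conj] at h2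
  simp only [map_mul, partialDeriv_conj hf, Complex.conj_conj] at h2
  rw [h2]
  ring

end FieldTrunc

/-! ### The coupling operator -/

section Abstract

variable {H₁ H₂ H₃ : Type*} [NormedAddCommGroup H₁] [InnerProductSpace ℂ H₁]
  [NormedAddCommGroup H₂] [InnerProductSpace ℂ H₂] [NormedAddCommGroup H₃] [InnerProductSpace ℂ H₃]

/-- If `T` is bounded relative to `R`, it maps sequences which converge in the graph norm of `R`
to convergent sequences. -/
theorem exists_tendsto_of_graph_bound [CompleteSpace H₂] {T : H₁ →ₗ.[ℂ] H₂} {R : H₁ →ₗ.[ℂ] H₃}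
    {k : ℝ} (hT : ∀ x y z, (x, y) ∈ T.graph → (x, z) ∈ R.graph → ‖y‖ ^ 2 ≤ k * (‖z‖ ^ 2 + ‖x‖ ^ 2))
    {x : ℕ → H₁} {y : ℕ → H₂} {z : ℕ → H₃} (hy : ∀ N, (x N, y N) ∈ T.graph)
    (hz : ∀ N, (x N, z N) ∈ R.graph) {x₀ : H₁} {z₀ : H₃} (hx₀ : Tendsto x atTop (𝓝 x₀))
    (hz₀ : Tendsto z atTop (𝓝 z₀)) : ∃ y₀, Tendsto y atTop (𝓝 y₀) := by
  refine cauchySeq_tendsto_of_complete (Metric.cauchySeq_iff.2 fun ε hε => ?_)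
  have hk : 0 < |k| + 1 := by positivity
  -- Chosen so that (|k| + 1) · 2δ² = ε²/2; the absolute value allows any sign of `k`.
  set δ : ℝ := ε / (2 * Real.sqrt (|k| + 1)) with hδ
  have hδ0 : 0 < δ := div_pos hε (mul_pos two_pos (Real.sqrt_pos.2 hk))
  obtain ⟨N₁, h₁⟩ := Metric.cauchySeq_iff.1 hx₀.cauchySeq δ hδ0
  obtain ⟨N₂, h₂⟩ := Metric.cauchySeq_iff.1 hz₀.cauchySeq δ hδ0
  refine ⟨max N₁ N₂, fun M hM N hN => ?_⟩
  have h3 := h₁ M ((le_max_left _ _).trans hM) N ((le_max_left _ _).trans hN)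
  have h4 := h₂ M ((le_max_right _ _).trans hM) N ((le_max_right _ _).trans hN)
  rw [dist_eq_norm] at h3 h4 ⊢
  have h5 := hT _ _ _ (T.graph.sub_mem (hy M) (hy N)) (R.graph.sub_mem (hz M) (hz N))
  have h6 : ‖x M - x N‖ ^ 2 ≤ δ ^ 2 := pow_le_pow_left₀ (norm_nonneg _) h3.le 2
  have h7 : ‖z M - z N‖ ^ 2 ≤ δ ^ 2 := pow_le_pow_left₀ (norm_nonneg _) h4.le 2
  have h8 : (|k| + 1) * (δ ^ 2 + δ ^ 2) = ε ^ 2 / 2 := by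
    rw [hδ, div_pow, mul_pow, Real.sq_sqrt hk.le]
    field_simp
    ring
  have h9 : k * (‖z M - z N‖ ^ 2 + ‖x M - x N‖ ^ 2) ≤ (|k| + 1) * (δ ^ 2 + δ ^ 2) :=
    mul_le_mul ((le_abs_self k).trans (by linarith)) (add_le_add h7 h6) (by positivity) hk.le
  refine lt_of_pow_lt_pow_left₀ 2 hε.le ?_
  have : 0 < ε ^ 2 := by positivity
  exact (h5.trans (h9.trans h8.le)).trans_lt (by linarith)

theorem inner_eq_of_mem_graph_closure_symm {T : H₁ →ₗ.[ℂ] H₁}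
    (h : ∀ x y v w, (x, y) ∈ T.graph → (v, w) ∈ T.graph → (inner ℂ y v : ℂ) = inner ℂ x w)
    {x y v w : H₁} (hxy : (x, y) ∈ T.closure.graph) (hvw : (v, w) ∈ T.closure.graph) :
    (inner ℂ y v : ℂ) = inner ℂ x w := by
  have h1 : ∀ a b, (a, b) ∈ T.graph → (inner ℂ x b : ℂ) = inner ℂ y a := fun a b hab => by
    have := inner_eq_of_mem_graph_closure (v := a) (w := b)
      (fun c d hcd => (h a b c d hab hcd).symm) hxy
    rw [← inner_conj_symm, ← this, inner_conj_symm]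
  exact (inner_eq_of_mem_graph_closure h1 hvw).symm

end Abstract

/-! ### Domain, symmetry and product rule for the coupling operator -/

section Coupling

variable {n d p : ℕ}

theorem mem_hilbFin_iff {ψ : Hilb n d p} :
    ψ ∈ hilbFin n d p ↔ ∃ N : ℕ, ∀ᵐ x, ∀ m, N ≤ m → ψ x m = 0 := by
  refine exists_congr fun N => ?_
  rw [ae_all_iff]
  exact forall_congr' fun m => eventually_imp_distrib_left.symm

theorem ae_mem_fockFin {ψ : Hilb n d p} (hψ : ψ ∈ hilbFin n d p) :
    ∀ᵐ x, ψ x ∈ fockFin (modeMeasure d p) := by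
  obtain ⟨N, hN⟩ := mem_hilbFin_iff.1 hψ
  filter_upwards [hN] with x hx
  exact ⟨N, hx⟩

theorem numCut_mem_hilbFin (N : ℕ) (ψ : Hilb n d p) :
    (Multiplier.numCut _ N).onL2 (modeMeasure d p) n ψ ∈ hilbFin n d p := by
  refine mem_hilbFin_iff.2 ⟨N, ?_⟩
  filter_upwards [isMulL2_onL2 (Multiplier.numCut _ N) ψ] with x hx m hm
  refine (hx m).unique ?_
  filter_upwards [Lp.coeFn_zero ℂ 2 (Measure.pi fun _ : Fin m => modeMeasure d p)] with k hk
  rw [Multiplier.numCut_apply, if_neg (not_lt.2 hm), Complex.ofReal_zero, zero_mul]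
  exact hk

variable {G K : EuclideanSpace ℝ (Fin n) → OneParticle d p}

/-- The operator whose closure is `coupling G`. -/
def preCoupling (G : EuclideanSpace ℝ (Fin n) → OneParticle d p) : Hilb n d p →ₗ.[ℂ] Hilb n d p :=
  (pointwise fun x => field (modeMeasure d p) (G x)).domRestrict (hilbFin n d p)

theorem mem_graph_preCoupling {ψ χ : Hilb n d p} : (ψ, χ) ∈ (preCoupling G).graph ↔
    ψ ∈ hilbFin n d p ∧
      ∀ᵐ x, ∃ h : ψ x ∈ fockFin (modeMeasure d p), χ x = fieldFin (G x) ⟨ψ x, h⟩ := by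
  rw [preCoupling, mem_graph_domRestrict, mem_graph_pointwise]
  refine and_congr_right fun hψ => ?_
  have h1 := ae_mem_fockFin hψ
  constructor <;> intro h
  · filter_upwards [h, h1] with x h2 h3
    exact ⟨h3, (mem_graph_field_iff (G x) ⟨ψ x, h3⟩).1 h2⟩
  · filter_upwards [h] with x ⟨h2, h3⟩
    exact (mem_graph_field_iff (G x) ⟨ψ x, h2⟩).2 h3

/-- Below `N` particles φ(G(x)) is bounded by a constant times ‖G(x)‖, which is essentially bounded,
so the fibrewise result is square integrable. -/
theorem exists_mem_graph_preCoupling (hG : EssBounded G) {ψ : Hilb n d p}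
    (hψ : ψ ∈ hilbFin n d p) : ∃ χ ∈ hilbFin n d p, (ψ, χ) ∈ (preCoupling G).graph := by
  obtain ⟨N, hN⟩ := mem_hilbFin_iff.1 hψ
  obtain ⟨C, hC0, hC⟩ := exists_norm_fieldTrunc_le (modeMeasure d p) N
  have hm : AEStronglyMeasurable (fun x => fieldTrunc N (G x) (ψ x)) volume :=
    aestronglyMeasurable_fieldTrunc N hG.1 (Lp.aestronglyMeasurable ψ)
  obtain ⟨B, hB⟩ : ∃ B : ℝ, ∀ᵐ x, ‖G x‖ ≤ B := by
    refine ⟨(eLpNormEssSup G volume).toReal, ?_⟩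
    filter_upwards [ae_le_eLpNormEssSup (f := G)] with x hx
    rw [← toReal_enorm]
    exact ENNReal.toReal_mono (by simpa using hG.2.ne) hx
  have hL : MemLp (fun x => fieldTrunc N (G x) (ψ x)) 2 volume := by
    refine (Lp.memLp ψ).of_le_mul (c := C * B) hm ?_
    filter_upwards [hB] with x hx
    refine (hC _ _).trans ?_
    rw [mul_assoc]
    exact mul_le_mul_of_nonneg_left (mul_le_mul_of_nonneg_right hx (norm_nonneg _)) hC0
  have h1 : ∀ᵐ x, ∃ h : ψ x ∈ fockFin (modeMeasure d p),
      hL.toLp _ x = fieldFin (G x) ⟨ψ x, h⟩ := by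
    filter_upwards [hN, hL.coeFn_toLp] with x h2 h3
    refine ⟨⟨N, h2⟩, ?_⟩
    rw [h3, fieldFin_eq_fieldTrunc (G x) (u := ⟨ψ x, N, h2⟩) h2]
  -- The field operator raises the particle number by at most one.
  refine ⟨hL.toLp _, mem_hilbFin_iff.2 ⟨N + 1, ?_⟩, mem_graph_preCoupling.2 ⟨hψ, h1⟩⟩
  filter_upwards [h1, hN] with x ⟨h2, h3⟩ h4 m hm
  rw [h3, fieldFin_apply, Submodule.coe_smul, Submodule.coe_add, lp.coeFn_smul, Pi.smul_apply,
    lp.coeFn_add, Pi.add_apply, annFin_apply]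
  obtain ⟨m, rfl⟩ : ∃ l, m = l + 1 := ⟨m - 1, by omega⟩
  rw [creFin_succ]
  change _ • (annihL _ _ _ (ψ x (m + 1 + 1)) + createL _ _ _ (ψ x m)) = 0
  rw [h4 _ (by omega), h4 _ (by omega), map_zero, map_zero, add_zero, smul_zero]

theorem preCoupling_symmetric {ψ χ ψ' χ' : Hilb n d p} (h : (ψ, χ) ∈ (preCoupling G).graph)
    (h' : (ψ', χ') ∈ (preCoupling G).graph) : (inner ℂ χ ψ' : ℂ) = inner ℂ ψ χ' := by
  rw [L2.inner_def, L2.inner_def]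
  refine integral_congr_ae ?_
  filter_upwards [(mem_graph_preCoupling.1 h).2, (mem_graph_preCoupling.1 h').2] with x ⟨h1, h2⟩
    ⟨h3, h4⟩
  rw [h2, h4]
  exact fieldFin_symmetric (G x) ⟨ψ x, h1⟩ ⟨ψ' x, h3⟩

theorem eq_zero_of_inner_hilbFin {y : Hilb n d p}
    (h : ∀ v ∈ hilbFin n d p, (inner ℂ v y : ℂ) = 0) : y = 0 := by
  have h1 : Tendsto (fun N => (inner ℂ ((Multiplier.numCut _ N).onL2 (modeMeasure d p) n y) y : ℂ))
      atTop (𝓝 (inner ℂ y y)) := (tendsto_numCut y).inner tendsto_const_nhds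
  simp only [h _ (numCut_mem_hilbFin _ y)] at h1
  exact inner_self_eq_zero.1 (tendsto_nhds_unique h1 tendsto_const_nhds)

theorem preCoupling_isClosable (hG : EssBounded G) : (preCoupling G).IsClosable := by
  refine isClosable_of_formalAdjoint (D := hilbFin n d p) (fun y => eq_zero_of_inner_hilbFin) ?_
  intro v hv
  obtain ⟨w, -, hw⟩ := exists_mem_graph_preCoupling hG hv
  exact ⟨w, fun x y hxy => (preCoupling_symmetric hw hxy).symm⟩

theorem coupling_symmetric {ψ χ ψ' χ' : Hilb n d p} (h : (ψ, χ) ∈ (coupling G).graph)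
    (h' : (ψ', χ') ∈ (coupling G).graph) : (inner ℂ χ ψ' : ℂ) = inner ℂ ψ χ' :=
  inner_eq_of_mem_graph_closure_symm (T := preCoupling G)
    (fun _ _ _ _ => preCoupling_symmetric) h h'

theorem norm_sq_le_of_ae {E : Type*} [NormedAddCommGroup E] [InnerProductSpace ℂ E]
    {y z x : L2 n E} {k : ℝ} (h : ∀ᵐ t, ‖y t‖ ^ 2 ≤ k * (‖z t‖ ^ 2 + ‖x t‖ ^ 2)) :
    ‖y‖ ^ 2 ≤ k * (‖z‖ ^ 2 + ‖x‖ ^ 2) := by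
  rw [norm_sq_eq_integral, norm_sq_eq_integral, norm_sq_eq_integral,
    ← integral_add (integrable_norm_sq _) (integrable_norm_sq _), ← integral_const_mul]
  exact integral_mono_ae (integrable_norm_sq _)
    (((integrable_norm_sq _).add (integrable_norm_sq _)).const_mul _) h

variable {w : EuclideanSpace ℝ (Fin d) × Fin p → ℝ≥0} {C : ℝ}

theorem norm_preCoupling_sq_le (hw : Measurable w) (hC : ∀ᵐ x, WeightBound w (G x) C)
    {ψ χ ξ : Hilb n d p} (h : (ψ, χ) ∈ (preCoupling G).graph)
    (hξ : IsMulL2 (fun m k => Real.sqrt (weight w m k)) ψ ξ) :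
    ‖χ‖ ^ 2 ≤ 2 * C ^ 2 * (‖ξ‖ ^ 2 + ‖ψ‖ ^ 2) := by
  refine norm_sq_le_of_ae ?_
  filter_upwards [(mem_graph_preCoupling.1 h).2, hC, hξ] with x ⟨h1, h2⟩ h3 h4
  rw [h2]
  exact norm_fieldFin_sq_le hw h3 ⟨ψ x, h1⟩ h4

theorem norm_preCoupling_preCoupling_sq_le (hw : Measurable w)
    (hC : ∀ᵐ x, WeightBound w (G x) C) {ψ χ χ' ξ : Hilb n d p}
    (h : (ψ, χ) ∈ (preCoupling G).graph) (h' : (χ, χ') ∈ (preCoupling G).graph)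
    (hξ : IsMulL2 (weight w) ψ ξ) :
    ‖χ'‖ ^ 2 ≤ 24 * C ^ 4 * (‖ξ‖ ^ 2 + ‖ψ‖ ^ 2) := by
  refine norm_sq_le_of_ae ?_
  filter_upwards [(mem_graph_preCoupling.1 h).2, (mem_graph_preCoupling.1 h').2, hC, hξ] with x
    ⟨h1, h2⟩ ⟨h3, h4⟩ h5 h6
  have : (⟨χ x, h3⟩ : fockFin (modeMeasure d p)) = fieldFin (G x) ⟨ψ x, h1⟩ := Subtype.ext h2
  rw [h4, this]
  exact norm_fieldFin_fieldFin_sq_le hw h5 ⟨ψ x, h1⟩ h6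

theorem IsMulL2.numCut {g : ∀ m : ℕ, (Fin m → EuclideanSpace ℝ (Fin d) × Fin p) → ℝ}
    {ψ χ : Hilb n d p} (h : IsMulL2 g ψ χ) (N : ℕ) :
    IsMulL2 g ((Multiplier.numCut _ N).onL2 (modeMeasure d p) n ψ)
      ((Multiplier.numCut _ N).onL2 (modeMeasure d p) n χ) := by
  filter_upwards [h, isMulL2_onL2 (Multiplier.numCut _ N) ψ,
    isMulL2_onL2 (Multiplier.numCut _ N) χ] with x h1 h2 h3 m
  filter_upwards [h1 m, h2 m, h3 m] with k h4 h5 h6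
  rw [h6, h5, h4]
  ring

/-- `D(H_f^{1/2}) ⊂ D(Φ(G))`. -/
theorem exists_mem_graph_coupling (hw : Measurable w) (hG : EssBounded G)
    (hC : ∀ᵐ x, WeightBound w (G x) C) {ψ ξ : Hilb n d p}
    (hξ : IsMulL2 (fun m k => Real.sqrt (weight w m k)) ψ ξ) :
    ∃ χ, (ψ, χ) ∈ (coupling G).graph := by
  choose χ _ hχ using fun N => exists_mem_graph_preCoupling hG (numCut_mem_hilbFin N ψ)
  obtain ⟨χ₀, h0⟩ := exists_tendsto_of_graph_bound (T := preCoupling G)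
    (R := pointwise fun _ => fockMul (modeMeasure d p) fun m k => Real.sqrt (weight w m k))
    (fun x y z hy hz => norm_preCoupling_sq_le hw hC hy (mem_graph_pointwise_fockMul.1 hz)) hχ
    (fun N => mem_graph_pointwise_fockMul.2 (hξ.numCut N)) (tendsto_numCut ψ) (tendsto_numCut ξ)
  exact ⟨χ₀, mem_graph_closure_of_tendsto (preCoupling_isClosable hG) hχ (tendsto_numCut ψ) h0⟩

/-- `D(H_f) ⊂ D(Φ(G)²)`. -/
theorem exists_mem_graph_coupling_coupling (hw : Measurable w) (hG : EssBounded G)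
    (hC : ∀ᵐ x, WeightBound w (G x) C) {ψ ξ : Hilb n d p} (hξ : IsMulL2 (weight w) ψ ξ) :
    ∃ χ χ', (ψ, χ) ∈ (coupling G).graph ∧ (χ, χ') ∈ (coupling G).graph := by
  obtain ⟨ξ₁, hξ₁⟩ := hξ.exists_sqrt hw
  choose χ hχf hχ using fun N => exists_mem_graph_preCoupling hG (numCut_mem_hilbFin N ψ)
  choose χ' _ hχ' using fun N => exists_mem_graph_preCoupling hG (hχf N)
  obtain ⟨χ₀, h0⟩ := exists_tendsto_of_graph_bound (T := preCoupling G)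
    (R := pointwise fun _ => fockMul (modeMeasure d p) fun m k => Real.sqrt (weight w m k))
    (fun x y z hy hz => norm_preCoupling_sq_le hw hC hy (mem_graph_pointwise_fockMul.1 hz)) hχ
    (fun N => mem_graph_pointwise_fockMul.2 (hξ₁.numCut N)) (tendsto_numCut ψ) (tendsto_numCut ξ₁)
  -- The twice applied operator is estimated as a whole relative to H_f. The same truncations serve
  -- both limits, so `χ₀` is a common limit and closedness can be used a second time.
  obtain ⟨χ₀', h0'⟩ := exists_tendsto_of_graph_bound (T := opComp (preCoupling G) (preCoupling G))
    (R := pointwise fun _ => fockMul (modeMeasure d p) (weight w))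
    (fun x y z hy hz => by
      obtain ⟨u, hu, hu'⟩ := mem_graph_opComp.1 hy
      exact norm_preCoupling_preCoupling_sq_le hw hC hu hu' (mem_graph_pointwise_fockMul.1 hz))
    (fun N => mem_graph_opComp.2 ⟨_, hχ N, hχ' N⟩)
    (fun N => mem_graph_pointwise_fockMul.2 (hξ.numCut N)) (tendsto_numCut ψ) (tendsto_numCut ξ)
  have hcl := preCoupling_isClosable hG
  exact ⟨χ₀, χ₀', mem_graph_closure_of_tendsto hcl hχ (tendsto_numCut ψ) h0,
    mem_graph_closure_of_tendsto hcl hχ' h0 h0'⟩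

/-- The test vector has finitely many particles, so symmetry transfers Φ(G) to it, where it acts
fibrewise on the fixed vector `v`. -/
theorem inner_testVec_coupling (hG : EssBounded G) {φ χ : Hilb n d p}
    (h : (φ, χ) ∈ (coupling G).graph) {f : EuclideanSpace ℝ (Fin n) → ℂ} (hf : IsTest f)
    (v : fockFin (modeMeasure d p)) :
    Integrable (fun x => f x * inner ℂ (fieldFin (G x) v : Fock (modeMeasure d p)) (φ x)) volume ∧
    (inner ℂ (testVec hf (v : Fock (modeMeasure d p))) χ : ℂ)
      = ∫ x, f x * inner ℂ (fieldFin (G x) v : Fock (modeMeasure d p)) (φ x) := by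
  have hcoe : ∀ᵐ x, testVec (n := n) hf (v : Fock (modeMeasure d p)) x
      = starRingEnd ℂ (f x) • (v : Fock (modeMeasure d p)) :=
    (memLp_smul_const hf (v : Fock (modeMeasure d p))).coeFn_toLp
  have hfin : testVec hf (v : Fock (modeMeasure d p)) ∈ hilbFin n d p := by
    obtain ⟨N, hN⟩ := v.2
    refine mem_hilbFin_iff.2 ⟨N, ?_⟩
    filter_upwards [hcoe] with x hx m hm
    rw [hx, lp.coeFn_smul, Pi.smul_apply, hN m hm, smul_zero]
  obtain ⟨τ, -, hτ⟩ := exists_mem_graph_preCoupling hG hfin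
  have h1 : ∀ᵐ x, (inner ℂ (τ x) (φ x) : ℂ)
      = f x * inner ℂ (fieldFin (G x) v : Fock (modeMeasure d p)) (φ x) := by
    filter_upwards [(mem_graph_preCoupling.1 hτ).2, hcoe] with x ⟨h2, h3⟩ h4
    have h5 : (⟨testVec hf (v : Fock (modeMeasure d p)) x, h2⟩ : fockFin (modeMeasure d p))
        = starRingEnd ℂ (f x) • v := Subtype.ext h4
    rw [h3, h5, map_smul, Submodule.coe_smul, inner_smul_left, Complex.conj_conj]
  refine ⟨(L2.integrable_inner (𝕜 := ℂ) τ φ).congr h1, ?_⟩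
  rw [← integral_congr_ae h1, ← L2.inner_def]
  exact (coupling_symmetric (mem_graph_closure_of_mem_graph hτ) h).symm

/-- The product rule `∂_j (Φ(G) φ) = Φ(∂_j G) φ + Φ(G) ∂_j φ`. -/
theorem isWeakDeriv_coupling {j : Fin n} (h : HasWeakDeriv j G K) {φ η χ χ₁ χ₂ : Hilb n d p}
    (hη : IsWeakDeriv j φ η) (hχ : (φ, χ) ∈ (coupling G).graph)
    (hχ₁ : (φ, χ₁) ∈ (coupling K).graph) (hχ₂ : (η, χ₂) ∈ (coupling G).graph) :
    IsWeakDeriv j χ (χ₁ + χ₂) := by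
  obtain ⟨hG, hK, hGK⟩ := h
  refine (isWeakDeriv_iff_inner (dense_fockFin (μ := modeMeasure d p))).2 fun f hf v hv => ?_
  have h1 := inner_testVec_coupling hG hχ (hf.partialDeriv j) ⟨v, hv⟩
  have h2 := inner_testVec_coupling hK hχ₁ hf ⟨v, hv⟩
  have h3 := inner_testVec_coupling hG hχ₂ hf ⟨v, hv⟩
  have h4 := (isBddWeakDeriv_fieldFin hG hK (fun ℓ f hf => hGK ℓ f hf.smooth hf.compact)
    ⟨v, hv⟩).integral_inner hη hf
  rw [inner_add_right, h2.2, h3.2, ← integral_add h2.1 h3.1, h1.2, h4]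
  simp only [mul_add]

end Coupling

/-! ### The form domain and the Hamiltonian -/

section FormDomain

variable {n : ℕ}

theorem IsTest.integral_partialDeriv {f : EuclideanSpace ℝ (Fin n) → ℂ} (hf : IsTest f)
    (j : Fin n) : ∫ x, PauliFierz.partialDeriv j f x = 0 := by
  have h := integral_mul_fderiv_eq_neg_fderiv_mul_of_integrable (𝕜 := ℂ) (μ := volume)
    (f := fun _ : EuclideanSpace ℝ (Fin n) => (1 : ℂ)) (g := f) (v := EuclideanSpace.single j 1)
    (by simp) (by
      simp only [one_mul]
      exact memLp_one_iff_integrable.1 ((hf.partialDeriv j).memLp 1))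
    (by simpa using memLp_one_iff_integrable.1 (hf.memLp 1))
    (fun x _ => differentiableAt_const _) (fun x _ => hf.differentiable x)
  simpa [PauliFierz.partialDeriv] using h

/-- Combined with `isWeakDeriv_smul`, this differentiates the test vectors themselves and places
them in the momentum domains. -/
theorem isBddWeakDeriv_const {F : Type*} [NormedAddCommGroup F] [InnerProductSpace ℂ F]
    [CompleteSpace F] (j : Fin n) (v : F) :
    IsBddWeakDeriv j (fun _ : EuclideanSpace ℝ (Fin n) => v) fun _ => 0 := by
  refine ⟨memLp_top_const _, memLp_top_const _, fun f hf => ?_⟩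
  rw [integral_smul_const, hf.integral_partialDeriv]
  simp

theorem mem_graph_momentum_neg_I {F : Type*} [NormedAddCommGroup F] [InnerProductSpace ℂ F]
    [CompleteSpace F] {j : Fin n} {u η : L2 n F} (h : IsWeakDeriv j u η) :
    (u, -(Complex.I • η)) ∈ (momentum F j).graph := by
  refine mem_graph_momentum.2 ?_
  rwa [smul_neg, smul_smul, Complex.I_mul_I, neg_smul, one_smul, neg_neg]

theorem testVec_mem_momentum_domain {F : Type*} [NormedAddCommGroup F] [InnerProductSpace ℂ F]
    [CompleteSpace F] (j : Fin n) {f : EuclideanSpace ℝ (Fin n) → ℂ} (hf : IsTest f) (v : F) :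
    testVec hf v ∈ (momentum F j).domain := by
  exact LinearPMap.mem_domain_iff.2 ⟨_,
    mem_graph_momentum_neg_I ((isBddWeakDeriv_const j v).isWeakDeriv_smul hf.conj)⟩

variable {d p : ℕ} {ω : EuclideanSpace ℝ (Fin d) → ℝ≥0}

theorem mem_graph_fieldEnergy {ψ χ : Hilb n d p} : (ψ, χ) ∈ (fieldEnergy n p ω).graph ↔
    IsMulL2 (weight fun k : EuclideanSpace ℝ (Fin d) × Fin p => ω k.1) ψ χ :=
  mem_graph_pointwise_fockMul

theorem mem_graph_fieldEnergySqrt {ψ χ : Hilb n d p} : (ψ, χ) ∈ (fieldEnergySqrt n p ω).graph ↔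
    IsMulL2 (fun m k => Real.sqrt
      (weight (fun k : EuclideanSpace ℝ (Fin d) × Fin p => ω k.1) m k)) ψ χ :=
  mem_graph_pointwise_fockMul

/-- Scalar test functions times vectors of `sqrtDomain` belong to the form domain, and they are
total because `sqrtDomain` is dense in Fock space. -/
theorem dense_formDomain (hω : Measurable ω) : Dense (formDomain n p ω : Set (Hilb n d p)) := by
  rw [Submodule.dense_iff_topologicalClosure_eq_top, Submodule.topologicalClosure_eq_top_iff,
    Submodule.eq_bot_iff]
  intro y hy
  have hw : Measurable fun k : EuclideanSpace ℝ (Fin d) × Fin p => ω k.1 := hω.comp measurable_fst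
  refine ext_testVec (dense_sqrtDomain (μ := modeMeasure d p) hw) fun f hf v hv =>
    (Submodule.mem_orthogonal _ _).1 hy _ (Submodule.mem_inf.2 ⟨?_, ?_⟩)
  · exact Submodule.mem_iInf _ |>.2 fun j => testVec_mem_momentum_domain j hf v
  · obtain ⟨χ, hχ⟩ := mem_sqrtDomain.1 hv
    refine LinearPMap.mem_domain_iff.2 ⟨testVec hf χ, mem_graph_fieldEnergySqrt.2 ?_⟩
    filter_upwards [(memLp_smul_const hf v).coeFn_toLp, (memLp_smul_const hf χ).coeFn_toLp] with x
      h1 h2 m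
    change testVec hf v x = _ at h1
    change testVec hf χ x = _ at h2
    rw [h1, h2]
    filter_upwards [hχ m,
      Lp.coeFn_smul (starRingEnd ℂ (f x)) (v m : TensorPower (modeMeasure d p) m),
      Lp.coeFn_smul (starRingEnd ℂ (f x)) (χ m : TensorPower (modeMeasure d p) m)] with k h3 h4 h5
    refine h5.trans (Eq.trans ?_ (congrArg _ h4.symm))
    rw [Pi.smul_apply, Pi.smul_apply, h3, smul_eq_mul, smul_eq_mul, mul_left_comm]

/-- A uniform bound on `‖G(x)‖_ω`. -/
theorem exists_weightBound (hω : Measurable ω) (hω0 : ∀ᵐ k, ω k ≠ 0)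
    {G : EuclideanSpace ℝ (Fin n) → OneParticle d p} (hG : OmegaBounded ω G) :
    ∃ C, ∀ᵐ x, WeightBound (fun k : EuclideanSpace ℝ (Fin d) × Fin p => ω k.1) (G x) C := by
  refine ⟨(essSup (fun x => omegaNorm ω (G x)) volume).toReal, ?_⟩
  have h1 : ∀ᵐ x, omegaNorm ω (G x) ≤ essSup (fun x => omegaNorm ω (G x)) volume := ae_le_essSup
  filter_upwards [h1] with x hx
  set A := eLpNorm (G x) 2 (modeMeasure d p) with hA
  set B := eLpNorm (fun k => G x k / (Real.sqrt (ω k.1) : ℂ)) 2 (modeMeasure d p) with hB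
  have h2 : ∀ a b : ℝ≥0∞, a ≤ (a ^ 2 + b ^ 2) ^ (1 / 2 : ℝ) := fun a b => by
    calc a = (a ^ 2) ^ (1 / 2 : ℝ) := by
          rw [← ENNReal.rpow_natCast, ← ENNReal.rpow_mul]; norm_num
      _ ≤ _ := ENNReal.rpow_le_rpow le_self_add (by norm_num)
  have hAC : A ≤ essSup (fun x => omegaNorm ω (G x)) volume := (h2 A B).trans hx
  have hBC : B ≤ essSup (fun x => omegaNorm ω (G x)) volume := by
    have h3 := h2 B A
    rw [add_comm] at h3
    exact h3.trans hx
  have hm : AEStronglyMeasurable (fun k => G x k / (Real.sqrt (ω k.1) : ℂ)) (modeMeasure d p) := by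
    refine (Lp.aestronglyMeasurable (G x)).div₀ ?_
    have : Measurable fun k : EuclideanSpace ℝ (Fin d) × Fin p => (Real.sqrt (ω k.1) : ℂ) :=
      Complex.measurable_ofReal.comp (hω.comp measurable_fst).coe_nnreal_real.sqrt
    exact this.aestronglyMeasurable
  have hL : MemLp (fun k => G x k / (Real.sqrt (ω k.1) : ℂ)) 2 (modeMeasure d p) :=
    ⟨hm, hBC.trans_lt hG.2⟩
  refine ⟨ENNReal.toReal_nonneg, ENNReal.toReal_mono hG.2.ne hAC, hL.toLp _, ?_, ?_⟩
  · rw [Lp.norm_toLp]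
    exact ENNReal.toReal_mono hG.2.ne hBC
  -- Division by zero gives zero, so recovering `G x` as √ω times the quotient requires ω ≠ 0 almost
  -- everywhere.
  · have h3 : ∀ᵐ k ∂(modeMeasure d p), ω k.1 ≠ 0 := Measure.quasiMeasurePreserving_fst.ae hω0
    filter_upwards [h3, hL.coeFn_toLp] with k h4 h5
    rw [h5, mul_div_cancel₀]
    exact_mod_cast (Real.sqrt_pos.2 (by positivity : (0 : ℝ) < ω k.1)).ne'

end FormDomain

/-! ### The square of the kinetic operator and the comparison of the two Hamiltonians -/

section Hamiltonian

variable {n d p : ℕ} {ω : EuclideanSpace ℝ (Fin d) → ℝ≥0}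
  {G K : Fin n → EuclideanSpace ℝ (Fin n) → OneParticle d p}

theorem exists_of_mem_graph_add {H₁ H₂ : Type*} [AddCommGroup H₁] [Module ℂ H₁] [AddCommGroup H₂]
    [Module ℂ H₂] {S R : H₁ →ₗ.[ℂ] H₂} {x : H₁} {y : H₂} (h : (x, y) ∈ (S + R).graph) :
    ∃ a b, (x, a) ∈ S.graph ∧ (x, b) ∈ R.graph ∧ a + b = y := by
  obtain ⟨hx, rfl⟩ := mem_graph_iff_exists.1 h
  exact ⟨_, _, mem_graph_iff_exists.2 ⟨hx.1, rfl⟩, mem_graph_iff_exists.2 ⟨hx.2, rfl⟩, rfl⟩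

theorem kinetic_symmetric {j : Fin n} {ψ χ ψ' χ' : Hilb n d p} (h : (ψ, χ) ∈ (kinetic G j).graph)
    (h' : (ψ', χ') ∈ (kinetic G j).graph) : (inner ℂ χ ψ' : ℂ) = inner ℂ ψ χ' := by
  obtain ⟨a, b, ha, hb, rfl⟩ := exists_of_mem_graph_add h
  obtain ⟨a', b', ha', hb', rfl⟩ := exists_of_mem_graph_add h'
  rw [inner_add_left, inner_add_right, momentum_symmetric ha ha', coupling_symmetric hb hb']

/-- This inclusion rules out the zero convention in `onSubspace`, so the kinetic terms of `form`
have their literal meaning. -/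
theorem formDomain_le_kinetic_domain (hω : Measurable ω) (hω0 : ∀ᵐ k, ω k ≠ 0) {j : Fin n}
    (hG : OmegaBounded ω (G j)) (hG' : EssBounded (G j)) :
    formDomain n p ω ≤ (kinetic G j).domain := by
  intro ψ hψ
  obtain ⟨hψ1, hψ2⟩ := Submodule.mem_inf.1 hψ
  obtain ⟨ξ, hξ⟩ := LinearPMap.mem_domain_iff.1 hψ2
  obtain ⟨η, hη⟩ := LinearPMap.mem_domain_iff.1 ((Submodule.mem_iInf _).1 hψ1 j)
  obtain ⟨C, hC⟩ := exists_weightBound hω hω0 hG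
  obtain ⟨χ, hχ⟩ := exists_mem_graph_coupling (hω.comp measurable_fst) hG' hC
    (mem_graph_fieldEnergySqrt.1 hξ)
  exact LinearPMap.mem_domain_iff.2 ⟨_, mem_graph_add hη hχ⟩

/-- The domain of `p²` and `H_f` is contained in the domain of `(p_j + A_j)²`. -/
theorem exists_mem_graph_kinetic (hω : Measurable ω) (hω0 : ∀ᵐ k, ω k ≠ 0) {j : Fin n}
    (hG : OmegaBounded ω (G j)) (hGK : HasWeakDeriv j (G j) (K j)) (hK : OmegaBounded ω (K j))
    {φ ξ ζ : Hilb n d p} (hξ : (φ, ξ) ∈ (fieldEnergy n p ω).graph)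
    (hζ : (φ, ζ) ∈ (opComp (momentum (Fock (modeMeasure d p)) j)
      (momentum (Fock (modeMeasure d p)) j)).graph) :
    ∃ κ ν, (φ, κ) ∈ (kinetic G j).graph ∧ (κ, ν) ∈ (kinetic G j).graph := by
  have hw : Measurable fun k : EuclideanSpace ℝ (Fin d) × Fin p => ω k.1 := hω.comp measurable_fst
  obtain ⟨C, hC⟩ := exists_weightBound hω hω0 hG
  obtain ⟨C', hC'⟩ := exists_weightBound hω hω0 hK
  obtain ⟨η, hη, hηζ⟩ := mem_graph_opComp.1 hζ
  have hξ' := mem_graph_fieldEnergy.1 hξ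
  have hη' := mem_graph_momentum.1 hη
  obtain ⟨ξ₁, hξ₁⟩ := hξ'.exists_sqrt hw
  obtain ⟨ξ₂, hξ₂⟩ := hξ'.exists_sqrt_of_isWeakDeriv hw hη'
    ((mem_graph_momentum.1 hηζ).smul Complex.I)
  obtain ⟨a, b, ha, hb⟩ := exists_mem_graph_coupling_coupling hw hGK.1 hC hξ'
  obtain ⟨c, hc⟩ := exists_mem_graph_coupling hw hGK.2.1 hC' hξ₁
  obtain ⟨e, he⟩ := exists_mem_graph_coupling hw hGK.1 hC hξ₂
  have ha' := mem_graph_momentum_neg_I (isWeakDeriv_coupling hGK hη' ha hc he)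
  have he' : (η, -Complex.I • e) ∈ (coupling (G j)).graph := by
    have := (coupling (G j)).graph.smul_mem (-Complex.I) he
    rwa [Prod.smul_mk, smul_smul, neg_mul, Complex.I_mul_I, neg_neg, one_smul] at this
  -- Here η = p_j φ and a = A_j φ. The four terms exist for separate reasons: p_j η since φ ∈
  -- D(p_j²), p_j a by the product rule, A_j η since η ∈ D(H_f^{1/2}), and A_j a since D(H_f) ⊂
  -- D(A_j²).
  exact ⟨η + a, _, mem_graph_add hη ha, mem_graph_add
    ((momentum _ j).graph.add_mem hηζ ha') ((coupling (G j)).graph.add_mem he' hb)⟩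

/-- A single vector in both graphs yields the domain inclusions and the equality of the two
operators at once. -/
theorem exists_mem_graph_hamiltonian (hω : Measurable ω) (hω0 : ∀ᵐ k, ω k ≠ 0)
    (hG : ∀ j, OmegaBounded ω (G j)) (hGK : ∀ j, HasWeakDeriv j (G j) (K j))
    (hK : ∀ j, OmegaBounded ω (K j)) {φ : Hilb n d p} (hφ : φ ∈ (freeHamiltonian n p ω).domain) :
    ∃ η, (φ, η) ∈ (formHamiltonian ω G).graph ∧
      (φ, η) ∈ (kineticSq G + fieldEnergy n p ω).graph := by
  have hw : Measurable fun k : EuclideanSpace ℝ (Fin d) × Fin p => ω k.1 := hω.comp measurable_fst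
  obtain ⟨hφ1, hφ2⟩ : φ ∈ (momentumSq n (Fock (modeMeasure d p))).domain ∧
    φ ∈ (fieldEnergy n p ω).domain := hφ
  have hφ3 : φ ∈ sobolev2 n (Fock (modeMeasure d p)) := hφ1.1
  obtain ⟨hφ4, hφ5⟩ := Submodule.mem_inf.1 hφ3
  obtain ⟨ξ, hξ⟩ := LinearPMap.mem_domain_iff.1 hφ2
  obtain ⟨ξ₁, hξ₁⟩ := (mem_graph_fieldEnergy.1 hξ).exists_sqrt hw
  have hφQ : φ ∈ formDomain n p ω :=
    Submodule.mem_inf.2 ⟨hφ4, LinearPMap.mem_domain_iff.2 ⟨ξ₁, mem_graph_fieldEnergySqrt.2 hξ₁⟩⟩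
  have h1 : ∀ j, ∃ κ ν, (φ, κ) ∈ (kinetic G j).graph ∧ (κ, ν) ∈ (kinetic G j).graph := fun j => by
    obtain ⟨ζ, hζ⟩ := LinearPMap.mem_domain_iff.1
      ((Submodule.mem_iInf _).1 ((Submodule.mem_iInf _).1 hφ5 j) j)
    exact exists_mem_graph_kinetic hω hω0 (hG j) (hGK j) (hK j) hξ hζ
  choose κ ν hκ hν using h1
  refine ⟨∑ j, ν j + ξ, ?_, ?_⟩
  · refine (mem_graph_formOperator (dense_formDomain hω) _).2 ⟨⟨φ, hφQ⟩, rfl, fun ψ => ?_⟩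
    have h2 : ∀ j, formDomain n p ω ≤ (kinetic G j).domain := fun j =>
      formDomain_le_kinetic_domain hω hω0 (hG j) (hGK j).1
    have h3 : formDomain n p ω ≤ (fieldEnergySqrt n p ω).domain := inf_le_right
    change ∑ j : Fin n, inner ℂ (onSubspace (kinetic G j) (formDomain n p ω) ⟨φ, hφQ⟩)
          (onSubspace (kinetic G j) (formDomain n p ω) ψ) +
        inner ℂ (onSubspace (fieldEnergySqrt n p ω) (formDomain n p ω) ⟨φ, hφQ⟩)
          (onSubspace (fieldEnergySqrt n p ω) (formDomain n p ω) ψ) = _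
    rw [inner_add_left, sum_inner]
    congr 1
    · refine Finset.sum_congr rfl fun j _ => ?_
      rw [onSubspace_eq (h2 j) (φ := ⟨φ, hφQ⟩) (hκ j)]
      exact (kinetic_symmetric (hν j) (onSubspace_mem_graph (h2 j) ψ)).symm
    · rw [onSubspace_eq h3 (φ := ⟨φ, hφQ⟩) (mem_graph_fieldEnergySqrt.2 hξ₁)]
      -- The multipliers √s and √s are redistributed as s and 1, which moves the whole field energy
      -- onto φ.
      refine hξ₁.inner_eq (mem_graph_fieldEnergySqrt.1 (onSubspace_mem_graph h3 ψ))
        (mem_graph_fieldEnergy.1 hξ) (isMulL2_one _) fun m k => ?_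
      rw [Real.mul_self_sqrt (weight_nonneg _ m k)]
      exact (mul_one _).symm
  · exact mem_graph_add (mem_graph_sum _ fun j _ => mem_graph_opComp.2 ⟨κ j, hκ j, hν j⟩) hξ

end Hamiltonian

end PauliFierz

end

open PauliFierz in
theorem theorem2 (n d p : ℕ) (ω : EuclideanSpace ℝ (Fin d) → ℝ≥0) (hω : Measurable ω)
    (hω0 : ∀ᵐ k, ω k ≠ 0)
    (G K : Fin n → EuclideanSpace ℝ (Fin n) → OneParticle d p)
    (hG : ∀ j, OmegaBounded ω (G j))
    (hGK : ∀ j, HasWeakDeriv j (G j) (K j))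
    (hK : ∀ j, OmegaBounded ω (K j)) :
    (freeHamiltonian n p ω).domain ≤
        (formHamiltonian ω G).domain ⊓ (kineticSq G + fieldEnergy n p ω).domain ∧
      ∀ (φ : Hilb n d p) (_ : φ ∈ (freeHamiltonian n p ω).domain)
        (hT : φ ∈ (formHamiltonian ω G).domain)
        (hS : φ ∈ (kineticSq G + fieldEnergy n p ω).domain),
        formHamiltonian ω G ⟨φ, hT⟩ = (kineticSq G + fieldEnergy n p ω) ⟨φ, hS⟩ := by
  refine ⟨fun φ hφ => ?_, fun φ hφ hT hS => ?_⟩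
  · obtain ⟨η, h1, h2⟩ := exists_mem_graph_hamiltonian hω hω0 hG hGK hK hφ
    exact Submodule.mem_inf.2
      ⟨LinearPMap.mem_domain_iff.2 ⟨η, h1⟩, LinearPMap.mem_domain_iff.2 ⟨η, h2⟩⟩
  · obtain ⟨η, h1, h2⟩ := exists_mem_graph_hamiltonian hω hω0 hG hGK hK hφ
    obtain ⟨_, h3⟩ := mem_graph_iff_exists.1 h1
    obtain ⟨_, h4⟩ := mem_graph_iff_exists.1 h2
    exact h3.trans h4.symm
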